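/- Write $\mathbb N=\{1,2,\dots\}$, $[n]=\{1,\dots,n\}$. Let $\mathcal O$ be the space of (strict) total orders on $\mathbb N$ with the topology of convergence of all restrictions to the sets $[n]$, and its Borel $\sigma$-algebra. The restriction of $O\in\mathcal O$ to $[n]$ is the permutation $\sigma=\pi_n^\infty(O)\in\mathfrak S_n$ such that $i$ precedes $j$ iff $\sigma^{-1}(i)<\sigma^{-1}(j)$. For $\sigma\in\mathfrak S_n$ let $R(\sigma)=\{j\in[n]:\sigma(j)=\max_{i\le j}\sigma(i)\}$ be its set of records. A Borel probability measure $P$ on $\mathcal O$ is called *record-dependent* if for every $n$ the probability $P(\pi_n^\infty(O)=\sigma)$ depends only on $R(\sigma)$, $\sigma\in\mathfrak S_n$. Measures $P^\omega$: * $P^*$ is the law of the order in which $i$ precedes $j$ iff $\xi_i<\xi_j$, where $\xi_1,\xi_2,\dots$ are independent and uniform on $[0,1]$. * Let $\alpha=(\alpha_k)_{k\ge1}$ be a sequence in $\{1,2,\dots\}\cup\{+\infty\}$ that is strictly increasing as long as its terms are finite and equal to $+\infty$ afterwards (all terms finite, and all terms infinite, being allowed), with $\sum_k 1/\alpha_k<\infty$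 (where $1/\infty=0$). Let $(r_i)_{i\ge1}$ be independent, $r_i$ uniform on $\{1,\dots,i-1\}$ if $i\in\{\alpha_1+1,\alpha_2+1,\dots\}$, and $r_i=i$ otherwise. Put $r_{i,i}=r_i$ and $r_{i,j+1}=r_{i,j}+1(r_{j+1}\le r_{i,j})$ for $j\ge i$. Almost surely $\sigma(i)=\lim_{j\to\infty}r_{i,j}$ exists for all $i$ and defines a bijection $\sigma:\mathbb N\to\mathbb N$; $P^{(\alpha,1)}$ is the law of the order in which $i$ precedes $j$ iff $\sigma^{-1}(i)<\sigma^{-1}(j)$. * For $0<p\le1$ put every integer independently in $N_1$ with probability $p$ and in $N_2$ with probability $1-p$. $P^{(\alpha,p)}$ is the law of the order in which every element of $N_1$ precedes every element of $N_2$, and, independently, $N_1$ is ordered according to $P^{(\alpha,1)}$ and $N_2$ according to $P^*$, using the increasing identifications of $N_1$ and $N_2$ with $\mathbb N$ (when $p=1$, $N_2$ is almost surely empty). Let $\Omega$ consist of the point $*$ and all such pairs $(\alpha,p)$, with the topology in which convergence to $(\alpha,p)$ is component-wise and convergence to $*$ means that the $p$-component tends to $0$, and with the Borel $\sigma$-algebra.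 **Statement.** The measures $P^\omega$, $\omega\in\Omega$, are exactly the extreme points of the convex set of record-dependent probability measures on $\mathcal O$, the map $\omega\mapsto P^\omega$ is measurable (that is, $\omega\mapsto P^\omega(A)$ is measurable for every Borel set $A\subset\mathcal O$), and for every record-dependent probability measure $P$ on $\mathcal O$ there exists a unique Borel probability measure $\mu$ on $\Omega$ such that $$P=\int_\Omega P^\omega\,\mu(d\omega),\qquad\text{i.e. } P(A)=\int_\Omega P^\omega(A)\,\mu(d\omega)\text{ for every Borel set }A\subset\mathcal O.$$ -/

import Mathlib

open MeasureTheory Set Filter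
open scoped ENNReal NNReal Topology

noncomputable section

namespace RecordDependent

/-! Letters, positions and ranks are numbered from `0`: the letter (position, rank) `i` of the code
is the letter (position, rank) `i + 1` of the usual convention `ℕ = {1, 2, …}`,
and `Fin n` plays the role of `[n] = {1, …, n}`. -/

/-- The space of strict total orders on `ℕ`; `O.1 i j = true` means that `i` precedes `j`.
Its topology is inherited from the product of discrete spaces `ℕ → ℕ → Bool`, i.e. it is the
topology of convergence of all restrictions to finite sets (the projective limit topology), and
its σ-algebra is the Borel σ-algebra of this topology. -/
abbrev Orders : Type :=
  {r : ℕ → ℕ → Bool // IsStrictTotalOrder ℕ (fun i j => r i j = true)}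

/-- `i` precedes `j` in the order `O`. -/
def Orders.Prec (O : Orders) (i j : ℕ) : Prop := O.1 i j = true

instance (O : Orders) : IsStrictTotalOrder ℕ O.Prec := O.2

open Classical in
/-- The order on `ℕ` given by a relation that is a strict total order. -/
def Orders.ofRel (r : ℕ → ℕ → Prop) (h : IsStrictTotalOrder ℕ r) : Orders :=
  ⟨fun i j => decide (r i j), by simpa using h⟩

/-- The order on `ℕ` obtained by pulling back a linear order along an injective map. -/
def Orders.ofKey {K : Type*} [LinearOrder K] (f : ℕ → K) (hf : Function.Injective f) : Orders :=
  Orders.ofRel (fun i j => f i < f j)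
    { trichotomous := fun _ _ h₁ h₂ => hf (le_antisymm (not_lt.mp h₂) (not_lt.mp h₁))
      irrefl := fun _ => lt_irrefl _
      trans := fun _ _ _ => lt_trans }

/-! ### Restriction to `[n]` and records -/

open Classical in
/-- The place of letter `i` in the restriction of `O` to the first `n` letters. -/
def place (O : Orders) (n : ℕ) (i : Fin n) : Fin n :=
  ⟨(Finset.univ.filter (fun j : Fin n => O.Prec j i)).card, by
    have h : (Finset.univ.filter (fun j : Fin n => O.Prec j i)) ⊂ Finset.univ := by
      rw [Finset.filter_ssubset]
      exact ⟨i, Finset.mem_univ _, irrefl_of O.Prec (i : ℕ)⟩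
    simpa using Finset.card_lt_card h⟩

theorem place_lt {O : Orders} {n : ℕ} {i j : Fin n} (h : O.Prec i j) :
    place O n i < place O n j := by
  classical
  rw [Fin.lt_def]
  unfold place
  simp only
  refine Finset.card_lt_card ?_
  rw [Finset.ssubset_iff_of_subset]
  · exact ⟨i, by simpa using h, by simpa using irrefl_of O.Prec (i : ℕ)⟩
  · intro k hk
    simp only [Finset.mem_filter, Finset.mem_univ, true_and] at hk ⊢
    exact _root_.trans hk h

theorem place_injective (O : Orders) (n : ℕ) : Function.Injective (place O n) := by
  intro i j hij
  rcases trichotomous_of O.Prec (i : ℕ) (j : ℕ) with h | h | h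
  · exact absurd hij (place_lt h).ne
  · exact Fin.ext h
  · exact absurd hij (place_lt h).ne'

/-- The restriction of the order `O` to the first `n` letters, written as a permutation `σ`
(a word `σ 0, σ 1, …, σ (n - 1)`): the letter `i` precedes the letter `j` in `O` if and only if
`σ⁻¹ i < σ⁻¹ j`, see `toPerm_symm_lt_iff`. -/
def toPerm (n : ℕ) (O : Orders) : Equiv.Perm (Fin n) :=
  (Equiv.ofBijective (place O n) (Finite.injective_iff_bijective.mp (place_injective O n))).symm

theorem toPerm_symm_lt_iff (n : ℕ) (O : Orders) (i j : Fin n) :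
    (toPerm n O).symm i < (toPerm n O).symm j ↔ O.Prec i j := by
  change place O n i < place O n j ↔ _
  refine ⟨fun h => ?_, place_lt⟩
  rcases trichotomous_of O.Prec (i : ℕ) (j : ℕ) with h' | h' | h'
  · exact h'
  · exact absurd h (by rw [Fin.ext h']; exact lt_irrefl _)
  · exact absurd h (place_lt h').not_gt

/-- The set of (upper) records of a permutation: the positions `j` such that `σ j` is the
maximum of `σ 0, …, σ j`. -/
def records {n : ℕ} (σ : Equiv.Perm (Fin n)) : Set (Fin n) := {j | ∀ i ≤ j, σ i ≤ σ j}

/-- The probability mass function of the marginal on permutations of size `n` of a measure on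
orders. -/
def marginal (P : Measure Orders) (n : ℕ) (σ : Equiv.Perm (Fin n)) : ℝ≥0∞ :=
  P (toPerm n ⁻¹' {σ})

/-- Record-dependent probability measures on the space of orders: in every marginal, the
probability of a permutation depends only on its set of records. -/
structure IsRD (P : Measure Orders) : Prop where
  isProbabilityMeasure : IsProbabilityMeasure P
  marginal_eq : ∀ (n : ℕ) (σ τ : Equiv.Perm (Fin n)),
    records σ = records τ → marginal P n σ = marginal P n τ

/-! ### The exchangeable order -/

/-- The order in which `i` precedes `j` iff `ξ i < ξ j`; ties (which have probability zero in the
application) are broken by the natural order. -/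
def orderOfReals (ξ : ℕ → unitInterval) : Orders :=
  Orders.ofKey (fun i => toLex (ξ i, i)) (fun _ _ h => congrArg (fun x => (ofLex x).2) h)

/-- The law `P^*` of the order induced by independent uniform variables. -/
def exchangeable : Measure Orders :=
  (Measure.infinitePi (fun _ : ℕ => (volume : Measure unitInterval))).map orderOfReals

/-! ### The parameter space -/

/-- Sequences `α` of elements of `{1, 2, …} ∪ {∞}`, strictly increasing as long as they are
finite and constantly `∞` afterwards, with `∑ 1 / α k < ∞` (where `1 / ∞ = 0`). -/
def AlphaSeq : Type :=
  {α : ℕ → ℕ∞ // (∀ k, 1 ≤ α k) ∧ (∀ k, α k < α (k + 1) ∨ α (k + 1) = ⊤) ∧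
    ∑' k, ((α k : ℝ≥0∞))⁻¹ < ∞}

/-- The topology of component-wise convergence. -/
instance : TopologicalSpace AlphaSeq := instTopologicalSpaceSubtype

/-- The parameter space `Ω`: the pairs `(α, p)` with `0 < p ≤ 1`, and the point `*`. -/
inductive Param : Type
  | star : Param
  | pair (α : AlphaSeq) (p : {p : unitInterval // 0 < p}) : Param

/-- The topology of the cone: convergence to `(α, p)` is component-wise, and convergence to `*`
means that the `p`-component tends to `0`. -/
instance : TopologicalSpace Param where
  IsOpen U := IsOpen {x : AlphaSeq × {p : unitInterval // 0 < p} | Param.pair x.1 x.2 ∈ U} ∧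
    (Param.star ∈ U →
      ∃ ε > (0 : ℝ), ∀ (α : AlphaSeq) (p : {p : unitInterval // 0 < p}), (p : ℝ) < ε → Param.pair α p ∈ U)
  isOpen_univ := ⟨by simp, fun _ => ⟨1, one_pos, fun _ _ _ => mem_univ _⟩⟩
  isOpen_inter U V hU hV := by
    refine ⟨hU.1.inter hV.1, fun h => ?_⟩
    obtain ⟨ε, hε, h₁⟩ := hU.2 h.1
    obtain ⟨δ, hδ, h₂⟩ := hV.2 h.2
    exact ⟨min ε δ, lt_min hε hδ, fun α p hp =>
      ⟨h₁ α p (hp.trans_le (min_le_left _ _)), h₂ α p (hp.trans_le (min_le_right _ _))⟩⟩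
  isOpen_sUnion S hS := by
    refine ⟨?_, ?_⟩
    · have : {x : AlphaSeq × {p : unitInterval // 0 < p} | Param.pair x.1 x.2 ∈ ⋃₀ S} =
          ⋃ U ∈ S, {x | Param.pair x.1 x.2 ∈ U} := by
        ext x; simp
      rw [this]
      exact isOpen_biUnion fun U hU => (hS U hU).1
    · rintro ⟨U, hU, hs⟩
      obtain ⟨ε, hε, h⟩ := (hS U hU).2 hs
      exact ⟨ε, hε, fun α p hp => ⟨U, hU, h α p hp⟩⟩

/-- `Ω` carries its Borel σ-algebra. -/
instance : MeasurableSpace Param := borel Param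

instance : BorelSpace Param := ⟨rfl⟩

/-! ### Random infinite permutations with prescribed records -/

/-- The order of an infinite permutation: `i` precedes `j` iff `σ⁻¹ i < σ⁻¹ j`. -/
def orderOfPerm (σ : Equiv.Perm ℕ) : Orders := Orders.ofKey σ.symm σ.symm.injective

/-- `iterRank r i d` is the rank `r_{i, i + d}` of the entry in position `i` among the entries in
positions `0, …, i + d`, computed from the sequence of ranks `r_i = r_{i,i}` by the recursion
`r_{i, j + 1} = r_{i, j} + 1(r_{j + 1} ≤ r_{i, j})`. -/
def iterRank (r : ℕ → ℕ) (i : ℕ) : ℕ → ℕ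
  | 0 => r i
  | d + 1 => iterRank r i d + if r (i + d + 1) ≤ iterRank r i d then 1 else 0

open Classical in
/-- The order of the infinite permutation `σ` with ranks `r`, given by
`σ i = lim_{j → ∞} r_{i, j}`; sequences `r` that do not define an infinite permutation (they have
probability zero in the application) are sent to the natural order. -/
def orderOfRanks (r : ℕ → ℕ) : Orders :=
  if h : ∃ σ : Equiv.Perm ℕ, ∀ i, ∀ᶠ d in atTop, iterRank r i d = σ i
  then orderOfPerm h.choose else orderOfPerm (Equiv.refl ℕ)

open Classical in
/-- The law of the rank `r_i`. With positions numbered from `0`, the entries of `α` are exactly the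
non-record positions; there the rank is uniform on `{0, …, i - 1}`, and elsewhere it is maximal,
`r_i = i`. -/
def rankLaw (α : AlphaSeq) (i : ℕ) : Measure ℕ :=
  if ∃ k, α.1 k = (i : ℕ∞) then ProbabilityTheory.uniformOn (Set.Iio i) else Measure.dirac i

/-- The measure `P^{(α, 1)}`: the ranks are independent with laws `rankLaw α i`. -/
def alphaOne (α : AlphaSeq) : Measure Orders :=
  (Measure.infinitePi (rankLaw α)).map orderOfRanks

/-! ### The measures `P^{(α, p)}` -/

/-- The index of `i` in the increasing enumeration of its class `{k | ε k = ε i}`. -/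
def classIndex (ε : ℕ → Bool) (i : ℕ) : ℕ := Nat.count (fun k => ε k = ε i) i

theorem classIndex_lt {ε : ℕ → Bool} {i j : ℕ} (h : ε i = ε j) (hij : i < j) :
    classIndex ε i < classIndex ε j := by
  unfold classIndex
  rw [← h]
  exact Nat.count_strict_mono (p := fun k => ε k = ε i) rfl hij

theorem classIndex_inj {ε : ℕ → Bool} {i j : ℕ} (h : ε i = ε j)
    (hij : classIndex ε i = classIndex ε j) : i = j := by
  rcases lt_trichotomy i j with h' | h' | h'
  · exact absurd hij (classIndex_lt h h').ne
  · exact h'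
  · exact absurd hij (classIndex_lt h.symm h').ne'

/-- The relation of `merge`. -/
def MergeRel (ε : ℕ → Bool) (O₁ O₂ : Orders) (i j : ℕ) : Prop :=
  (ε i = true ∧ ε j = false) ∨
  (ε i = true ∧ ε j = true ∧ O₁.Prec (classIndex ε i) (classIndex ε j)) ∨
  (ε i = false ∧ ε j = false ∧ O₂.Prec (classIndex ε i) (classIndex ε j))

theorem mergeRel_isStrictTotalOrder (ε : ℕ → Bool) (O₁ O₂ : Orders) :
    IsStrictTotalOrder ℕ (MergeRel ε O₁ O₂) where
  trichotomous i j h₁ h₂ := by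
    have t₁ := trichotomous_of O₁.Prec (classIndex ε i) (classIndex ε j)
    have t₂ := trichotomous_of O₂.Prec (classIndex ε i) (classIndex ε j)
    have t₃ := @classIndex_inj ε i j
    unfold MergeRel at h₁ h₂
    cases hi : ε i <;> cases hj : ε j <;> simp_all
  irrefl i := by
    have t₁ := irrefl_of O₁.Prec (classIndex ε i)
    have t₂ := irrefl_of O₂.Prec (classIndex ε i)
    unfold MergeRel
    cases hi : ε i <;> simp_all
  trans i j k h₁ h₂ := by
    have t₁ : O₁.Prec (classIndex ε i) (classIndex ε j) →
        O₁.Prec (classIndex ε j) (classIndex ε k) →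
        O₁.Prec (classIndex ε i) (classIndex ε k) := fun a b => _root_.trans a b
    have t₂ : O₂.Prec (classIndex ε i) (classIndex ε j) →
        O₂.Prec (classIndex ε j) (classIndex ε k) →
        O₂.Prec (classIndex ε i) (classIndex ε k) := fun a b => _root_.trans a b
    unfold MergeRel at h₁ h₂ ⊢
    cases hi : ε i <;> cases hj : ε j <;> cases hk : ε k <;> simp_all

/-- With `N₁ = {i | ε i = true}` and `N₂ = {i | ε i = false}`: every element of `N₁` precedes every
element of `N₂`, and `N₁`, `N₂` are ordered by `O₁`, `O₂` via the increasing identifications of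
`N₁`, `N₂` with (initial segments of) `ℕ`. -/
def merge (x : (ℕ → Bool) × Orders × Orders) : Orders :=
  Orders.ofRel (MergeRel x.1 x.2.1 x.2.2) (mergeRel_isStrictTotalOrder x.1 x.2.1 x.2.2)

/-- The measure `P^{(α, p)}`: every integer is put in `N₁` with probability `p` and in `N₂` with
probability `1 - p`, and, independently, `N₁` is ordered according to `P^{(α, 1)}` and `N₂`
according to `P^*`. -/
def alphaP (α : AlphaSeq) (p : unitInterval) : Measure Orders :=
  ((Measure.infinitePi (fun _ : ℕ => ProbabilityTheory.bernoulliMeasure true false p)).prod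
    ((alphaOne α).prod exchangeable)).map merge

/-- The family `P^ω`, `ω ∈ Ω`. -/
def paramMeasure : Param → Measure Orders
  | Param.star => exchangeable
  | Param.pair α p => alphaP α p

end RecordDependent

end

/-!
A permutation is encoded by the relative ranks of its successive entries: the rank in position `i`
is the number of smaller entries among the positions before it. Ranks are free of constraints
except `r i ≤ i`, position `i` is a record iff `r i = i`, and hence a random permutation of `[n]` is
record-dependent iff, given its set of records, its ranks are independent, and uniform on
`{0, …, i - 1}` at every non-record `i`. So every
finite marginal of a record-dependent measure `P` is a mixture of the laws of independent ranks with
a prescribed finite set `A` of non-records (`IsRD.code_eq_mul`, `IsRD.integral_rankProb`), and the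
task is to pass to the limit in the size of the permutation.

The tool for this is a family of binomial moments. For a code `c` of length `n`, let `φ (c_k)` be
the probability of the code `c_k` formed by the first `k` ranks of `c`; the moment of `c` is
`∑ k, (-1) ^ (n - k) * (n choose k) * k! * φ (c_k)`. The moments of all codes determine a measure
(`eq_of_moment_eq`), and they diagonalize the two operations that build the measures `P^ω`: adding
a non-record position `a` multiplies the moment by `1 - n / a` (`moment_rankProb`), and merging with
an independent exchangeable order with probability `p` multiplies it by `p ^ n`
(`moment_thinning`). The measure with parameters `(α, p)` therefore has the moments
`m_c(α) * p ^ n * ∏ (1 - n / a)`, the product being over the entries `a ≥ n` of `α`. Since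
`∏ (1 - n / a) exp (n / a)` converges uniformly in `α`, these moments are continuous functions of
the set `A` of entries of `α` and of `q = p * exp (-∑ 1 / a)`, even when the sum diverges and `q = 0`
(`continuous_extMoment`); there all moments of codes of positive length vanish, which is the case
of the exchangeable order `P^*` (`extMoment_zero`).

*Existence.* The pairs `(A, q)` range over a compact space. At level `N` the measure `P` is the
mixture of the laws of finitely many ranks, whose moments are the values of the same functions at
`(A, exp (-∑ 1 / a))`, with `A` the random set of non-records below `N`. A limit point of the laws
of these random pairs is a mixing measure (`IsRD.exists_mixture`). It lives on the closed set
where `q * exp (∑ 1 / a) ≤ 1`, every point of which comes from a parameter in `Ω`.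

*Uniqueness.* The parameter is a measurable function of the order, almost surely: under `P^(α,p)`
the letters with finitely many predecessors are those of `N₁`, whose density is `p`, and the set of
non-record positions is the set of entries of `α`; under `P^*` every letter has infinitely many
predecessors (`ae_statistic`). Thus the mixing measure is an image of `P` (`mixture_injective`).

*Extreme points.* By uniqueness, mixing is an affine bijection from the probability measures on `Ω`
to the record-dependent measures, and the extreme points on the left are the point masses.
-/

noncomputable section

namespace RecordDependent

/-! ### Rank codes of words -/

/-- The rank code of a word. Words are written as lists with the last letter first, so that the
head of the code is the rank of the last letter among all the letters. -/
def rankCode : List ℕ → List ℕ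
  | [] => []
  | a :: l => l.countP (· < a) :: rankCode l

/-- The lists that are rank codes: the rank of a letter is at most the number of letters that
stand before it. -/
def IsCode : List ℕ → Prop
  | [] => True
  | s :: c => s ≤ c.length ∧ IsCode c

/-- The record indicators of a word, read off its rank code: a letter is a record if its rank is
maximal. -/
def recWord : List ℕ → List Bool
  | [] => []
  | s :: c => decide (s = c.length) :: recWord c

/-- On rank codes, the operation of keeping the `n` smallest letters of the word: a last letter of
rank `s` is among them iff `s < n`, and then `n - 1` letters are kept of the rest of the word. -/
def restr : ℕ → List ℕ → List ℕ
  | _, [] => []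
  | n, s :: c => if n ≤ s then restr n c else s :: restr (n - 1) c

/-- The list `f (n - 1), …, f 0`. -/
def revList {β : Type*} (f : ℕ → β) : ℕ → List β
  | 0 => []
  | n + 1 => f n :: revList f n

@[simp] theorem length_rankCode (l : List ℕ) : (rankCode l).length = l.length := by
  induction l with
  | nil => rfl
  | cons a l ih => simp [rankCode, ih]

@[simp] theorem length_recWord (l : List ℕ) : (recWord l).length = l.length := by
  induction l with
  | nil => rfl
  | cons a l ih => simp [recWord, ih]

@[simp] theorem length_revList {β : Type*} (f : ℕ → β) (n : ℕ) : (revList f n).length = n := by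
  induction n with
  | zero => rfl
  | succ n ih => simp [revList, ih]

theorem mem_revList {β : Type*} {f : ℕ → β} {n : ℕ} {b : β} :
    b ∈ revList f n ↔ ∃ i < n, f i = b := by
  induction n with
  | zero => simp [revList]
  | succ n ih =>
    simp only [revList, List.mem_cons, ih, Nat.lt_succ_iff_lt_or_eq, or_and_right, exists_or,
      exists_eq_left]
    rw [or_comm, eq_comm]

theorem revList_congr {β : Type*} {f g : ℕ → β} {n : ℕ} (h : ∀ i < n, f i = g i) :
    revList f n = revList g n := by
  induction n with
  | zero => rfl
  | succ n ih => simp [revList, h n n.lt_succ_self, ih fun i hi => h i (hi.trans n.lt_succ_self)]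

theorem revList_inj {β : Type*} {f g : ℕ → β} {n : ℕ} :
    revList f n = revList g n ↔ ∀ i < n, f i = g i := by
  refine ⟨fun h => ?_, revList_congr⟩
  induction n with
  | zero => simp
  | succ n ih =>
    simp only [revList, List.cons.injEq] at h
    intro i hi
    rcases Nat.lt_succ_iff_lt_or_eq.mp hi with h' | rfl
    · exact ih h.2 i h'
    · exact h.1

theorem map_revList {β γ : Type*} (f : ℕ → β) (g : β → γ) (n : ℕ) :
    (revList f n).map g = revList (fun i => g (f i)) n := by
  induction n with
  | zero => rfl
  | succ n ih => simp [revList, ih]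

theorem nodup_revList {β : Type*} {f : ℕ → β} {n : ℕ} (h : InjOn f (Iio n)) :
    (revList f n).Nodup := by
  induction n with
  | zero => simp [revList]
  | succ n ih =>
    simp only [revList, List.nodup_cons, mem_revList, not_exists, not_and]
    refine ⟨fun i hi hf => ?_, ih (h.mono fun i (hi : i < n) => hi.trans n.lt_succ_self)⟩
    exact hi.ne (h (hi.trans n.lt_succ_self) n.lt_succ_self hf)

theorem injOn_of_nodup_revList {β : Type*} {f : ℕ → β} {n : ℕ} (h : (revList f n).Nodup) :
    InjOn f (Iio n) := by
  induction n with
  | zero => simp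
  | succ n ih =>
    rw [revList, List.nodup_cons, mem_revList] at h
    intro i hi j hj hij
    rcases Nat.lt_succ_iff_lt_or_eq.1 hi with hi | rfl <;>
      rcases Nat.lt_succ_iff_lt_or_eq.1 hj with hj | rfl
    · exact ih h.2 hi hj hij
    · exact absurd ⟨i, hi, hij⟩ h.1
    · exact absurd ⟨j, hj, hij.symm⟩ h.1
    · rfl

theorem exists_revList (c : List ℕ) : ∃ f : ℕ → ℕ, revList f c.length = c := by
  induction c with
  | nil => exact ⟨fun _ => 0, rfl⟩
  | cons s c ih =>
    obtain ⟨f, hf⟩ := ih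
    refine ⟨fun i => if i = c.length then s else f i, ?_⟩
    simp only [List.length_cons, revList, if_true, List.cons.injEq, true_and]
    refine (revList_congr fun i hi => ?_).trans hf
    simp [hi.ne]

theorem isCode_rankCode (l : List ℕ) : IsCode (rankCode l) := by
  induction l with
  | nil => trivial
  | cons a l ih => exact ⟨by simpa using List.countP_le_length, ih⟩

theorem isCode_revList {r : ℕ → ℕ} (h : ∀ i, r i ≤ i) (n : ℕ) : IsCode (revList r n) := by
  induction n with
  | zero => trivial
  | succ n ih => exact ⟨by simpa using h n, ih⟩

theorem IsCode.drop {c : List ℕ} (h : IsCode c) (k : ℕ) : IsCode (c.drop k) := by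
  induction k generalizing c with
  | zero => simpa using h
  | succ k ih =>
    cases c with
    | nil => simpa using h
    | cons s c => simpa using ih h.2

theorem recWord_drop (c : List ℕ) (k : ℕ) : recWord (c.drop k) = (recWord c).drop k := by
  induction k generalizing c with
  | zero => simp
  | succ k ih =>
    cases c with
    | nil => simp [recWord]
    | cons s c => simpa [recWord] using ih c

theorem rankCode_drop (l : List ℕ) (k : ℕ) : rankCode (l.drop k) = (rankCode l).drop k := by
  induction k generalizing l with
  | zero => simp
  | succ k ih =>
    cases l with
    | nil => simp [rankCode]
    | cons s c => simpa [rankCode] using ih c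

theorem rankCode_map {f : ℕ → ℕ} {l : List ℕ}
    (h : ∀ a ∈ l, ∀ b ∈ l, f a < f b ↔ a < b) : rankCode (l.map f) = rankCode l := by
  induction l with
  | nil => rfl
  | cons a l ih =>
    simp only [List.map_cons, rankCode, List.countP_map]
    rw [ih fun a ha b hb => h a (List.mem_cons_of_mem _ ha) b (List.mem_cons_of_mem _ hb)]
    congr 1
    refine List.countP_congr fun b hb => ?_
    simpa using h b (List.mem_cons_of_mem _ hb) a List.mem_cons_self

/-- A word is determined by its set of letters and its rank code. -/
theorem eq_of_rankCode_eq {l l' : List ℕ} (hp : l.Perm l') (h : rankCode l = rankCode l') :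
    l = l' := by
  induction l generalizing l' with
  | nil => simpa using hp.symm
  | cons a l ih =>
    cases l' with
    | nil => simp at hp
    | cons b l' =>
      simp only [rankCode, List.cons.injEq] at h
      -- the rank counts the smaller letters in the whole word, hence it determines the last letter
      have h₁ : ∀ x, (a :: l).countP (· < x) = (b :: l').countP (· < x) := fun x => hp.countP_eq _
      have hab : a = b := by
        rcases lt_trichotomy a b with hlt | heq | hlt
        · exfalso
          have h₂ := h₁ b
          have h₃ : l.countP (· < a) ≤ l.countP (· < b) :=
            List.countP_mono_left fun x _ hx => by
              simp only [decide_eq_true_eq] at hx ⊢; exact hx.trans hlt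
          simp only [List.countP_cons, hlt, lt_irrefl, decide_true, if_true, decide_false] at h₂
          simp at h₂
          omega
        · exact heq
        · exfalso
          have h₂ := h₁ a
          have h₃ : l'.countP (· < b) ≤ l'.countP (· < a) :=
            List.countP_mono_left fun x _ hx => by
              simp only [decide_eq_true_eq] at hx ⊢; exact hx.trans hlt
          simp only [List.countP_cons, hlt, lt_irrefl, decide_true, if_true, decide_false] at h₂
          simp at h₂
          omega
      subst hab
      rw [ih hp.cons_inv h.2]

theorem countP_lt_range (n a : ℕ) (h : a ≤ n) : (List.range n).countP (· < a) = a := by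
  induction n with
  | zero => simp_all
  | succ n ih =>
    rw [List.range_succ, List.countP_append]
    rcases h.lt_or_eq with h' | rfl
    · have : ¬ n < a := by omega
      simp [ih (by omega), this]
    · have : (List.range n).countP (· < n + 1) = (List.range n).length := by
        rw [List.countP_eq_length]
        intro x hx
        simp only [List.mem_range] at hx
        simp; omega
      rw [this]; simp

theorem filter_lt_range {n N : ℕ} (h : n ≤ N) : (List.range N).filter (· < n) = List.range n := by
  obtain ⟨k, rfl⟩ := Nat.exists_eq_add_of_le h
  rw [List.range_add, List.filter_append, List.filter_eq_self.2, List.filter_eq_nil_iff.2]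
  · simp
  · intro a ha
    simp only [List.mem_map, List.mem_range] at ha
    obtain ⟨b, _, rfl⟩ := ha
    simp
  · intro a ha
    simpa using ha

/-- Insertion of a new letter of rank `r` shifts the letters that are at least `r`. -/
def bump (r x : ℕ) : ℕ := x + if r ≤ x then 1 else 0

theorem bump_lt_bump {r a b : ℕ} : bump r a < bump r b ↔ a < b := by
  unfold bump; split_ifs <;> omega

theorem bump_lt {r x : ℕ} : bump r x < r ↔ x < r := by
  unfold bump; split_ifs <;> omega

theorem perm_range_insert {l : List ℕ} {n r : ℕ} (hl : l.Perm (List.range n)) (hr : r ≤ n) :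
    (r :: l.map (bump r)).Perm (List.range (n + 1)) := by
  have hnd : (r :: l.map (bump r)).Nodup := by
    rw [List.nodup_cons]
    refine ⟨?_, ?_⟩
    · simp only [List.mem_map, not_exists, not_and]
      intro x _
      unfold bump; split_ifs <;> omega
    · refine (hl.symm.nodup List.nodup_range).map fun a b hab => ?_
      have h₁ := @bump_lt_bump r a b
      have h₂ := @bump_lt_bump r b a
      omega
  rw [List.perm_ext_iff_of_nodup hnd List.nodup_range]
  intro a
  simp only [List.mem_cons, List.mem_map, List.mem_range, hl.mem_iff]
  constructor
  · rintro (rfl | ⟨x, hx, rfl⟩)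
    · omega
    · unfold bump; split_ifs <;> omega
  · intro ha
    rcases lt_trichotomy a r with h | h | h
    · exact Or.inr ⟨a, by omega, by unfold bump; split_ifs <;> omega⟩
    · exact Or.inl h
    · exact Or.inr ⟨a - 1, by omega, by unfold bump; split_ifs <;> omega⟩

theorem rankCode_insert {l : List ℕ} {n r : ℕ} (hl : l.Perm (List.range n)) (hr : r ≤ n) :
    rankCode (r :: l.map (bump r)) = r :: rankCode l := by
  rw [rankCode, rankCode_map fun a _ b _ => bump_lt_bump, List.countP_map]
  congr 1
  rw [show ((fun x => decide (x < r)) ∘ bump r) = fun x => decide (x < r) from by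
    funext x; simp [bump_lt], hl.countP_eq, countP_lt_range n r hr]

theorem exists_rankCode_eq {c : List ℕ} (hc : IsCode c) :
    ∃ l : List ℕ, l.Perm (List.range c.length) ∧ rankCode l = c := by
  induction c with
  | nil => exact ⟨[], by simp, rfl⟩
  | cons s c ih =>
    obtain ⟨l, hl, rfl⟩ := ih hc.2
    have hs : s ≤ (rankCode l).length := hc.1
    exact ⟨_, perm_range_insert hl hs, rankCode_insert hl hs⟩

theorem restr_of_length_le {c : List ℕ} (hc : IsCode c) {n : ℕ} (h : c.length ≤ n) :
    restr n c = c := by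
  induction c generalizing n with
  | nil => rfl
  | cons s c ih =>
    have := hc.1
    simp only [List.length_cons] at h
    rw [restr, if_neg (by omega), ih hc.2 (by omega)]

/-- The rank code of the word of the letters below a threshold. -/
theorem rankCode_filter_lt (l : List ℕ) (hl : l.Nodup) (t : ℕ) :
    rankCode (l.filter (· < t)) = restr (l.countP (· < t)) (rankCode l) := by
  induction l with
  | nil => rfl
  | cons a l ih =>
    have ih := ih hl.of_cons
    by_cases ha : a < t
    · have h₁ : (l.filter (· < t)).countP (· < a) = l.countP (· < a) := by
        rw [List.countP_filter]
        refine List.countP_congr fun x _ => ?_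
        simp; omega
      have h₂ : l.countP (· < a) ≤ l.countP (· < t) :=
        List.countP_mono_left fun x _ hx => by
          simp only [decide_eq_true_eq] at hx ⊢; omega
      have h₃ : ¬ (l.countP (· < t) + 1 ≤ l.countP (· < a)) := by omega
      simp only [List.filter_cons, ha, decide_true, if_true, rankCode, List.countP_cons, restr, h₁,
        if_neg h₃, Nat.add_sub_cancel, ih]
    · have h₂ : l.countP (· < t) ≤ l.countP (· < a) :=
        List.countP_mono_left fun x _ hx => by
          simp only [decide_eq_true_eq] at hx ⊢; omega
      simp [ha, rankCode, restr, h₂, ih]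

theorem rankCode_filter_lt_of_perm {l : List ℕ} {n N : ℕ} (hl : l.Perm (List.range N))
    (h : n ≤ N) : rankCode (l.filter (· < n)) = restr n (rankCode l) := by
  rw [rankCode_filter_lt l (hl.symm.nodup List.nodup_range), hl.countP_eq, countP_lt_range N n h]

open Classical in
/-- The record indicators of the word `f 0, …, f (n - 1)`. -/
theorem recWord_rankCode_revList (f : ℕ → ℕ) (n : ℕ) :
    recWord (rankCode (revList f n)) = revList (fun i => decide (∀ j < i, f j < f i)) n := by
  induction n with
  | zero => rfl
  | succ n ih =>
    simp only [revList, rankCode, recWord, ih, List.cons.injEq, and_true, decide_eq_decide,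
      length_rankCode, List.countP_eq_length]
    simp only [mem_revList, decide_eq_true_eq]
    exact ⟨fun h j hj => h _ ⟨j, hj, rfl⟩, by rintro h _ ⟨j, hj, rfl⟩; exact h j hj⟩

/-! ### Words and rank codes of orders -/

/-- The word of a permutation, last letter first. -/
def permWord {n : ℕ} (σ : Equiv.Perm (Fin n)) : List ℕ :=
  revList (fun i => if h : i < n then (σ ⟨i, h⟩ : ℕ) else 0) n

/-- The word formed by the letters below `n` in the order `O`, last letter first. -/
def word (O : Orders) (n : ℕ) : List ℕ := permWord (toPerm n O)

/-- The rank code of the restriction of an order to the letters below `n`. -/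
def code (O : Orders) (n : ℕ) : List ℕ := rankCode (word O n)

theorem permWord_perm {n : ℕ} (σ : Equiv.Perm (Fin n)) : (permWord σ).Perm (List.range n) := by
  refine (List.perm_ext_iff_of_nodup (nodup_revList ?_) List.nodup_range).2 fun a => ?_
  · intro i hi j hj hij
    simp only [mem_Iio] at hi hj
    simp only [hi, hj, dite_true] at hij
    simpa using σ.injective (Fin.ext hij)
  · simp only [mem_revList, List.mem_range]
    constructor
    · rintro ⟨i, hi, rfl⟩
      simp [hi]
    · intro ha
      exact ⟨σ.symm ⟨a, ha⟩, (σ.symm ⟨a, ha⟩).2, by simp⟩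

theorem permWord_injective (n : ℕ) : Function.Injective (permWord (n := n)) := by
  intro σ τ h
  ext i
  have := (revList_inj.1 h) i i.2
  simpa using this

theorem exists_permWord {l : List ℕ} {n : ℕ} (hl : l.Perm (List.range n)) :
    ∃ σ : Equiv.Perm (Fin n), permWord σ = l := by
  obtain ⟨f, hf⟩ := exists_revList l
  have hlen : l.length = n := by simpa using hl.length_eq
  rw [hlen] at hf
  have hlt : ∀ i < n, f i < n := fun i hi => by
    have : f i ∈ l := hf ▸ mem_revList.2 ⟨i, hi, rfl⟩
    simpa using hl.mem_iff.1 this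
  have hsurj : Function.Surjective (fun i : Fin n => (⟨f i, hlt i i.2⟩ : Fin n)) := by
    intro a
    have : (a : ℕ) ∈ revList f n := by rw [hf, hl.mem_iff]; simp
    obtain ⟨i, hi, hia⟩ := mem_revList.1 this
    exact ⟨⟨i, hi⟩, Fin.ext hia⟩
  refine ⟨Equiv.ofBijective _ (Finite.surjective_iff_bijective.1 hsurj), ?_⟩
  rw [← hf]
  exact revList_congr fun i hi => by simp [hi]

theorem rankCode_permWord_injective (n : ℕ) :
    Function.Injective (fun σ : Equiv.Perm (Fin n) => rankCode (permWord σ)) := fun σ τ h =>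
  permWord_injective n (eq_of_rankCode_eq ((permWord_perm σ).trans (permWord_perm τ).symm) h)

theorem exists_rankCode_permWord {c : List ℕ} {n : ℕ} (hc : IsCode c) (hn : c.length = n) :
    ∃ σ : Equiv.Perm (Fin n), rankCode (permWord σ) = c := by
  subst hn
  obtain ⟨l, hl, rfl⟩ := exists_rankCode_eq hc
  obtain ⟨σ, hσ⟩ := exists_permWord hl
  exact ⟨σ, by rw [hσ]⟩

theorem records_eq_iff {n : ℕ} (σ τ : Equiv.Perm (Fin n)) :
    records σ = records τ ↔
      recWord (rankCode (permWord σ)) = recWord (rankCode (permWord τ)) := by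
  classical
  unfold permWord
  rw [recWord_rankCode_revList, recWord_rankCode_revList, revList_inj]
  have key : ∀ (σ : Equiv.Perm (Fin n)) (i : ℕ) (hi : i < n),
      (∀ j < i, (if h : j < n then (σ ⟨j, h⟩ : ℕ) else 0) < if h : i < n then (σ ⟨i, h⟩ : ℕ) else 0)
        ↔ (⟨i, hi⟩ : Fin n) ∈ records σ := by
    intro σ i hi
    simp only [hi, dite_true, records, mem_ofPred_eq]
    constructor
    · intro h j hj
      rcases hj.lt_or_eq with h' | rfl
      · have := h j h'
        rw [dif_pos j.2] at this
        exact this.le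
      · exact le_rfl
    · intro h j hj
      rw [dif_pos (hj.trans hi)]
      refine lt_of_le_of_ne (h ⟨j, hj.trans hi⟩ (by simpa using hj.le)) fun he => ?_
      have := σ.injective (Fin.ext he)
      simp at this
      omega
  constructor
  · intro h i hi
    rw [decide_eq_decide, key σ i hi, key τ i hi, h]
  · intro h
    ext ⟨i, hi⟩
    have := h i hi
    rwa [decide_eq_decide, key σ i hi, key τ i hi] at this

theorem word_perm (O : Orders) (n : ℕ) : (word O n).Perm (List.range n) := permWord_perm _

theorem length_word (O : Orders) (n : ℕ) : (word O n).length = n := by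
  simpa using (word_perm O n).length_eq

theorem nodup_word (O : Orders) (n : ℕ) : (word O n).Nodup :=
  (word_perm O n).symm.nodup List.nodup_range

theorem mem_word {O : Orders} {n i : ℕ} : i ∈ word O n ↔ i < n := by
  rw [(word_perm O n).mem_iff, List.mem_range]

@[simp] theorem length_code (O : Orders) (n : ℕ) : (code O n).length = n := by
  rw [code, length_rankCode, length_word]

theorem isCode_code (O : Orders) (n : ℕ) : IsCode (code O n) := isCode_rankCode _

theorem pairwise_revList {β : Type*} {R : β → β → Prop} {f : ℕ → β} {n : ℕ}
    (h : ∀ i < n, ∀ j < i, R (f i) (f j)) : (revList f n).Pairwise R := by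
  induction n with
  | zero => simp [revList]
  | succ n ih =>
    refine List.pairwise_cons.2 ⟨fun b hb => ?_, ih fun i hi => h i (hi.trans n.lt_succ_self)⟩
    obtain ⟨j, hj, rfl⟩ := mem_revList.1 hb
    exact h n n.lt_succ_self j hj

theorem pairwise_word (O : Orders) (n : ℕ) : (word O n).Pairwise fun a b => O.Prec b a := by
  refine pairwise_revList fun i hi j hj => ?_
  rw [dif_pos hi, dif_pos (hj.trans hi), ← toPerm_symm_lt_iff]
  simpa using hj

theorem eq_word {O : Orders} {n : ℕ} {l : List ℕ} (hl : l.Perm (List.range n))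
    (h : l.Pairwise fun a b => O.Prec b a) : l = word O n :=
  List.Perm.eq_of_pairwise (le := fun a b => O.Prec b a)
    (fun a _ _ _ h₁ h₂ => absurd (_root_.trans h₂ h₁) (irrefl_of O.Prec a)) h (pairwise_word O n)
    (hl.trans (word_perm O n).symm)

theorem word_eq_filter (O : Orders) {n N : ℕ} (h : n ≤ N) :
    word O n = (word O N).filter (· < n) := by
  refine (eq_word ?_ ((pairwise_word O N).filter _)).symm
  rw [← filter_lt_range h]
  exact (word_perm O N).filter _

theorem code_eq_restr (O : Orders) {n N : ℕ} (h : n ≤ N) : code O n = restr n (code O N) := by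
  rw [code, word_eq_filter O h, rankCode_filter_lt_of_perm (word_perm O N) h, code]

theorem code_eq_iff {O : Orders} {n : ℕ} {l : List ℕ} (hl : l.Perm (List.range n)) :
    code O n = rankCode l ↔ word O n = l :=
  ⟨fun h => eq_of_rankCode_eq ((word_perm O n).trans hl.symm) h, fun h => by rw [code, h]⟩

theorem toPerm_eq_iff {n : ℕ} {O : Orders} {σ : Equiv.Perm (Fin n)} :
    toPerm n O = σ ↔ ∀ i j : Fin n, O.Prec i j ↔ σ.symm i < σ.symm j := by
  refine ⟨fun h i j => by rw [← h, toPerm_symm_lt_iff], fun h => ?_⟩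
  apply permWord_injective
  refine (eq_word (permWord_perm σ) (pairwise_revList fun i hi j hj => ?_)).symm
  rw [dif_pos hi, dif_pos (hj.trans hi), h]
  simpa using hj

theorem code_eq_rankCode_permWord_iff {n : ℕ} {O : Orders} {σ : Equiv.Perm (Fin n)} :
    code O n = rankCode (permWord σ) ↔ toPerm n O = σ :=
  (rankCode_permWord_injective n).eq_iff

/-! ### Measures on orders are determined by the laws of the rank codes -/

/-- Rank codes form a countable set, with the discrete σ-algebra. -/
instance : MeasurableSpace (List ℕ) := ⊤
instance : DiscreteMeasurableSpace (List ℕ) := ⟨fun _ => trivial⟩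

theorem measurableSet_prec (i j : ℕ) : MeasurableSet {O : Orders | O.Prec i j} := by
  have : Measurable fun O : Orders => O.1 i j :=
    (measurable_pi_apply j).comp ((measurable_pi_apply i).comp measurable_subtype_coe)
  exact this (measurableSet_singleton true)

theorem measurable_orders {X : Type*} [MeasurableSpace X] {f : X → Orders}
    (h : ∀ i j, MeasurableSet {x | (f x).Prec i j}) : Measurable f := by
  refine Measurable.subtype_mk (f := fun x => (f x).1) ?_
  refine measurable_pi_lambda _ fun i => measurable_pi_lambda _ fun j => ?_
  exact measurable_to_bool (h i j)

theorem measurableSet_toPerm_eq {n : ℕ} (σ : Equiv.Perm (Fin n)) :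
    MeasurableSet {O | toPerm n O = σ} := by
  simp only [toPerm_eq_iff, ofPred_forall]
  refine MeasurableSet.iInter fun i => MeasurableSet.iInter fun j => ?_
  by_cases h : σ.symm i < σ.symm j
  · simpa [h] using measurableSet_prec i j
  · simp only [h, iff_false]
    exact (measurableSet_prec i j).compl

theorem measurable_code (n : ℕ) : Measurable fun O => code O n := by
  refine measurable_to_countable' fun c => ?_
  by_cases h : ∃ σ : Equiv.Perm (Fin n), rankCode (permWord σ) = c
  · obtain ⟨σ, rfl⟩ := h
    convert measurableSet_toPerm_eq σ using 1
    ext O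
    exact code_eq_rankCode_permWord_iff
  · convert MeasurableSet.empty
    rw [eq_empty_iff_forall_notMem]
    exact fun O hO => h ⟨_, hO⟩

/-- Whether `i` precedes `j` can be read off a finite rank code. -/
theorem prec_iff_code (i j : ℕ) :
    ∃ S : Set (List ℕ), ∀ O : Orders, O.Prec i j ↔ code O (max i j + 1) ∈ S := by
  refine ⟨(fun O => code O (max i j + 1)) '' {O | O.Prec i j}, fun O =>
    ⟨fun h => ⟨O, h, rfl⟩, ?_⟩⟩
  rintro ⟨O', h, he⟩
  have he : toPerm _ O' = toPerm _ O := rankCode_permWord_injective _ he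
  have h₁ := toPerm_symm_lt_iff (max i j + 1) O ⟨i, by omega⟩ ⟨j, by omega⟩
  have h₂ := toPerm_symm_lt_iff (max i j + 1) O' ⟨i, by omega⟩ ⟨j, by omega⟩
  rw [← he] at h₁
  exact h₁.1 (h₂.2 h)

/-- The events that depend on finitely many letters. -/
def codeEvents : Set (Set Orders) := {A | ∃ (n : ℕ) (S : Set (List ℕ)), A = {O | code O n ∈ S}}

theorem isPiSystem_codeEvents : IsPiSystem codeEvents := by
  rintro _ ⟨n, S, rfl⟩ _ ⟨m, T, rfl⟩ _
  refine ⟨max n m, {c | restr n c ∈ S ∧ restr m c ∈ T}, ?_⟩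
  ext O
  simp only [mem_inter_iff, mem_ofPred_eq, ← code_eq_restr O (le_max_left n m),
    ← code_eq_restr O (le_max_right n m)]

theorem generateFrom_codeEvents :
    (inferInstance : MeasurableSpace Orders) = MeasurableSpace.generateFrom codeEvents := by
  apply le_antisymm
  · have : @Measurable Orders Orders (MeasurableSpace.generateFrom codeEvents) _ id := by
      refine @measurable_orders Orders (MeasurableSpace.generateFrom codeEvents) id fun i j => ?_
      obtain ⟨S, hS⟩ := prec_iff_code i j
      exact MeasurableSpace.measurableSet_generateFrom ⟨_, S, by ext O; exact hS O⟩
    intro s hs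
    exact this hs
  · refine MeasurableSpace.generateFrom_le ?_
    rintro _ ⟨n, S, rfl⟩
    exact measurable_code n (MeasurableSet.of_discrete (s := S))

theorem measure_codeEvent (P : Measure Orders) (n : ℕ) (S : Set (List ℕ)) :
    P {O | code O n ∈ S} = ∑' c : S, P {O | code O n = c} := by
  have h : {O | code O n ∈ S} = ⋃ c : S, {O | code O n = c} := by
    ext O; simp
  rw [h, measure_iUnion]
  · intro a b hab
    refine Set.disjoint_left.2 fun O h₁ h₂ => hab (Subtype.ext ?_)
    exact Eq.trans (Eq.symm h₁) h₂
  · exact fun c => measurable_code n (measurableSet_singleton _)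

theorem measure_code_eq_zero (P : Measure Orders) {n : ℕ} {c : List ℕ}
    (h : ¬ (IsCode c ∧ c.length = n)) : P {O | code O n = c} = 0 := by
  convert measure_empty (μ := P)
  rw [eq_empty_iff_forall_notMem]
  rintro O rfl
  exact h ⟨isCode_code O n, length_code O n⟩

/-- Probability measures on orders that assign the same probabilities to all rank codes agree. -/
theorem ext_of_code {P Q : Measure Orders} [IsProbabilityMeasure P] [IsProbabilityMeasure Q]
    (h : ∀ c, IsCode c → P {O | code O c.length = c} = Q {O | code O c.length = c}) : P = Q := by
  refine ext_of_generate_finite _ generateFrom_codeEvents isPiSystem_codeEvents ?_ (by simp)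
  rintro _ ⟨n, S, rfl⟩
  rw [measure_codeEvent, measure_codeEvent]
  refine tsum_congr fun c => ?_
  by_cases hc : IsCode (c : List ℕ) ∧ (c : List ℕ).length = n
  · obtain ⟨h₁, rfl⟩ := hc
    exact h _ h₁
  · rw [measure_code_eq_zero P hc, measure_code_eq_zero Q hc]

theorem marginal_eq_code (P : Measure Orders) {n : ℕ} (σ : Equiv.Perm (Fin n)) :
    marginal P n σ = P {O | code O n = rankCode (permWord σ)} := by
  unfold marginal
  congr 1
  ext O
  exact code_eq_rankCode_permWord_iff.symm

/-- Record-dependence in terms of rank codes. -/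
theorem isRD_iff (P : Measure Orders) : IsRD P ↔ IsProbabilityMeasure P ∧
    ∀ c c', IsCode c → IsCode c' → recWord c = recWord c' →
      P {O | code O c.length = c} = P {O | code O c'.length = c'} := by
  constructor
  · rintro ⟨h₁, h₂⟩
    refine ⟨h₁, fun c c' hc hc' h => ?_⟩
    have hlen : c'.length = c.length := by
      rw [← length_recWord c, ← length_recWord c', h]
    obtain ⟨σ, hσ⟩ := exists_rankCode_permWord hc rfl
    obtain ⟨τ, hτ⟩ := exists_rankCode_permWord hc' hlen
    rw [hlen]
    have := h₂ _ σ τ ((records_eq_iff σ τ).2 (by rw [hσ, hτ, h]))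
    rwa [marginal_eq_code, marginal_eq_code, hσ, hτ] at this
  · rintro ⟨h₁, h₂⟩
    refine ⟨h₁, fun n σ τ h => ?_⟩
    have := h₂ _ _ (isCode_rankCode (permWord σ)) (isCode_rankCode (permWord τ))
      ((records_eq_iff σ τ).1 h)
    simpa [marginal_eq_code, (permWord_perm _).length_eq] using this

/-! ### Independent ranks -/

/-- The law of the rank in position `i`: uniform on `{0, …, i - 1}` if `A i` holds (and `i ≠ 0`),
and the maximal rank `i` otherwise. -/
def rankDist (A : ℕ → Bool) (i : ℕ) : Measure ℕ :=
  if i ≠ 0 ∧ A i = true then ProbabilityTheory.uniformOn (Set.Iio i) else Measure.dirac i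

instance (A : ℕ → Bool) (i : ℕ) : IsProbabilityMeasure (rankDist A i) := by
  unfold rankDist
  split_ifs with h
  · exact ProbabilityTheory.isProbabilityMeasure_uniformOn (finite_Iio i)
      ⟨0, Nat.pos_of_ne_zero h.1⟩
  · infer_instance

/-- The law of a sequence of independent ranks for which `A` is the set of non-records. -/
def rankMeasure (A : ℕ → Bool) : Measure (ℕ → ℕ) := Measure.infinitePi (rankDist A)

instance (A : ℕ → Bool) : IsProbabilityMeasure (rankMeasure A) := by
  unfold rankMeasure; infer_instance

theorem rankDist_apply_of_true {A : ℕ → Bool} {i : ℕ} (h : i ≠ 0 ∧ A i = true) (t : Finset ℕ) :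
    rankDist A i t = (Finset.Iio i ∩ t).card / i := by
  rw [rankDist, if_pos h, ← Finset.coe_Iio, ProbabilityTheory.uniformOn_apply_finset]
  simp

theorem rankDist_singleton {A : ℕ → Bool} {i s : ℕ} (h : i ≠ 0 ∧ A i = true) (hs : s < i) :
    rankDist A i {s} = (i : ℝ≥0∞)⁻¹ := by
  have := rankDist_apply_of_true h {s}
  rw [Finset.coe_singleton] at this
  rw [this, Finset.inter_singleton_of_mem (by simpa using hs)]
  simp

theorem rankDist_Iio {A : ℕ → Bool} {i s : ℕ} (h : i ≠ 0 ∧ A i = true) (hs : s ≤ i) :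
    rankDist A i (Iio s) = s / i := by
  have := rankDist_apply_of_true h (Finset.Iio s)
  rw [Finset.coe_Iio] at this
  rw [this, show Finset.Iio i ∩ Finset.Iio s = Finset.Iio s from ?_]
  · simp
  · ext; simp; omega

theorem rankDist_Iio_le (A : ℕ → Bool) (i s : ℕ) (h : i ≠ 0 ∧ A i = true) :
    rankDist A i (Iio s) ≤ s / i := by
  rcases le_total s i with hs | hs
  · exact (rankDist_Iio h hs).le
  · refine prob_le_one.trans ?_
    rw [ENNReal.le_div_iff_mul_le (by simp [h.1]) (by simp)]
    simpa using hs

theorem rankDist_ae (A : ℕ → Bool) (i : ℕ) :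
    ∀ᵐ s ∂(rankDist A i), s ≤ i ∧ (s < i ↔ (i ≠ 0 ∧ A i = true)) := by
  by_cases h : i ≠ 0 ∧ A i = true
  · have : ∀ᵐ s ∂(rankDist A i), s ∈ Iio i := by
      change Iio i ∈ ae _
      rw [mem_ae_iff_prob_eq_one measurableSet_Iio, rankDist_Iio h le_rfl]
      exact ENNReal.div_self (by simp [h.1]) (by simp)
    filter_upwards [this] with s hs
    exact ⟨le_of_lt hs, by simpa [h] using hs⟩
  · simp only [rankDist, if_neg h]
    rw [ae_dirac_iff (by measurability)]
    simp [h]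

theorem rankMeasure_ae (A : ℕ → Bool) :
    ∀ᵐ r ∂(rankMeasure A), ∀ i, r i ≤ i ∧ (r i < i ↔ (i ≠ 0 ∧ A i = true)) := by
  rw [ae_all_iff]
  intro i
  exact (measurePreserving_eval_infinitePi (rankDist A) i).quasiMeasurePreserving.ae
    (rankDist_ae A i)

@[fun_prop]
theorem measurable_revList (N : ℕ) : Measurable fun r : ℕ → ℕ => revList r N := by
  induction N with
  | zero => exact measurable_const
  | succ N ih =>
    have h : Measurable fun p : ℕ × List ℕ => p.1 :: p.2 := measurable_of_countable _
    exact h.comp ((measurable_pi_apply N).prodMk ih)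

/-- The rank in position `N` is independent of the earlier ranks. -/
theorem map_head_revList (A : ℕ → Bool) (N : ℕ) :
    (rankMeasure A).map (fun r => (r N, revList r N)) =
      (rankDist A N).prod ((rankMeasure A).map fun r => revList r N) := by
  have h₁ : ProbabilityTheory.iIndepFun (fun i (r : ℕ → ℕ) => r i) (rankMeasure A) :=
    ProbabilityTheory.iIndepFun_infinitePi (P := rankDist A) (X := fun _ x => x)
      fun _ => measurable_id
  have h₂ := h₁.indepFun_finset {N} (Finset.range N) (by simp) fun i => measurable_pi_apply i
  have h₃ := h₂.comp
    (φ := fun x : ({N} : Finset ℕ) → ℕ => x ⟨N, by simp⟩)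
    (ψ := fun x : Finset.range N → ℕ =>
      revList (fun i => if h : i ∈ Finset.range N then x ⟨i, h⟩ else 0) N)
    (measurable_of_countable _) (measurable_of_countable _)
  have h₄ : (fun r : ℕ → ℕ => revList r N) = (fun x : Finset.range N → ℕ =>
      revList (fun i => if h : i ∈ Finset.range N then x ⟨i, h⟩ else 0) N) ∘
      (fun a (i : Finset.range N) => a i) := by
    funext r
    exact revList_congr fun i hi => by simp [hi]
  rw [← h₄] at h₃
  have h₅ := h₃.map_prod_eq_prod_map_map (measurable_pi_apply N).aemeasurable
    (measurable_revList N).aemeasurable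
  have h₆ : (rankMeasure A).map (fun r => r N) = rankDist A N :=
    Measure.infinitePi_map_eval (rankDist A) N
  rw [← h₆]
  exact h₅

/-- The probability that the first `N` ranks produce the rank code `c` on the smallest letters. -/
def rankProb (A : ℕ → Bool) (N : ℕ) (c : List ℕ) : ℝ :=
  (rankMeasure A).real {r | restr c.length (revList r N) = c}

theorem rankProb_nil (A : ℕ → Bool) (N : ℕ) : rankProb A N [] = 1 := by
  have : ∀ c : List ℕ, restr 0 c = [] := fun c => by
    induction c with
    | nil => rfl
    | cons s c ih => simp [restr, ih]
  simp [rankProb, this]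

/-- A record in position `N` is larger than all other letters and does not affect the restriction
to the smaller ones. -/
theorem rankProb_succ_of_false {A : ℕ → Bool} {N : ℕ} (h : ¬ (N ≠ 0 ∧ A N = true)) {c : List ℕ}
    (hc : c.length ≤ N) : rankProb A (N + 1) c = rankProb A N c := by
  unfold rankProb
  refine measureReal_congr ?_
  filter_upwards [rankMeasure_ae A] with r hr
  have : r N = N := le_antisymm (hr N).1 (not_lt.1 fun h' => h ((hr N).2.1 h'))
  apply propext
  change restr _ (r N :: revList r N) = c ↔ restr _ (revList r N) = c
  rw [restr, this, if_pos hc]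

/-- A letter inserted in a non-record position `N` belongs to the `c.length + 1` smallest ones iff its
rank is at most `c.length`, and it is then the last letter of the restricted word. -/
theorem rankProb_succ_of_true {A : ℕ → Bool} {N : ℕ} (h : N ≠ 0 ∧ A N = true) {s : ℕ}
    {c : List ℕ} (hs : s ≤ c.length) (hN : c.length + 1 ≤ N) :
    rankProb A (N + 1) (s :: c) =
      (1 - ((c.length + 1 : ℕ) : ℝ) / N) * rankProb A N (s :: c) + 1 / N * rankProb A N c := by
  set n := c.length with hn
  have hset : {r : ℕ → ℕ | restr (s :: c).length (revList r (N + 1)) = s :: c} =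
      (fun r => (r N, revList r N)) ⁻¹' ((Ici (n + 1) ×ˢ {C | restr (n + 1) C = s :: c}) ∪
        ({s} ×ˢ {C | restr n C = c})) := by
    ext r
    simp only [List.length_cons, ← hn, revList, restr, mem_ofPred_eq, mem_preimage, mem_union,
      mem_prod, mem_Ici, mem_singleton_iff]
    split_ifs with h'
    · have : r N ≠ s := by omega
      simp [h', this]
    · simp [h']
  unfold rankProb
  rw [hset, ← map_measureReal_apply (by fun_prop) (MeasurableSet.of_discrete), map_head_revList,
    measureReal_union _ MeasurableSet.of_discrete]
  · rw [measureReal_prod_prod, measureReal_prod_prod,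
      map_measureReal_apply (by fun_prop) MeasurableSet.of_discrete,
      map_measureReal_apply (by fun_prop) MeasurableSet.of_discrete]
    congr 2
    · have h₁ : (Ici (n + 1) : Set ℕ) = (Iio (n + 1))ᶜ := by simp
      rw [h₁, probReal_compl_eq_one_sub measurableSet_Iio, measureReal_def, rankDist_Iio h hN,
        ENNReal.toReal_div, ENNReal.toReal_natCast, ENNReal.toReal_natCast]
    · rw [measureReal_def, rankDist_singleton h (by omega)]
      simp
  · refine Set.disjoint_left.2 fun p h₁ h₂ => ?_
    have h₁ := h₁.1
    have h₂ := h₂.1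
    simp only [mem_Ici, mem_singleton_iff] at h₁ h₂
    omega

theorem rankProb_cons {A : ℕ → Bool} {N s : ℕ} {c : List ℕ} (hN : c.length = N) :
    rankProb A (N + 1) (s :: c) = (rankDist A N).real {s} * rankProb A N c := by
  have hset : {r : ℕ → ℕ | restr (s :: c).length (revList r (N + 1)) = s :: c} =ᵐ[rankMeasure A]
      (fun r => (r N, revList r N)) ⁻¹' ({s} ×ˢ {C | restr c.length C = c}) := by
    filter_upwards [rankMeasure_ae A] with r hr
    apply propext
    change restr _ (r N :: revList r N) = s :: c ↔ r N = s ∧ restr _ (revList r N) = c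
    have := (hr N).1
    rw [restr, if_neg (by simp; omega)]
    simp
  unfold rankProb
  rw [measureReal_congr hset, ← map_measureReal_apply (by fun_prop) (MeasurableSet.of_discrete),
    map_head_revList, measureReal_prod_prod,
    map_measureReal_apply (by fun_prop) MeasurableSet.of_discrete]
  rfl

/-- `rankProb A N c` depends on the code `c` only through its record indicators. -/
theorem rankProb_congr (A : ℕ → Bool) {N : ℕ} {c c' : List ℕ} (hc : IsCode c) (hc' : IsCode c')
    (h : recWord c = recWord c') (hN : c.length ≤ N) : rankProb A N c = rankProb A N c' := by
  have hlen : c.length = c'.length := by rw [← length_recWord c, ← length_recWord c', h]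
  induction N generalizing c c' with
  | zero =>
    have h₁ : c = [] := by simpa using hN
    have h₂ : c' = [] := by simpa [h₁] using hlen.symm
    rw [h₁, h₂]
  | succ N ih =>
    cases c with
    | nil => rw [show c' = [] by simpa using hlen.symm]
    | cons s c =>
      cases c' with
      | nil => simp at hlen
      | cons s' c' =>
        simp only [recWord, List.cons.injEq, decide_eq_decide] at h
        simp only [List.length_cons, Nat.add_right_cancel_iff] at hlen
        rw [List.length_cons] at hN
        by_cases hA : N ≠ 0 ∧ A N = true
        · rcases hN.lt_or_eq with hN' | hN'
          · rw [rankProb_succ_of_true hA hc.1 (by omega),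
              rankProb_succ_of_true hA hc'.1 (by omega), hlen,
              ih hc.2 hc'.2 h.2 (by omega) hlen,
              ih hc hc' (by simp [recWord, h]) (by simp; omega) (by simp [hlen])]
          · rw [rankProb_cons (by omega), rankProb_cons (by omega),
              ih hc.2 hc'.2 h.2 (by omega) hlen]
            congr 1
            have h₁ := hc.1
            have h₂ := hc'.1
            by_cases hs : s = c.length
            · rw [hs, h.1.1 hs, hlen]
            · have hs' : s' ≠ c'.length := fun h' => hs (h.1.2 h')
              rw [measureReal_def, measureReal_def, rankDist_singleton hA (by omega),
                rankDist_singleton hA (by omega)]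
        · rcases hN.lt_or_eq with hN' | hN'
          · rw [rankProb_succ_of_false hA (by simp; omega),
              rankProb_succ_of_false hA (by simp; omega),
              ih hc hc' (by simp [recWord, h]) (by simp; omega) (by simp [hlen])]
          · rw [rankProb_cons (by omega), rankProb_cons (by omega),
              ih hc.2 hc'.2 h.2 (by omega) hlen]
            congr 1
            have h₁ := hc.1
            have h₂ := hc'.1
            by_cases hs : s = c.length
            · rw [hs, h.1.1 hs, hlen]
            · have hs' : s' ≠ c'.length := fun h' => hs (h.1.2 h')
              have h₃ : N ≠ s := by omega
              have h₄ : N ≠ s' := by omega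
              simp [measureReal_def, rankDist, if_neg hA, h₃, h₄]

/-! ### Binomial moments -/

/-- The binomial moment of a code `c` of length `n` for a function `φ` on codes: the `n`-th iterated
difference, at `0`, of the sequence `k ↦ k! * φ c_k`, where `c_k` consists of the first `k` ranks of
`c` (the last `k` entries of the list). -/
def moment (φ : List ℕ → ℝ) (c : List ℕ) : ℝ :=
  ∑ k ∈ Finset.range (c.length + 1), (-1) ^ (c.length - k) * (c.length.choose k) *
    (k.factorial * φ (c.drop (c.length - k)))

theorem moment_congr {φ ψ : List ℕ → ℝ} {c : List ℕ}
    (h : ∀ k ≤ c.length, φ (c.drop k) = ψ (c.drop k)) : moment φ c = moment ψ c :=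
  Finset.sum_congr rfl fun k _ => by rw [h _ (Nat.sub_le _ _)]

/-- The binomial moments of all codes determine the probabilities. -/
theorem eq_of_moment_eq {φ ψ : List ℕ → ℝ} (h : ∀ c, IsCode c → moment φ c = moment ψ c)
    {c : List ℕ} (hc : IsCode c) : φ c = ψ c := by
  induction hn : c.length using Nat.strong_induction_on generalizing c with
  | _ n ih =>
    have := h c hc
    unfold moment at this
    rw [Finset.sum_range_succ, Finset.sum_range_succ, Finset.sum_congr rfl fun k hk => ?_] at this
    · have h₂ := add_left_cancel this
      simpa [Nat.factorial_ne_zero] using h₂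
    · simp only [Finset.mem_range] at hk
      rw [ih k (by omega) (hc.drop _) (by simp; omega)]

/-- The binomial moments are eigenvectors of the recursion for the probabilities of the codes when a
non-record position `a` is added, see `rankProb_succ_of_true`. -/
theorem moment_step {φ φ' : List ℕ → ℝ} {c : List ℕ} {a : ℝ} (h₀ : φ' [] = φ [])
    (h : ∀ k < c.length, φ' (c.drop k) = (1 - ((c.length - k : ℕ) : ℝ) / a) * φ (c.drop k) +
      1 / a * φ (c.drop (k + 1))) :
    moment φ' c = (1 - c.length / a) * moment φ c := by
  unfold moment
  set n := c.length with hn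
  set y : ℕ → ℝ := fun k => k.factorial * φ (c.drop (n - k)) with hy
  set b : ℕ → ℝ := fun k => (-1) ^ (n - k) * (n.choose k) with hb
  have h₁ : ∀ k < n, ((k + 1).factorial : ℝ) * φ' (c.drop (n - (k + 1))) =
      (1 - ((k + 1 : ℕ) : ℝ) / a) * y (k + 1) + ((k + 1 : ℕ) : ℝ) / a * y k := by
    intro k hk
    rw [h (n - (k + 1)) (by omega), show n - (n - (k + 1)) = k + 1 by omega,
      show n - (k + 1) + 1 = n - k by omega, hy]
    simp only [Nat.factorial_succ]
    push_cast
    ring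
  have h₂ : ∀ k < n, b (k + 1) * ((k + 1 : ℕ) : ℝ) = - (b k * ((n : ℝ) - k)) := by
    intro k hk
    have e : ((n.choose (k + 1) : ℕ) : ℝ) * ((k + 1 : ℕ) : ℝ) = n.choose k * ((n : ℝ) - k) := by
      rw [← Nat.cast_sub hk.le]
      exact_mod_cast Nat.choose_succ_right_eq n k
    rw [hb]
    simp only
    rw [mul_assoc, e, show n - k = n - (k + 1) + 1 by omega, pow_succ]
    ring
  calc ∑ k ∈ Finset.range (n + 1), b k * (k.factorial * φ' (c.drop (n - k)))
      = ∑ k ∈ Finset.range n, b (k + 1) *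
          ((1 - ((k + 1 : ℕ) : ℝ) / a) * y (k + 1) + ((k + 1 : ℕ) : ℝ) / a * y k) + b 0 * y 0 := by
        rw [Finset.sum_range_succ']
        congr 1
        · exact Finset.sum_congr rfl fun k hk => by rw [h₁ k (Finset.mem_range.1 hk)]
        · have : c.drop (n - 0) = [] := by simp [hn]
          simp only [hy, this, h₀]
    _ = (∑ k ∈ Finset.range n, b (k + 1) * ((1 - ((k + 1 : ℕ) : ℝ) / a) * y (k + 1)) +
          b 0 * ((1 - ((0 : ℕ) : ℝ) / a) * y 0)) +
          (∑ k ∈ Finset.range n, -(b k * ((n : ℝ) - k) / a * y k) +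
            -(b n * ((n : ℝ) - n) / a * y n)) := by
        have : ∀ k ∈ Finset.range n, b (k + 1) *
            ((1 - ((k + 1 : ℕ) : ℝ) / a) * y (k + 1) + ((k + 1 : ℕ) : ℝ) / a * y k) =
            b (k + 1) * ((1 - ((k + 1 : ℕ) : ℝ) / a) * y (k + 1)) +
            -(b k * ((n : ℝ) - k) / a * y k) := by
          intro k hk
          have e := h₂ k (Finset.mem_range.1 hk)
          linear_combination (y k / a) * e
        rw [Finset.sum_congr rfl this, Finset.sum_add_distrib]
        simp
        ring
    _ = (1 - n / a) * ∑ k ∈ Finset.range (n + 1), b k * y k := by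
        rw [← Finset.sum_range_succ' (fun k => b k * ((1 - (k : ℝ) / a) * y k)),
          ← Finset.sum_range_succ (fun k => -(b k * ((n : ℝ) - k) / a * y k)),
          ← Finset.sum_add_distrib, Finset.mul_sum]
        refine Finset.sum_congr rfl fun k _ => ?_
        ring

/-! ### Infinite permutations from ranks -/

/-- The word, last letter first, obtained from the ranks `r 0, …, r (N - 1)`. -/
def insList (r : ℕ → ℕ) : ℕ → List ℕ
  | 0 => []
  | N + 1 => r N :: (insList r N).map (bump (r N))

theorem insList_perm {r : ℕ → ℕ} (h : ∀ i, r i ≤ i) (N : ℕ) :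
    (insList r N).Perm (List.range N) := by
  induction N with
  | zero => simp [insList]
  | succ N ih => exact perm_range_insert ih (h N)

theorem rankCode_insList {r : ℕ → ℕ} (h : ∀ i, r i ≤ i) (N : ℕ) :
    rankCode (insList r N) = revList r N := by
  induction N with
  | zero => rfl
  | succ N ih => rw [insList, rankCode_insert (insList_perm h N) (h N), ih, revList]

theorem insList_eq (r : ℕ → ℕ) (N : ℕ) :
    insList r N = revList (fun i => iterRank r i (N - 1 - i)) N := by
  induction N with
  | zero => rfl
  | succ N ih =>
    rw [insList, ih, map_revList, revList]
    congr 1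
    · simp [iterRank]
    · refine revList_congr fun i hi => ?_
      rw [show N + 1 - 1 - i = N - 1 - i + 1 by omega, iterRank, bump,
        show i + (N - 1 - i) + 1 = N by omega]

theorem monotone_iterRank (r : ℕ → ℕ) (i : ℕ) : Monotone (iterRank r i) :=
  monotone_nat_of_le_succ fun d => by rw [iterRank]; omega

theorem iterRank_le {r : ℕ → ℕ} (h : ∀ i, r i ≤ i) (i d : ℕ) : iterRank r i d ≤ i + d := by
  induction d with
  | zero => exact h i
  | succ d ih => rw [iterRank]; split_ifs <;> omega

/-- The permutation `σ` is the limit of the words defined by the ranks `r`. -/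
def IsLimitPerm (r : ℕ → ℕ) (σ : Equiv.Perm ℕ) : Prop := ∀ i, ∀ᶠ d in atTop, iterRank r i d = σ i

theorem IsLimitPerm.unique {r : ℕ → ℕ} {σ τ : Equiv.Perm ℕ} (hσ : IsLimitPerm r σ)
    (hτ : IsLimitPerm r τ) : σ = τ := by
  ext i
  obtain ⟨d, h₁, h₂⟩ := ((hσ i).and (hτ i)).exists
  exact h₁.symm.trans h₂

theorem orderOfRanks_eq {r : ℕ → ℕ} {σ : Equiv.Perm ℕ} (hσ : IsLimitPerm r σ) :
    orderOfRanks r = orderOfPerm σ := by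
  have h : ∃ σ : Equiv.Perm ℕ, ∀ i, ∀ᶠ d in atTop, iterRank r i d = σ i := ⟨σ, hσ⟩
  have : h.choose = σ := IsLimitPerm.unique (r := r) h.choose_spec hσ
  rw [orderOfRanks, dif_pos h, this]

theorem prec_orderOfPerm {σ : Equiv.Perm ℕ} {i j : ℕ} :
    (orderOfPerm σ).Prec i j ↔ σ.symm i < σ.symm j := by
  simp [Orders.Prec, orderOfPerm, Orders.ofKey, Orders.ofRel]

theorem revList_drop {β : Type*} (f : ℕ → β) (k n : ℕ) :
    (revList f (k + n)).drop k = revList f n := by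
  induction k with
  | zero => simp
  | succ k ih => rw [Nat.succ_add, revList]; simpa using ih

theorem IsLimitPerm.eventually_drop {r : ℕ → ℕ} {σ : Equiv.Perm ℕ} (hσ : IsLimitPerm r σ) (n : ℕ) :
    ∀ᶠ N in atTop, n ≤ N ∧ (insList r N).drop (N - n) = revList σ n := by
  have h : ∀ᶠ N in atTop, ∀ i < n, iterRank r i (N - 1 - i) = σ i := by
    refine (eventually_all_finite (finite_Iio n)).2 fun i _ => ?_
    exact (tendsto_sub_atTop_nat i).comp (tendsto_sub_atTop_nat 1) |>.eventually (hσ i)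
  filter_upwards [h, eventually_ge_atTop n] with N hN hn
  refine ⟨hn, ?_⟩
  rw [insList_eq]
  conv_lhs => rw [show revList (fun i => iterRank r i (N - 1 - i)) N =
    revList (fun i => iterRank r i (N - 1 - i)) (N - n + n) by rw [Nat.sub_add_cancel hn]]
  rw [revList_drop]
  exact revList_congr hN

/-- The ranks `r` are the relative ranks of the limit permutation. -/
theorem IsLimitPerm.rankCode_revList {r : ℕ → ℕ} {σ : Equiv.Perm ℕ} (hσ : IsLimitPerm r σ)
    (h : ∀ i, r i ≤ i) (n : ℕ) : rankCode (revList σ n) = revList r n := by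
  obtain ⟨N, hn, hN⟩ := (hσ.eventually_drop n).exists
  rw [← hN, rankCode_drop, rankCode_insList h]
  conv_lhs => rw [show revList r N = revList r (N - n + n) by rw [Nat.sub_add_cancel hn]]
  rw [revList_drop]

theorem IsLimitPerm.lt_iff {r : ℕ → ℕ} {σ : Equiv.Perm ℕ} (hσ : IsLimitPerm r σ)
    (h : ∀ i, r i ≤ i) (j : ℕ) : r j < j ↔ ∃ i < j, σ j < σ i := by
  have h₁ := hσ.rankCode_revList h (j + 1)
  simp only [revList, rankCode, List.cons.injEq] at h₁
  have h₂ : r j = j ↔ ∀ i < j, σ i < σ j := by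
    rw [← h₁.1]
    have := List.countP_eq_length (l := revList σ j) (p := fun x => decide (x < σ j))
    rw [length_revList] at this
    rw [this]
    simp only [mem_revList, decide_eq_true_eq]
    exact ⟨fun h i hi => h _ ⟨i, hi, rfl⟩, by rintro h _ ⟨i, hi, rfl⟩; exact h i hi⟩
  rw [← not_iff_not, not_lt, (h j).ge_iff_eq', eq_comm, h₂]
  push Not
  refine forall₂_congr fun i hi => ⟨le_of_lt, fun h' => lt_of_le_of_ne h' fun he => ?_⟩
  exact hi.ne (σ.injective he)

/-- The rank code of the restriction of the limit order to `n` letters is obtained from any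
sufficiently long initial part of the ranks. -/
theorem IsLimitPerm.eventually_restr {r : ℕ → ℕ} {σ : Equiv.Perm ℕ} (hσ : IsLimitPerm r σ)
    (h : ∀ i, r i ≤ i) (n : ℕ) :
    ∀ᶠ N in atTop, restr n (revList r N) = code (orderOfPerm σ) n := by
  obtain ⟨M, hM⟩ : ∃ M, ∀ a < n, σ.symm a < M :=
    ⟨(Finset.range n).sup (fun a => σ.symm a) + 1, fun a ha => Nat.lt_succ_of_le
      (Finset.le_sup (f := fun a => σ.symm a) (Finset.mem_range.2 ha))⟩
  filter_upwards [hσ.eventually_drop M, eventually_ge_atTop n] with N hN hn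
  have hnd : (insList r N).Nodup := (insList_perm h N).symm.nodup List.nodup_range
  -- all letters below `n` stand in the first `M` positions
  have hfilter : (insList r N).filter (· < n) = (revList σ M).filter (· < n) := by
    have h₁ := List.take_append_drop (N - M) (insList r N)
    rw [hN.2] at h₁
    rw [← h₁] at hnd ⊢
    rw [List.filter_append, List.filter_eq_nil_iff.2, List.nil_append]
    intro a ha han
    simp only [decide_eq_true_eq] at han
    exact List.disjoint_of_nodup_append hnd ha (mem_revList.2 ⟨σ.symm a, hM a han, by simp⟩)
  rw [← rankCode_insList h, ← rankCode_filter_lt_of_perm (insList_perm h N) hn, code]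
  congr 1
  refine eq_word ?_ ?_
  · rw [← filter_lt_range hn]
    exact (insList_perm h N).filter _
  · rw [hfilter]
    refine (pairwise_revList fun i _ j hj => ?_).filter _
    rw [prec_orderOfPerm]
    simpa using hj

/-- The entry in a given position converges if its successive values are bounded; the limit is
surjective if the later ranks eventually leave every initial segment. -/
theorem exists_isLimitPerm {r : ℕ → ℕ} (h : ∀ i, r i ≤ i)
    (h_infty : ∀ n, ∀ᶠ j in atTop, n ≤ r j) (h_bdd : ∀ i, ∃ B, ∀ d, iterRank r i d ≤ B) :
    ∃ σ, IsLimitPerm r σ := by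
  have h₁ : ∀ i, ∃ a, ∀ᶠ d in atTop, iterRank r i d = a := by
    intro i
    obtain ⟨B, hB⟩ := h_bdd i
    have := tendsto_atTop_ciSup (monotone_iterRank r i) ⟨B, by rintro _ ⟨d, rfl⟩; exact hB d⟩
    rw [nhds_discrete, tendsto_pure] at this
    exact ⟨_, this⟩
  choose f hf using h₁
  have hinj : Function.Injective f := by
    intro i j hij
    by_contra hne
    have e₁ : ∀ᶠ N in atTop, iterRank r i (N - 1 - i) = f i :=
      (tendsto_sub_atTop_nat i).comp (tendsto_sub_atTop_nat 1) |>.eventually (hf i)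
    have e₂ : ∀ᶠ N in atTop, iterRank r j (N - 1 - j) = f j :=
      (tendsto_sub_atTop_nat j).comp (tendsto_sub_atTop_nat 1) |>.eventually (hf j)
    obtain ⟨N, h₁, h₂, h₃, h₄⟩ :=
      (e₁.and (e₂.and ((eventually_gt_atTop i).and (eventually_gt_atTop j)))).exists
    have hnd : (insList r N).Nodup := (insList_perm h N).symm.nodup List.nodup_range
    rw [insList_eq] at hnd
    have := injOn_of_nodup_revList hnd
    exact hne (this h₃ h₄ (by simp only; rw [h₁, h₂, hij]))
  have hsurj : Function.Surjective f := by
    intro n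
    obtain ⟨N, hN⟩ := eventually_atTop.1 (h_infty (n + 1))
    have hmem : n ∈ insList r (N + n + 1) := by
      rw [(insList_perm h _).mem_iff, List.mem_range]; omega
    rw [insList_eq] at hmem
    obtain ⟨i, hi, hin⟩ := mem_revList.1 hmem
    refine ⟨i, ?_⟩
    -- later insertions have larger ranks, so the letter in this position does not change
    have hconst : ∀ d, iterRank r i (N + n + 1 - 1 - i + d) = n := by
      intro d
      induction d with
      | zero => exact hin
      | succ d ih =>
        rw [← Nat.add_assoc, iterRank, ih, if_neg, Nat.add_zero]
        have := hN (i + (N + n + 1 - 1 - i + d) + 1) (by omega)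
        omega
    obtain ⟨d, h₁, h₂⟩ :=
      ((hf i).and (eventually_ge_atTop (N + n + 1 - 1 - i))).exists
    obtain ⟨e, rfl⟩ := Nat.exists_eq_add_of_le h₂
    rw [← h₁, hconst e]
  exact ⟨Equiv.ofBijective f ⟨hinj, hsurj⟩, hf⟩

/-- The weight `1 / a` of a non-record position `a`. -/
def weight (A : ℕ → Bool) (a : ℕ) : ℝ := if a ≠ 0 ∧ A a = true then 1 / a else 0

theorem weight_nonneg (A : ℕ → Bool) (a : ℕ) : 0 ≤ weight A a := by
  unfold weight; split_ifs <;> positivity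

theorem ofReal_weight {A : ℕ → Bool} {a : ℕ} (h : a ≠ 0 ∧ A a = true) :
    ENNReal.ofReal (weight A a) = 1 / (a : ℝ≥0∞) := by
  have : (0 : ℝ) < a := by exact_mod_cast Nat.pos_of_ne_zero h.1
  rw [weight, if_pos h, ENNReal.ofReal_div_of_pos this]
  simp

/-- By the Borel–Cantelli lemma, the ranks tend to infinity. -/
theorem ae_rank_tendsto {A : ℕ → Bool} (hA : Summable (weight A)) :
    ∀ᵐ r ∂(rankMeasure A), ∀ n, ∀ᶠ j in atTop, n ≤ r j := by
  rw [ae_all_iff]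
  intro n
  have hle : ∀ j, rankMeasure A {r | r j < n} ≤
      (if j < n then 1 else 0) + n * ENNReal.ofReal (weight A j) := by
    intro j
    have h₁ : rankMeasure A {r | r j < n} = rankDist A j (Iio n) := by
      rw [← Measure.infinitePi_map_eval (rankDist A) j, Measure.map_apply (measurable_pi_apply j)
        measurableSet_Iio]
      rfl
    rw [h₁]
    by_cases h : j ≠ 0 ∧ A j = true
    · refine (rankDist_Iio_le A j n h).trans ?_
      rw [ofReal_weight h, mul_one_div]
      exact le_add_self
    · refine le_trans ?_ le_self_add
      rw [rankDist, if_neg h, Measure.dirac_apply' _ measurableSet_Iio]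
      by_cases hj : j < n <;> simp [hj]
  have hsum : ∑' j, rankMeasure A {r | r j < n} ≠ ∞ := by
    refine ne_top_of_le_ne_top ?_ (ENNReal.tsum_le_tsum hle)
    rw [ENNReal.tsum_add, ENNReal.tsum_mul_left,
      ← ENNReal.ofReal_tsum_of_nonneg (weight_nonneg A) hA,
      tsum_eq_sum (s := Finset.range n) fun j hj => if_neg (by simpa using hj)]
    simp [ENNReal.mul_eq_top]
  filter_upwards [ae_eventually_notMem hsum] with r hr
  filter_upwards [hr] with j hj
  simpa using hj

/-- `iterRank r i d` depends only on the ranks up to position `i + d`. -/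
theorem exists_iterRank_eq (i d : ℕ) :
    ∃ g : List ℕ → ℕ, ∀ r, iterRank r i d = g (revList r (i + d + 1)) := by
  induction d with
  | zero => exact ⟨fun c => c.headD 0, fun r => rfl⟩
  | succ d ih =>
    obtain ⟨g, hg⟩ := ih
    refine ⟨fun c => g c.tail + if c.headD 0 ≤ g c.tail then 1 else 0, fun r => ?_⟩
    rw [iterRank, hg]
    rfl

/-- A rank uniform on `{0, …, a - 1}` is at most `g` with probability `(g + 1) / a`, so the insertion
in position `a` multiplies the expectation of `iterRank + 1` by at most `1 + 1 / a`. -/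
theorem lintegral_iterRank_succ_le (A : ℕ → Bool) (i d : ℕ) :
    ∫⁻ r, ((iterRank r i (d + 1) : ℝ≥0∞) + 1) ∂(rankMeasure A) ≤
      (1 + ENNReal.ofReal (weight A (i + d + 1))) *
        ∫⁻ r, ((iterRank r i d : ℝ≥0∞) + 1) ∂(rankMeasure A) := by
  obtain ⟨g, hg⟩ := exists_iterRank_eq i d
  set N := i + d + 1 with hN
  have h₁ : ∀ r : ℕ → ℕ, ((iterRank r i (d + 1) : ℝ≥0∞) + 1) =
      (fun p : ℕ × List ℕ => (g p.2 : ℝ≥0∞) + 1 + (Iic (g p.2)).indicator 1 p.1)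
        (r N, revList r N) := by
    intro r
    simp only [iterRank, hg, ← hN]
    by_cases h : r N ≤ g (revList r N)
    · simp [h]
    · simp [h]
  have hmeas : Measurable fun r : ℕ → ℕ => (r N, revList r N) := by fun_prop
  have hae : ∀ᵐ C ∂((rankMeasure A).map fun r => revList r N), g C < N := by
    rw [ae_map_iff (by fun_prop) MeasurableSet.of_discrete]
    filter_upwards [rankMeasure_ae A] with r hr
    rw [← hg]
    have := iterRank_le (fun i => (hr i).1) i d
    omega
  calc ∫⁻ r, ((iterRank r i (d + 1) : ℝ≥0∞) + 1) ∂(rankMeasure A)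
      = ∫⁻ p, ((g p.2 : ℝ≥0∞) + 1 + (Iic (g p.2)).indicator 1 p.1)
          ∂((rankDist A N).prod ((rankMeasure A).map fun r => revList r N)) := by
        rw [← map_head_revList, lintegral_map (measurable_of_countable _) hmeas]
        exact lintegral_congr h₁
    _ = ∫⁻ C, ∫⁻ s, ((g C : ℝ≥0∞) + 1 + (Iic (g C)).indicator 1 s) ∂(rankDist A N)
          ∂((rankMeasure A).map fun r => revList r N) :=
        lintegral_prod_symm _ (measurable_of_countable _).aemeasurable
    _ ≤ ∫⁻ C, (1 + ENNReal.ofReal (weight A N)) * ((g C : ℝ≥0∞) + 1)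
          ∂((rankMeasure A).map fun r => revList r N) := by
        refine lintegral_mono_ae ?_
        filter_upwards [hae] with C hC
        rw [lintegral_add_left measurable_const, lintegral_const, lintegral_indicator_one
          measurableSet_Iic, measure_univ, mul_one, add_mul, one_mul]
        gcongr
        by_cases h : N ≠ 0 ∧ A N = true
        · rw [show Iic (g C) = Iio (g C + 1) by ext; simp, ofReal_weight h]
          refine (rankDist_Iio_le A N _ h).trans (le_of_eq ?_)
          rw [one_div, ENNReal.div_eq_inv_mul]
          simp
        · rw [rankDist, if_neg h, Measure.dirac_apply' _ measurableSet_Iic]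
          simp [hC]
    _ = _ := by
        rw [lintegral_map (measurable_of_countable _) (by fun_prop), lintegral_const_mul]
        · simp_rw [hg]
        · exact Measurable.comp (g := fun C => (g C : ℝ≥0∞) + 1) (measurable_of_countable _)
            (measurable_revList N)

/-- The expectations of `iterRank + 1` are bounded, as the product of the factors `1 + 1 / a`
converges; monotone convergence gives an almost sure bound. -/
theorem ae_iterRank_bdd {A : ℕ → Bool} (hA : Summable (weight A)) :
    ∀ᵐ r ∂(rankMeasure A), ∀ i, ∃ B, ∀ d, iterRank r i d ≤ B := by
  rw [ae_all_iff]
  intro i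
  have hmeas : ∀ d, Measurable fun r => (iterRank r i d : ℝ≥0∞) + 1 := by
    intro d
    obtain ⟨g, hg⟩ := exists_iterRank_eq i d
    simp_rw [hg]
    exact Measurable.comp (g := fun C => (g C : ℝ≥0∞) + 1) (measurable_of_countable _)
      (measurable_revList _)
  set K : ℝ≥0∞ := ∫⁻ r, ((iterRank r i 0 : ℝ≥0∞) + 1) ∂(rankMeasure A) with hK
  have hK_top : K ≠ ∞ := by
    have : K ≤ i + 1 := by
      have : ∀ᵐ r ∂(rankMeasure A), (iterRank r i 0 : ℝ≥0∞) + 1 ≤ i + 1 := by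
        filter_upwards [rankMeasure_ae A] with r hr
        gcongr
        exact_mod_cast (hr i).1
      refine (lintegral_mono_ae this).trans (by simp)
    exact ne_top_of_le_ne_top (by simp) this
  have h₁ : ∀ d, ∫⁻ r, ((iterRank r i d : ℝ≥0∞) + 1) ∂(rankMeasure A) ≤
      ENNReal.ofReal (Real.exp (∑ a ∈ Finset.range (i + d + 1), weight A a)) * K := by
    intro d
    induction d with
    | zero =>
      refine le_mul_of_one_le_left zero_le ?_
      rw [ENNReal.one_le_ofReal, Real.one_le_exp_iff]
      exact Finset.sum_nonneg fun a _ => weight_nonneg A a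
    | succ d ih =>
      refine (lintegral_iterRank_succ_le A i d).trans ((mul_le_mul_right ih _).trans ?_)
      rw [← mul_assoc, show i + (d + 1) + 1 = i + d + 1 + 1 from rfl,
        Finset.sum_range_succ _ (i + d + 1), Real.exp_add, ENNReal.ofReal_mul (Real.exp_pos _).le,
        mul_comm (ENNReal.ofReal (Real.exp _))]
      gcongr
      rw [← ENNReal.ofReal_one, ← ENNReal.ofReal_add zero_le_one (weight_nonneg _ _)]
      refine ENNReal.ofReal_le_ofReal ?_
      rw [add_comm]
      exact Real.add_one_le_exp _
  have h₂ : ∫⁻ r, (⨆ d, ((iterRank r i d : ℝ≥0∞) + 1)) ∂(rankMeasure A) ≠ ∞ := by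
    rw [lintegral_iSup hmeas]
    · refine ne_top_of_le_ne_top (b := ENNReal.ofReal (Real.exp (∑' a, weight A a)) * K)
        (ENNReal.mul_ne_top (by simp) hK_top) (iSup_le fun d => (h₁ d).trans ?_)
      gcongr
      exact hA.sum_le_tsum _ fun a _ => weight_nonneg A a
    · intro d e hde r
      simp only
      gcongr
      exact monotone_iterRank r i hde
  filter_upwards [ae_lt_top (Measurable.iSup hmeas) h₂] with r hr
  obtain ⟨B, hB⟩ := ENNReal.exists_nat_gt hr.ne
  refine ⟨B, fun d => ?_⟩
  have h₃ : (iterRank r i d : ℝ≥0∞) + 1 < B :=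
    (le_iSup (fun d => (iterRank r i d : ℝ≥0∞) + 1) d).trans_lt hB
  have h₄ : iterRank r i d + 1 < B := by exact_mod_cast h₃
  omega

/-- If the sum of the inverses of the non-record positions is finite, then independent ranks almost
surely define an infinite permutation. -/
theorem ae_exists_isLimitPerm {A : ℕ → Bool} (hA : Summable (weight A)) :
    ∀ᵐ r ∂(rankMeasure A), ∃ σ, IsLimitPerm r σ := by
  filter_upwards [rankMeasure_ae A, ae_rank_tendsto hA, ae_iterRank_bdd hA] with r h₁ h₂ h₃
  exact exists_isLimitPerm (fun i => (h₁ i).1) h₂ h₃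

/-! ### The laws of the rank codes -/

/-- The probability that the restriction of a random order has rank code `c`. -/
def codeProb (P : Measure Orders) (c : List ℕ) : ℝ := P.real {O | code O c.length = c}

theorem eq_of_codeProb_eq {P Q : Measure Orders} [IsProbabilityMeasure P] [IsProbabilityMeasure Q]
    (h : ∀ c, IsCode c → codeProb P c = codeProb Q c) : P = Q :=
  ext_of_code fun c hc => (measureReal_eq_measureReal_iff).1 (h c hc)

theorem prec_orderOfReals {ξ : ℕ → unitInterval} {i j : ℕ} :
    (orderOfReals ξ).Prec i j ↔ ξ i < ξ j ∨ ξ i = ξ j ∧ i < j := by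
  simp [Orders.Prec, orderOfReals, Orders.ofKey, Orders.ofRel, Prod.Lex.toLex_lt_toLex]

theorem measurable_orderOfReals : Measurable orderOfReals := by
  refine measurable_orders fun i j => ?_
  simp only [prec_orderOfReals]
  exact (measurableSet_lt (measurable_pi_apply i) (measurable_pi_apply j)).union
    ((measurableSet_eq_fun (measurable_pi_apply i) (measurable_pi_apply j)).inter
      (MeasurableSet.const _))

theorem prec_merge {x : (ℕ → Bool) × Orders × Orders} {i j : ℕ} :
    (merge x).Prec i j ↔ MergeRel x.1 x.2.1 x.2.2 i j := by
  simp [Orders.Prec, merge, Orders.ofRel]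

theorem measurable_classIndex (i : ℕ) : Measurable fun ε : ℕ → Bool => classIndex ε i := by
  have : (fun ε : ℕ → Bool => classIndex ε i) = fun ε =>
      ∑ k ∈ Finset.range i, if ε k = ε i then 1 else 0 := by
    funext ε
    rw [classIndex, Nat.count_eq_card_filter_range, Finset.card_filter]
  rw [this]
  refine Finset.measurable_sum _ fun k _ => ?_
  exact Measurable.ite (measurableSet_eq_fun (measurable_pi_apply k) (measurable_pi_apply i))
    measurable_const measurable_const

theorem measurable_merge : Measurable merge := by
  refine measurable_orders fun i j => ?_
  simp only [prec_merge, MergeRel]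
  have hε : ∀ (k : ℕ) (b : Bool), MeasurableSet {x : (ℕ → Bool) × Orders × Orders | x.1 k = b} :=
    fun k b => measurableSet_eq_fun ((measurable_pi_apply k).comp measurable_fst) measurable_const
  have hp : ∀ f : (ℕ → Bool) × Orders × Orders → Orders, Measurable f →
      MeasurableSet {x | (f x).Prec (classIndex x.1 i) (classIndex x.1 j)} := by
    intro f hf
    have : {x | (f x).Prec (classIndex x.1 i) (classIndex x.1 j)} =
        ⋃ (a : ℕ) (b : ℕ), {x | classIndex x.1 i = a} ∩ {x | classIndex x.1 j = b} ∩
          f ⁻¹' {O | O.Prec a b} := by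
      ext x; simp
    rw [this]
    refine MeasurableSet.iUnion fun a => MeasurableSet.iUnion fun b => MeasurableSet.inter ?_
      (hf (measurableSet_prec a b))
    exact (((measurable_classIndex i).comp measurable_fst) (measurableSet_singleton a)).inter
      (((measurable_classIndex j).comp measurable_fst) (measurableSet_singleton b))
  exact ((hε i _).inter (hε j _)).union
    (((hε i _).inter ((hε j _).inter (hp _ (measurable_fst.comp measurable_snd)))).union
    ((hε i _).inter ((hε j _).inter (hp _ (measurable_snd.comp measurable_snd)))))

theorem measurableSet_limit_eq (i a : ℕ) :
    MeasurableSet {r : ℕ → ℕ | ∀ᶠ d in atTop, iterRank r i d = a} := by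
  have h : ∀ d, MeasurableSet {r : ℕ → ℕ | iterRank r i d = a} := by
    intro d
    obtain ⟨g, hg⟩ := exists_iterRank_eq i d
    simp_rw [hg]
    exact measurable_revList _ (MeasurableSet.of_discrete (s := {c | g c = a}))
  simp only [eventually_atTop, ofPred_exists, ofPred_forall]
  exact MeasurableSet.iUnion fun _ => MeasurableSet.iInter fun d =>
    MeasurableSet.iInter fun _ => h d

/-- The existence of a limit permutation as a countable combination of the events that a given
position has a given limit. -/
theorem exists_isLimitPerm_iff (r : ℕ → ℕ) : (∃ σ, IsLimitPerm r σ) ↔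
    (∀ i, ∃ a, ∀ᶠ d in atTop, iterRank r i d = a) ∧
    (∀ a, ∃ i, ∀ᶠ d in atTop, iterRank r i d = a) ∧
    ∀ i j a, i ≠ j → ¬ ((∀ᶠ d in atTop, iterRank r i d = a) ∧ ∀ᶠ d in atTop, iterRank r j d = a) := by
  have huniq : ∀ i a b, (∀ᶠ d in atTop, iterRank r i d = a) →
      (∀ᶠ d in atTop, iterRank r i d = b) → a = b := fun i a b h₁ h₂ => by
    obtain ⟨d, h₁, h₂⟩ := (h₁.and h₂).exists
    exact h₁.symm.trans h₂
  constructor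
  · rintro ⟨σ, hσ⟩
    refine ⟨fun i => ⟨_, hσ i⟩, fun a => ⟨σ.symm a, by simpa using hσ (σ.symm a)⟩, ?_⟩
    rintro i j a hij ⟨h₁, h₂⟩
    exact hij (σ.injective ((huniq i _ _ (hσ i) h₁).trans (huniq j _ _ (hσ j) h₂).symm))
  · rintro ⟨h₁, h₂, h₃⟩
    choose f hf using h₁
    refine ⟨Equiv.ofBijective f ⟨fun i j hij => ?_, fun a => ?_⟩, hf⟩
    · by_contra hne
      exact h₃ i j (f i) hne ⟨hf i, hij ▸ hf j⟩
    · obtain ⟨i, hi⟩ := h₂ a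
      exact ⟨i, huniq i _ _ (hf i) hi⟩

theorem measurable_orderOfRanks : Measurable orderOfRanks := by
  have hgood : MeasurableSet {r : ℕ → ℕ | ∃ σ, IsLimitPerm r σ} := by
    simp only [exists_isLimitPerm_iff]
    have h₁ : MeasurableSet {r : ℕ → ℕ | ∀ i, ∃ a, ∀ᶠ d in atTop, iterRank r i d = a} := by
      simp only [ofPred_exists, ofPred_forall]
      exact MeasurableSet.iInter fun i => MeasurableSet.iUnion fun a => measurableSet_limit_eq i a
    have h₂ : MeasurableSet {r : ℕ → ℕ | ∀ a, ∃ i, ∀ᶠ d in atTop, iterRank r i d = a} := by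
      simp only [ofPred_exists, ofPred_forall]
      exact MeasurableSet.iInter fun a => MeasurableSet.iUnion fun i => measurableSet_limit_eq i a
    have h₃ : MeasurableSet {r : ℕ → ℕ | ∀ i j a, i ≠ j →
        ¬ ((∀ᶠ d in atTop, iterRank r i d = a) ∧ ∀ᶠ d in atTop, iterRank r j d = a)} := by
      simp only [ofPred_forall]
      exact MeasurableSet.iInter fun i => MeasurableSet.iInter fun j => MeasurableSet.iInter fun a =>
        MeasurableSet.iInter fun _ =>
          ((measurableSet_limit_eq i a).inter (measurableSet_limit_eq j a)).compl
    exact h₁.inter (h₂.inter h₃)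
  refine measurable_orders fun i j => ?_
  have : {r | (orderOfRanks r).Prec i j} =
      ({r | ∃ σ, IsLimitPerm r σ} ∩ ⋃ (a : ℕ) (b : ℕ) (_ : a < b),
        {r | ∀ᶠ d in atTop, iterRank r a d = i} ∩ {r | ∀ᶠ d in atTop, iterRank r b d = j}) ∪
      ({r | ∃ σ, IsLimitPerm r σ}ᶜ ∩ {_r | i < j}) := by
    ext r
    by_cases h : ∃ σ, IsLimitPerm r σ
    · obtain ⟨σ, hσ⟩ := h
      have h' : ∃ σ, IsLimitPerm r σ := ⟨σ, hσ⟩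
      have huniq : ∀ i a, (∀ᶠ d in atTop, iterRank r i d = a) → σ i = a := fun i a h₂ => by
        obtain ⟨d, h₁, h₂⟩ := ((hσ i).and h₂).exists
        exact h₁.symm.trans h₂
      simp only [mem_ofPred_eq, orderOfRanks_eq hσ, prec_orderOfPerm, mem_union, mem_inter_iff, h',
        true_and, mem_iUnion, mem_compl_iff, not_true, false_and, or_false, exists_prop]
      constructor
      · exact fun h => ⟨_, _, h, by simpa using hσ (σ.symm i), by simpa using hσ (σ.symm j)⟩
      · rintro ⟨a, b, hab, ha, hb⟩
        rwa [← huniq a i ha, ← huniq b j hb, σ.symm_apply_apply, σ.symm_apply_apply]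
    · have h₁ : orderOfRanks r = orderOfPerm (Equiv.refl ℕ) := by
        rw [orderOfRanks, dif_neg]; exact h
      simp [h, h₁, prec_orderOfPerm]
  rw [this]
  refine (hgood.inter (MeasurableSet.iUnion fun a => MeasurableSet.iUnion fun b =>
    MeasurableSet.iUnion fun _ => ?_)).union (hgood.compl.inter (MeasurableSet.const _))
  exact (measurableSet_limit_eq a i).inter (measurableSet_limit_eq b j)

theorem measurableSet_code_eq (n : ℕ) (c : List ℕ) : MeasurableSet {O | code O n = c} :=
  measurable_code n (measurableSet_singleton c)

/-- The probabilities of the rank codes under the order of an infinite random permutation. -/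
theorem tendsto_rankProb {A : ℕ → Bool} (hA : Summable (weight A)) (c : List ℕ) :
    Tendsto (fun N => rankProb A N c) atTop
      (𝓝 (codeProb ((rankMeasure A).map orderOfRanks) c)) := by
  rw [codeProb, map_measureReal_apply measurable_orderOfRanks (measurableSet_code_eq _ _)]
  refine (ENNReal.tendsto_toReal (measure_ne_top _ _)).comp ?_
  refine tendsto_measure_of_ae_tendsto_indicator_of_isFiniteMeasure atTop
    (measurable_orderOfRanks (measurableSet_code_eq _ _))
    (fun N => measurable_revList N (MeasurableSet.of_discrete (s := {C | restr c.length C = c}))) ?_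
  filter_upwards [rankMeasure_ae A, ae_exists_isLimitPerm hA] with r h₁ ⟨σ, hσ⟩
  filter_upwards [hσ.eventually_restr (fun i => (h₁ i).1) c.length] with N hN
  simp [orderOfRanks_eq hσ, hN]

/-! ### The exchangeable order -/

theorem ae_injective : ∀ᵐ ξ ∂(Measure.infinitePi fun _ : ℕ => (volume : Measure unitInterval)),
    Function.Injective ξ := by
  have : ∀ i j : ℕ, i ≠ j →
      ∀ᵐ ξ ∂(Measure.infinitePi fun _ : ℕ => (volume : Measure unitInterval)), ξ i ≠ ξ j := by
    intro i j hij
    have h₁ := Measure.infinitePi_map_eval_prod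
      (P := fun _ : ℕ => (volume : Measure unitInterval)) hij
    have h₂ : ∀ᵐ p ∂((volume : Measure unitInterval).prod (volume : Measure unitInterval)),
        p.1 ≠ p.2 := by
      have hm : MeasurableSet {p : unitInterval × unitInterval | p.1 = p.2} :=
        measurableSet_eq_fun measurable_fst measurable_snd
      rw [ae_iff]
      simp only [not_not]
      rw [Measure.measure_prod_null hm]
      refine ae_of_all _ fun x => ?_
      have : Prod.mk x ⁻¹' {p : unitInterval × unitInterval | p.1 = p.2} = {x} := by
        ext y; simp [eq_comm]
      simp only [this]
      simp
    rw [← h₁] at h₂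
    exact ae_of_ae_map (f := fun ξ : ℕ → unitInterval => (ξ i, ξ j)) (by fun_prop) h₂
  simp only [← ae_all_iff] at this
  filter_upwards [this] with ξ hξ i j hij
  by_contra hne
  exact hξ i j hne hij

/-- The restrictions of the exchangeable order are uniform random permutations. -/
theorem exchangeable_toPerm {n : ℕ} (σ : Equiv.Perm (Fin n)) :
    exchangeable {O | toPerm n O = σ} = exchangeable {O | toPerm n O = 1} := by
  set E : Equiv.Perm (Fin n) → Set (ℕ → unitInterval) := fun σ =>
    {ξ | ∀ i j : Fin n, ξ i < ξ j ↔ σ.symm i < σ.symm j} with hE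
  have hEm : ∀ σ, MeasurableSet (E σ) := by
    intro σ
    simp only [hE, ofPred_forall]
    refine MeasurableSet.iInter fun i => MeasurableSet.iInter fun j => ?_
    have h := measurableSet_lt (measurable_pi_apply (X := fun _ : ℕ => unitInterval) (i : ℕ))
      (measurable_pi_apply (X := fun _ : ℕ => unitInterval) (j : ℕ))
    by_cases h' : σ.symm i < σ.symm j
    · simpa [h'] using h
    · simp only [h', iff_false]
      exact h.compl
  have h₁ : ∀ σ, exchangeable {O | toPerm n O = σ} =
      Measure.infinitePi (fun _ : ℕ => (volume : Measure unitInterval)) (E σ) := by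
    intro σ
    rw [exchangeable, Measure.map_apply measurable_orderOfReals (measurableSet_toPerm_eq σ)]
    refine measure_congr ?_
    filter_upwards [ae_injective] with ξ hξ
    apply propext
    change toPerm n (orderOfReals ξ) = σ ↔ ∀ i j : Fin n, ξ i < ξ j ↔ σ.symm i < σ.symm j
    rw [toPerm_eq_iff]
    refine forall₂_congr fun i j => ?_
    rw [prec_orderOfReals]
    have : ¬ (ξ i = ξ j ∧ (i : ℕ) < j) := fun h => h.2.ne (hξ h.1)
    rw [or_iff_left this]
  rw [h₁, h₁]
  -- relabelling the variables by `σ` preserves their joint law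
  set f : ℕ → ℕ := fun i => if h : i < n then (σ ⟨i, h⟩ : ℕ) else i with hf
  have hfi : Function.Injective f := by
    intro i j hij
    simp only [hf] at hij
    by_cases hi : i < n <;> by_cases hj : j < n
    · simp only [hi, hj, dite_true] at hij
      simpa using σ.injective (Fin.ext hij)
    · simp only [hi, hj, dite_true, dite_false] at hij
      have := (σ ⟨i, hi⟩).2
      omega
    · simp only [hi, hj, dite_true, dite_false] at hij
      have := (σ ⟨j, hj⟩).2
      omega
    · simpa [hi, hj] using hij
  have h₂ := Measure.map_infinitePi_infinitePi_of_inj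
    (P := fun _ : ℕ => (volume : Measure unitInterval)) hfi
  rw [← h₂, Measure.map_apply (by fun_prop) (hEm 1)]
  congr 1
  ext ξ
  simp only [hE, mem_preimage, mem_ofPred_eq, hf, Fin.is_lt, dite_true, Fin.eta]
  constructor
  · intro h i j
    simpa [Equiv.Perm.one_apply, show Equiv.symm (1 : Equiv.Perm (Fin n)) = 1 from rfl] using
      h (σ i) (σ j)
  · intro h i j
    simpa [Equiv.Perm.one_apply, show Equiv.symm (1 : Equiv.Perm (Fin n)) = 1 from rfl] using
      h (σ.symm i) (σ.symm j)

instance : IsProbabilityMeasure exchangeable :=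
  Measure.isProbabilityMeasure_map measurable_orderOfReals.aemeasurable

theorem codeProb_exchangeable {c : List ℕ} (hc : IsCode c) :
    codeProb exchangeable c = 1 / (c.length.factorial : ℝ) := by
  obtain ⟨σ, hσ⟩ := exists_rankCode_permWord hc rfl
  have h₁ : ∀ τ : Equiv.Perm (Fin c.length), exchangeable.real {O | toPerm c.length O = τ} =
      codeProb exchangeable c := by
    intro τ
    have : {O | code O c.length = c} = {O | toPerm c.length O = σ} := by
      ext O
      rw [mem_ofPred_eq, mem_ofPred_eq, ← code_eq_rankCode_permWord_iff, hσ]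
    rw [codeProb, this, measureReal_def, measureReal_def, exchangeable_toPerm τ,
      exchangeable_toPerm σ]
  have h₂ : ∑ τ : Equiv.Perm (Fin c.length), exchangeable.real {O | toPerm c.length O = τ} = 1 := by
    rw [← measureReal_biUnion_finset]
    · rw [← probReal_univ (μ := exchangeable)]
      congr 1
      ext O
      simp
    · intro τ _ τ' _ hne
      exact Set.disjoint_left.2 fun O h h' => hne (Eq.trans (Eq.symm h) h')
    · exact fun τ _ => measurableSet_toPerm_eq τ
  simp only [h₁, Finset.sum_const, Finset.card_univ, Fintype.card_perm, Fintype.card_fin,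
    nsmul_eq_mul] at h₂
  field_simp
  linarith

/-! ### The merged order -/

theorem eq_filter_append_filter {W : List ℕ} {ε : ℕ → Bool}
    (h : W.Pairwise fun a b => ε a = true → ε b = true) :
    W = W.filter (fun i => ε i == false) ++ W.filter (fun i => ε i == true) := by
  induction W with
  | nil => rfl
  | cons a W ih =>
    rw [List.pairwise_cons] at h
    cases ha : ε a
    · simpa [ha] using ih h.2
    · have h₁ : W.filter (fun i => ε i == false) = [] := by
        rw [List.filter_eq_nil_iff]
        intro b hb
        simp [h.1 b hb ha]
      have h₂ : W.filter (fun i => ε i == true) = W := by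
        rw [List.filter_eq_self]
        intro b hb
        simp [h.1 b hb ha]
      rw [List.filter_cons_of_neg (by simp [ha]), List.filter_cons_of_pos (by simp [ha]), h₁, h₂]
      rfl

/-- `classIndex` identifies the members of a class below `n` with an initial segment of `ℕ`. -/
theorem map_classIndex_filter_range (ε : ℕ → Bool) (b : Bool) (n : ℕ) :
    ((List.range n).filter (fun i => ε i == b)).map (classIndex ε) =
      List.range ((List.range n).filter (fun i => ε i == b)).length := by
  induction n with
  | zero => rfl
  | succ n ih =>
    rw [List.range_succ, List.filter_append, List.map_append, ih]
    by_cases h : ε n = b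
    · have : classIndex ε n = ((List.range n).filter (fun i => ε i == b)).length := by
        rw [classIndex, Nat.count, List.countP_eq_length_filter]
        congr 1
        refine List.filter_congr fun i _ => ?_
        rw [h, beq_eq_decide]
      simp [h, this, List.range_succ]
    · simp [h]

theorem classIndex_lt_iff {ε : ℕ → Bool} {i j : ℕ} (h : ε i = ε j) :
    classIndex ε i < classIndex ε j ↔ i < j := by
  refine ⟨fun h' => ?_, classIndex_lt h⟩
  by_contra! hji
  rcases hji.eq_or_lt with rfl | hji
  · exact lt_irrefl _ h'
  · exact (classIndex_lt h.symm hji).not_gt h'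

/-- Each of the two classes is ordered in the merged order as its own order prescribes. -/
theorem rankCode_filter_word_merge (ε : ℕ → Bool) (O₁ O₂ : Orders) (n : ℕ) (b : Bool) :
    rankCode ((word (merge (ε, O₁, O₂)) n).filter (fun i => ε i == b)) =
      code (cond b O₁ O₂) ((word (merge (ε, O₁, O₂)) n).filter (fun i => ε i == b)).length := by
  set W := word (merge (ε, O₁, O₂)) n with hW
  have hperm := (word_perm (merge (ε, O₁, O₂)) n).filter (fun i => ε i == b)
  rw [← hW] at hperm
  have hmono : ∀ i ∈ W.filter (fun i => ε i == b), ∀ j ∈ W.filter (fun i => ε i == b),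
      classIndex ε i < classIndex ε j ↔ i < j := by
    intro i hi j hj
    have hij : ε i = ε j := by
      have h₁ := (List.mem_filter.1 hi).2
      have h₂ := (List.mem_filter.1 hj).2
      simp only [beq_iff_eq] at h₁ h₂
      rw [h₁, h₂]
    exact classIndex_lt_iff hij
  rw [← rankCode_map hmono, code]
  congr 1
  refine eq_word ?_ ?_
  · rw [hperm.length_eq, ← map_classIndex_filter_range ε b n]
    exact hperm.map _
  · rw [List.pairwise_map]
    refine List.Pairwise.imp_of_mem ?_ ((pairwise_word (merge (ε, O₁, O₂)) n).filter _)
    intro i j hi hj hij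
    have h₁ := (List.mem_filter.1 hi).2
    have h₂ := (List.mem_filter.1 hj).2
    simp only [beq_iff_eq] at h₁ h₂
    rw [prec_merge, MergeRel] at hij
    cases b <;> simpa [h₁, h₂] using hij

/-- The set of triples for which the merged order has the word `L` on the first `n` letters and
`N₁` contributes the first `k` letters of the word. -/
def mergeEvent (L : List ℕ) (k : ℕ) : Set ((ℕ → Bool) × Orders × Orders) :=
  (Set.pi (Finset.range L.length) fun i => {decide (i ∈ L.drop (L.length - k))}) ×ˢ
    ({O | code O k = rankCode (L.drop (L.length - k))} ×ˢ
      {O | code O (L.length - k) = rankCode (L.take (L.length - k))})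

/-- The merged word `L` splits into a beginning from `N₁`, of some length `k`, and an end from
`N₂`. -/
theorem code_merge_eq_iff {L : List ℕ} (hL : L.Perm (List.range L.length))
    (x : (ℕ → Bool) × Orders × Orders) :
    code (merge x) L.length = rankCode L ↔
      ∃ k ∈ Finset.range (L.length + 1), x ∈ mergeEvent L k := by
  obtain ⟨ε, O₁, O₂⟩ := x
  set n := L.length with hn
  set W := word (merge (ε, O₁, O₂)) n with hW
  have hsplit : W = W.filter (fun i => ε i == false) ++ W.filter (fun i => ε i == true) := by
    refine eq_filter_append_filter ((pairwise_word _ n).imp fun {a b} hab ha => ?_)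
    rw [prec_merge, MergeRel] at hab
    simp only at hab
    by_contra hb
    simp only [Bool.not_eq_true] at hb
    simp [ha, hb] at hab
  have hlenW : W.length = n := length_word _ _
  have hlen : (W.filter (fun i => ε i == false)).length +
      (W.filter (fun i => ε i == true)).length = n := by
    rw [← List.length_append, ← hsplit, hlenW]
  have ht := rankCode_filter_word_merge ε O₁ O₂ n true
  have hf := rankCode_filter_word_merge ε O₁ O₂ n false
  rw [← hW, cond_true] at ht
  rw [← hW, cond_false] at hf
  rw [code_eq_iff hL, ← hW]
  simp only [mergeEvent, ← hn, Finset.mem_range, mem_prod, Set.mem_pi, mem_singleton_iff,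
    mem_ofPred_eq, Finset.mem_coe]
  constructor
  · intro h
    have hdrop := List.drop_left (l₁ := W.filter (fun i => ε i == false))
      (l₂ := W.filter (fun i => ε i == true))
    have htake := List.take_left (l₁ := W.filter (fun i => ε i == false))
      (l₂ := W.filter (fun i => ε i == true))
    rw [← hsplit] at hdrop htake
    refine ⟨(W.filter (fun i => ε i == true)).length, by omega, ?_, ?_, ?_⟩
    all_goals
      rw [show n - (W.filter (fun i => ε i == true)).length =
        (W.filter (fun i => ε i == false)).length by omega, ← h]
    · intro i hi
      have hiW : i ∈ W := mem_word.2 hi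
      rw [hdrop]
      simp [hiW]
    · rw [hdrop, ht]
    · rw [htake, hf]
  · rintro ⟨k, hk, h₁, h₂, h₃⟩
    have hnd : L.Nodup := hL.symm.nodup List.nodup_range
    have hLs := List.take_append_drop (n - k) L
    have hdisj := List.disjoint_of_nodup_append (hLs.symm ▸ hnd)
    have hWL : W.Perm L := (word_perm _ n).trans hL.symm
    have hmemL : ∀ i, i ∈ L ↔ i < n := fun i => by rw [hL.mem_iff, List.mem_range]
    have p₁ : (W.filter (fun i => ε i == true)).Perm (L.drop (n - k)) := by
      rw [List.perm_ext_iff_of_nodup ((nodup_word _ _).filter _)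
        (hnd.sublist (List.drop_sublist _ _))]
      intro i
      rw [List.mem_filter, mem_word]
      constructor
      · rintro ⟨hi, he⟩
        simpa [h₁ i hi] using he
      · intro hi
        have hi' : i < n := (hmemL i).1 (List.mem_of_mem_drop hi)
        exact ⟨hi', by simp [h₁ i hi', hi]⟩
    have p₂ : (W.filter (fun i => ε i == false)).Perm (L.take (n - k)) := by
      rw [List.perm_ext_iff_of_nodup ((nodup_word _ _).filter _)
        (hnd.sublist (List.take_sublist _ _))]
      intro i
      rw [List.mem_filter, mem_word]
      constructor
      · rintro ⟨hi, he⟩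
        have : i ∉ L.drop (n - k) := by simpa [h₁ i hi] using he
        have hiL := (hmemL i).2 hi
        rw [← hLs, List.mem_append] at hiL
        exact hiL.resolve_right this
      · intro hi
        have hi' : i < n := (hmemL i).1 (List.mem_of_mem_take hi)
        refine ⟨hi', ?_⟩
        have : i ∉ L.drop (n - k) := fun h => hdisj hi h
        simp [h₁ i hi', this]
    have l₁ : (W.filter (fun i => ε i == true)).length = k := by
      rw [p₁.length_eq, List.length_drop, ← hn]; omega
    have l₂ : (W.filter (fun i => ε i == false)).length = n - k := by omega
    rw [l₁, h₂] at ht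
    rw [l₂, h₃] at hf
    rw [hsplit, eq_of_rankCode_eq p₁ ht, eq_of_rankCode_eq p₂ hf, hLs]

theorem bernoulli_cylinder (p : unitInterval) {n : ℕ} {l : List ℕ} (hl : l.Nodup)
    (hln : ∀ i ∈ l, i < n) :
    (Measure.infinitePi fun _ : ℕ => ProbabilityTheory.bernoulliMeasure true false p).real
      (Set.pi (Finset.range n) fun i => {decide (i ∈ l)}) =
      (p : ℝ) ^ l.length * (1 - p) ^ (n - l.length) := by
  rw [measureReal_def, Measure.infinitePi_pi _ fun i _ => measurableSet_singleton _,
    ENNReal.toReal_prod]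
  have h₁ : ∀ i ∈ Finset.range n,
      (ProbabilityTheory.bernoulliMeasure true false p {decide (i ∈ l)}).toReal =
        if i ∈ l then (p : ℝ) else 1 - p := by
    intro i _
    by_cases hi : i ∈ l <;> simp [hi, ProbabilityTheory.bernoulliMeasure_def]
  have h₂ : (Finset.range n).filter (· ∈ l) = l.toFinset := by
    ext i
    simp only [Finset.mem_filter, Finset.mem_range, List.mem_toFinset]
    exact ⟨fun h => h.2, fun h => ⟨hln i h, h⟩⟩
  have h₃ : ((Finset.range n).filter (· ∈ l)).card = l.length := by
    rw [h₂, List.toFinset_card_of_nodup hl]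
  have h₄ : ((Finset.range n).filter (· ∉ l)).card = n - l.length := by
    rw [Finset.filter_not, Finset.card_sdiff_of_subset (Finset.filter_subset _ _), h₃,
      Finset.card_range]
  rw [Finset.prod_congr rfl h₁, Finset.prod_ite, Finset.prod_const, Finset.prod_const, h₃, h₄]

/-- The rank codes of the merged order. -/
theorem codeProb_merge (p : unitInterval) (P : Measure Orders) [IsProbabilityMeasure P]
    {c : List ℕ} (hc : IsCode c) :
    codeProb (((Measure.infinitePi fun _ : ℕ =>
      ProbabilityTheory.bernoulliMeasure true false p).prod (P.prod exchangeable)).map merge) c =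
    ∑ k ∈ Finset.range (c.length + 1), (p : ℝ) ^ k * (1 - p) ^ (c.length - k) *
      (codeProb P (c.drop (c.length - k)) * (1 / ((c.length - k).factorial : ℝ))) := by
  obtain ⟨L, hL, rfl⟩ := exists_rankCode_eq hc
  rw [length_rankCode] at hL ⊢
  have hnd : L.Nodup := hL.symm.nodup List.nodup_range
  have hset : merge ⁻¹' {O | code O L.length = rankCode L} =
      ⋃ k ∈ Finset.range (L.length + 1), mergeEvent L k := by
    ext x
    simp only [mem_preimage, mem_ofPred_eq, code_merge_eq_iff hL, mem_iUnion, exists_prop]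
  have hmeas : ∀ k, MeasurableSet (mergeEvent L k) := fun k =>
    (MeasurableSet.pi (Finset.countable_toSet _) fun i _ => measurableSet_singleton _).prod
      ((measurableSet_code_eq _ _).prod (measurableSet_code_eq _ _))
  rw [codeProb, length_rankCode, map_measureReal_apply measurable_merge (measurableSet_code_eq _ _),
    hset, measureReal_biUnion_finset _ fun k _ => hmeas k]
  · refine Finset.sum_congr rfl fun k hk => ?_
    have hk' : k ≤ L.length := Nat.lt_succ_iff.1 (Finset.mem_range.1 hk)
    have hlen : (L.drop (L.length - k)).length = k := by simp; omega
    rw [mergeEvent, measureReal_prod_prod, measureReal_prod_prod,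
      bernoulli_cylinder p (hnd.sublist (List.drop_sublist _ _)) fun i hi => ?_, hlen]
    · have h₁ := codeProb_exchangeable (isCode_rankCode (L.take (L.length - k)))
      rw [length_rankCode, List.length_take, Nat.min_eq_left (Nat.sub_le _ _)] at h₁
      rw [← h₁, codeProb, codeProb, ← rankCode_drop, length_rankCode, length_rankCode, hlen,
        List.length_take, Nat.min_eq_left (Nat.sub_le _ _)]
    · have := hL.mem_iff.1 (List.mem_of_mem_drop hi)
      simpa using this
  · intro k hk k' hk' hne
    refine Set.disjoint_left.2 fun x hx hx' => hne ?_
    simp only [Finset.coe_range, mem_Iio] at hk hk'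
    have h₁ := hx.1
    have h₂ := hx'.1
    simp only [Set.mem_pi, mem_singleton_iff] at h₁ h₂
    have h₃ : (L.drop (L.length - k)).Perm (L.drop (L.length - k')) := by
      rw [List.perm_ext_iff_of_nodup (hnd.sublist (List.drop_sublist _ _))
        (hnd.sublist (List.drop_sublist _ _))]
      intro i
      by_cases hi : i ∈ Finset.range L.length
      · have := (h₁ i hi).symm.trans (h₂ i hi)
        simpa using this
      · have : i ∉ L := fun h => hi (by simpa using hL.mem_iff.1 h)
        exact ⟨fun h => absurd (List.mem_of_mem_drop h) this,
          fun h => absurd (List.mem_of_mem_drop h) this⟩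
    have := h₃.length_eq
    simp only [List.length_drop] at this
    omega

open Polynomial in
/-- Thinning with probability `p` multiplies the binomial moments by powers of `p`. -/
theorem moment_thinning {φ φ' : List ℕ → ℝ} {c : List ℕ} (p : ℝ)
    (h : ∀ j ≤ c.length, φ' (c.drop j) = ∑ k ∈ Finset.range (c.length - j + 1),
      p ^ k * (1 - p) ^ (c.length - j - k) *
        (φ (c.drop (c.length - k)) * (1 / ((c.length - j - k).factorial : ℝ)))) :
    moment φ' c = p ^ c.length * moment φ c := by
  set n := c.length with hn
  -- the linear functional on polynomials that sends `X ^ k` to `k! φ (c_k)`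
  let L : ℝ[X] →ₗ[ℝ] ℝ := ∑ k ∈ Finset.range (n + 1),
    ((k.factorial : ℝ) * φ (c.drop (n - k))) • Polynomial.lcoeff ℝ k
  have hL : ∀ f : ℝ[X], L f = ∑ k ∈ Finset.range (n + 1),
      f.coeff k * ((k.factorial : ℝ) * φ (c.drop (n - k))) := by
    intro f
    simp only [L, LinearMap.sum_apply, LinearMap.smul_apply, Polynomial.lcoeff_apply, smul_eq_mul]
    exact Finset.sum_congr rfl fun k _ => mul_comm _ _
  have h₀ : ∀ m, L ((X + C (-1)) ^ m) = ∑ k ∈ Finset.range (n + 1),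
      (-1) ^ (m - k) * (m.choose k : ℝ) * ((k.factorial : ℝ) * φ (c.drop (n - k))) := by
    intro m
    rw [hL]
    exact Finset.sum_congr rfl fun k _ => by rw [coeff_X_add_C_pow]
  have h₁ : ∀ j ≤ n, (j.factorial : ℝ) * φ' (c.drop (n - j)) = L ((C p * X + C (1 - p)) ^ j) := by
    intro j hj
    rw [h (n - j) (Nat.sub_le _ _), Nat.sub_sub_self hj, add_pow, map_sum, Finset.mul_sum]
    refine Finset.sum_congr rfl fun k hk => ?_
    have hkj : k ≤ j := Nat.lt_succ_iff.1 (Finset.mem_range.1 hk)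
    have e : (C p * X) ^ k * C (1 - p) ^ (j - k) * ((j.choose k : ℕ) : ℝ[X]) =
        (p ^ k * (1 - p) ^ (j - k) * (j.choose k : ℝ)) • X ^ k := by
      rw [smul_eq_C_mul, mul_pow]
      simp only [map_mul, map_pow, map_natCast]
      ring
    rw [e, map_smul, hL, Finset.sum_eq_single k]
    · rw [coeff_X_pow, if_pos rfl, smul_eq_mul, one_mul, Nat.choose_eq_factorial_div_factorial hkj,
        Nat.cast_div (Nat.factorial_mul_factorial_dvd_factorial hkj)]
      · have := Nat.factorial_ne_zero (j - k)
        have := Nat.factorial_ne_zero k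
        push_cast
        field_simp
      · positivity
    · intro i _ hi
      rw [coeff_X_pow, if_neg hi, zero_mul]
    · intro hk'
      exact absurd (Finset.mem_range.2 (by omega)) hk'
  unfold moment
  rw [← hn, ← h₀ n, Finset.sum_congr rfl fun k hk => by
    rw [h₁ k (Nat.lt_succ_iff.1 (Finset.mem_range.1 hk))]]
  have e : C p ^ n * (X + C (-1)) ^ n =
      ∑ k ∈ Finset.range (n + 1), ((-1 : ℝ) ^ (n - k) * (n.choose k : ℝ)) •
        (C p * X + C (1 - p)) ^ k := by
    rw [← mul_pow, show C p * (X + C (-1)) = (C p * X + C (1 - p)) + C (-1) by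
      simp only [map_sub, map_neg, map_one]; ring, add_pow]
    refine Finset.sum_congr rfl fun k _ => ?_
    rw [smul_eq_C_mul]
    simp only [map_mul, map_pow, map_natCast]
    ring
  have e' := congrArg L e
  rw [map_sum, ← map_pow, ← smul_eq_C_mul, map_smul] at e'
  simpa using e'.symm

/-! ### Moments of the random orders -/

/-- Every non-record position `a ≥ c.length` multiplies the moment of `c` by `1 - c.length / a`. -/
theorem moment_rankProb (A : ℕ → Bool) {c : List ℕ} (hc : IsCode c) (k : ℕ) :
    moment (rankProb A (c.length + k)) c = moment (rankProb A c.length) c *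
      ∏ j ∈ Finset.range k, (1 - c.length * weight A (c.length + j)) := by
  induction k with
  | zero => simp
  | succ k ih =>
    rw [Finset.prod_range_succ, ← mul_assoc, ← ih, mul_comm _ (1 - _)]
    set N := c.length + k with hN
    by_cases h : N ≠ 0 ∧ A N = true
    · rw [weight, if_pos h, mul_one_div]
      refine moment_step ?_ fun j hj => ?_
      · rw [rankProb_nil, rankProb_nil]
      · rw [List.drop_eq_getElem_cons hj]
        have hcode := hc.drop j
        rw [List.drop_eq_getElem_cons hj] at hcode
        have hlen : (c.drop (j + 1)).length + 1 = c.length - j := by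
          rw [List.length_drop]; omega
        rw [← hlen]
        exact rankProb_succ_of_true h hcode.1 (by rw [hlen]; omega)
    · rw [weight, if_neg h, mul_zero, sub_zero, one_mul]
      refine moment_congr fun j _ => ?_
      exact rankProb_succ_of_false h (by rw [List.length_drop]; omega)

theorem map_revList_congr {A B : ℕ → Bool} {N : ℕ} (h : ∀ i < N, A i = B i) :
    (rankMeasure A).map (fun r => revList r N) = (rankMeasure B).map (fun r => revList r N) := by
  induction N with
  | zero => simp [revList]
  | succ N ih =>
    have h₁ : ∀ A : ℕ → Bool, (rankMeasure A).map (fun r => revList r (N + 1)) =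
        ((rankDist A N).prod ((rankMeasure A).map fun r => revList r N)).map
          (fun p => p.1 :: p.2) := by
      intro A
      rw [← map_head_revList, Measure.map_map (measurable_of_countable _) (by fun_prop)]
      rfl
    rw [h₁, h₁, ih fun i hi => h i (hi.trans N.lt_succ_self)]
    simp only [rankDist, h N N.lt_succ_self]

theorem rankProb_congr_left {A B : ℕ → Bool} {N : ℕ} (h : ∀ i < N, A i = B i) (c : List ℕ) :
    rankProb A N c = rankProb B N c := by
  have h₁ : ∀ A : ℕ → Bool, rankProb A N c =
      ((rankMeasure A).map (fun r => revList r N)).real {C | restr c.length C = c} := fun A => by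
    rw [map_measureReal_apply (by fun_prop) MeasurableSet.of_discrete]
    rfl
  rw [h₁, h₁, map_revList_congr h]

theorem continuous_of_eq_of_forall_lt {n : ℕ} {f : (ℕ → Bool) → ℝ}
    (h : ∀ A B : ℕ → Bool, (∀ i < n, A i = B i) → f A = f B) : Continuous f := by
  have : f = (fun B : Fin n → Bool => f fun i => if h : i < n then B ⟨i, h⟩ else false) ∘
      fun A i => A i := by
    funext A
    exact h _ _ fun i hi => by simp [hi]
  rw [this]
  exact continuous_of_discreteTopology.comp (continuous_pi fun i => continuous_apply _)

theorem continuous_weight (a : ℕ) : Continuous fun A : ℕ → Bool => weight A a :=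
  continuous_of_eq_of_forall_lt (n := a + 1) fun A B h => by simp [weight, h a a.lt_succ_self]

/-- The factor `(1 - t) e ^ t` of the infinite product below. It differs from `1` by at most `t ^ 2`,
so that the product converges uniformly in the set of non-records, also when `∑ 1 / a` diverges. -/
def normFactor (t : ℝ) : ℝ := (1 - t) * Real.exp t

theorem normFactor_nonneg {t : ℝ} (h : t ≤ 1) : 0 ≤ normFactor t :=
  mul_nonneg (by linarith) (Real.exp_pos t).le

theorem normFactor_le_one (t : ℝ) : normFactor t ≤ 1 := by
  have h := Real.add_one_le_exp (-t)
  have h₁ : normFactor t ≤ Real.exp (-t) * Real.exp t :=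
    mul_le_mul_of_nonneg_right (by linarith) (Real.exp_pos t).le
  rwa [← Real.exp_add, neg_add_cancel, Real.exp_zero] at h₁

theorem one_sub_normFactor_le {t : ℝ} (h : t ≤ 1) : 1 - normFactor t ≤ t ^ 2 := by
  have h₁ := mul_le_mul_of_nonneg_left (Real.add_one_le_exp t) (show 0 ≤ 1 - t by linarith)
  unfold normFactor
  nlinarith

/-- Partial products of `(1 - n / a) e ^ (n / a)` over the non-record positions `a ≥ n`. -/
def partialProd (n : ℕ) (A : ℕ → Bool) (k : ℕ) : ℝ :=
  ∏ j ∈ Finset.range k, normFactor (n * weight A (n + j))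

/-- The infinite product of `(1 - n / a) e ^ (n / a)` over the non-record positions `a ≥ n`,
written as a telescoping series. -/
def infProd (n : ℕ) (A : ℕ → Bool) : ℝ := 1 + ∑' k, (partialProd n A (k + 1) - partialProd n A k)

theorem weight_le (A : ℕ → Bool) (a : ℕ) : weight A a ≤ 1 / a := by
  unfold weight
  split_ifs
  · exact le_rfl
  · positivity

theorem mul_weight_le (n : ℕ) (A : ℕ → Bool) (j : ℕ) : n * weight A (n + j) ≤ n / (n + j : ℕ) := by
  rw [div_eq_mul_one_div]
  exact mul_le_mul_of_nonneg_left (weight_le A _) (Nat.cast_nonneg n)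

theorem mul_weight_le_one (n : ℕ) (A : ℕ → Bool) (j : ℕ) : n * weight A (n + j) ≤ 1 :=
  (mul_weight_le n A j).trans (div_le_one_of_le₀ (by push_cast; linarith [Nat.cast_nonneg (α := ℝ) j])
    (Nat.cast_nonneg _))

theorem partialProd_mem (n : ℕ) (A : ℕ → Bool) (k : ℕ) :
    0 ≤ partialProd n A k ∧ partialProd n A k ≤ 1 :=
  ⟨Finset.prod_nonneg fun j _ => normFactor_nonneg (mul_weight_le_one n A j),
    Finset.prod_le_one (fun j _ => normFactor_nonneg (mul_weight_le_one n A j))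
      fun _ _ => normFactor_le_one _⟩

theorem norm_partialProd_sub_le (n : ℕ) (A : ℕ → Bool) (k : ℕ) :
    ‖partialProd n A (k + 1) - partialProd n A k‖ ≤ (n / (n + k : ℕ) : ℝ) ^ 2 := by
  have h₁ := partialProd_mem n A k
  have h₂ := one_sub_normFactor_le (mul_weight_le_one n A k)
  have h₃ := normFactor_le_one (n * weight A (n + k))
  have h₄ : (n * weight A (n + k)) ^ 2 ≤ (n / (n + k : ℕ) : ℝ) ^ 2 :=
    pow_le_pow_left₀ (mul_nonneg (Nat.cast_nonneg n) (weight_nonneg A _)) (mul_weight_le n A k) 2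
  rw [partialProd, Finset.prod_range_succ]
  change ‖partialProd n A k * normFactor (n * weight A (n + k)) - partialProd n A k‖ ≤ _
  rw [Real.norm_eq_abs, abs_le]
  constructor <;> nlinarith

theorem summable_bound (n : ℕ) : Summable fun k : ℕ => (n / (n + k : ℕ) : ℝ) ^ 2 := by
  have h := (summable_nat_add_iff n).2 (Real.summable_one_div_nat_pow.2 one_lt_two)
  have h₁ := h.mul_left ((n : ℝ) ^ 2)
  refine h₁.congr fun k => ?_
  rw [add_comm k n, div_pow, mul_one_div]

theorem continuous_infProd (n : ℕ) : Continuous (infProd n) := by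
  refine continuous_const.add (continuous_tsum (fun k => ?_) (summable_bound n)
    fun k A => norm_partialProd_sub_le n A k)
  have h : ∀ k, Continuous fun A => partialProd n A k := fun k =>
    continuous_finsetProd _ fun j _ => by
      have := continuous_weight (n + j)
      unfold normFactor
      fun_prop
  exact (h (k + 1)).sub (h k)

theorem tendsto_partialProd (n : ℕ) (A : ℕ → Bool) :
    Tendsto (partialProd n A) atTop (𝓝 (infProd n A)) := by
  have hs : Summable fun k => partialProd n A (k + 1) - partialProd n A k :=
    Summable.of_norm_bounded (summable_bound n) (norm_partialProd_sub_le n A)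
  have h := hs.hasSum.tendsto_sum_nat
  simp only [Finset.sum_range_sub] at h
  have h₀ : partialProd n A 0 = 1 := by simp [partialProd]
  have h₁ := h.const_add 1
  simp only [h₀, add_sub_cancel] at h₁
  exact h₁

/-- The moments as a continuous function on the compact space of pairs `(A, q)`, where `A` is a set
of non-record positions and `q` corresponds to `p * exp (- ∑ a ∈ A, 1 / a)`. -/
def extMoment (c : List ℕ) (x : (ℕ → Bool) × ℝ) : ℝ :=
  moment (rankProb x.1 c.length) c * (x.2 ^ c.length *
    Real.exp (c.length * ∑ a ∈ Finset.range c.length, weight x.1 a) * infProd c.length x.1)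

theorem continuous_extMoment (c : List ℕ) : Continuous (extMoment c) := by
  have h₁ : Continuous fun A : ℕ → Bool => moment (rankProb A c.length) c :=
    continuous_of_eq_of_forall_lt (n := c.length) fun A B h =>
      moment_congr fun k _ => rankProb_congr_left h _
  have h₂ : Continuous fun A : ℕ → Bool => ∑ a ∈ Finset.range c.length, weight A a :=
    continuous_finsetSum _ fun a _ => continuous_weight a
  have h₃ := continuous_infProd c.length
  exact (h₁.comp continuous_fst).mul (((continuous_snd.pow _).mul (Real.continuous_exp.comp
    (continuous_const.mul (h₂.comp continuous_fst)))).mul (h₃.comp continuous_fst))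

/-- The total weight of a set of non-record positions. -/
def totalWeight (A : ℕ → Bool) : ℝ := ∑' a, weight A a

/-- The moments of the limit order, thinned with probability `p`. -/
theorem tendsto_moment {A : ℕ → Bool} (hA : Summable (weight A)) (p : ℝ) {c : List ℕ}
    (hc : IsCode c) :
    Tendsto (fun k => p ^ c.length * moment (rankProb A (c.length + k)) c) atTop
      (𝓝 (extMoment c (A, p * Real.exp (-totalWeight A)))) := by
  set n := c.length with hn
  have h₁ : ∀ k, p ^ n * moment (rankProb A (n + k)) c = moment (rankProb A n) c *
      (p ^ n * Real.exp (-(n * ∑ j ∈ Finset.range k, weight A (n + j))) * partialProd n A k) := by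
    intro k
    rw [hn, moment_rankProb A hc k, ← hn, partialProd]
    simp only [normFactor]
    rw [Finset.prod_mul_distrib, ← Real.exp_sum, ← Finset.mul_sum]
    have := Real.exp_ne_zero (n * ∑ j ∈ Finset.range k, weight A (n + j))
    rw [Real.exp_neg]
    field_simp
  have h₂ : Tendsto (fun k => ∑ j ∈ Finset.range k, weight A (n + j)) atTop
      (𝓝 (totalWeight A - ∑ a ∈ Finset.range n, weight A a)) := by
    have h := hA.hasSum.tendsto_sum_nat.comp (tendsto_add_atTop_nat n)
    have h' := h.sub_const (∑ a ∈ Finset.range n, weight A a)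
    refine h'.congr fun k => ?_
    simp only [Function.comp_apply]
    rw [add_comm k n, Finset.sum_range_add, add_sub_cancel_left]
  simp only [h₁]
  have h₃ : extMoment c (A, p * Real.exp (-totalWeight A)) = moment (rankProb A n) c *
      (p ^ n * Real.exp (-(n * (totalWeight A - ∑ a ∈ Finset.range n, weight A a))) *
        infProd n A) := by
    simp only [extMoment, ← hn]
    rw [mul_pow, ← Real.exp_nat_mul, mul_assoc (p ^ n), ← Real.exp_add]
    congr 4
    ring
  rw [h₃]
  refine Tendsto.const_mul _ (Tendsto.mul (Tendsto.const_mul _ ?_) (tendsto_partialProd n A))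
  exact (Real.continuous_exp.tendsto _).comp (h₂.const_mul _).neg

/-- At a finite set of non-records with `p = 1`, the extended moments are those of finitely many
ranks, since further records do not change them. -/
theorem extMoment_finite {A : ℕ → Bool} {N : ℕ} (h : ∀ i, N ≤ i → A i = false) {c : List ℕ}
    (hc : IsCode c) (hN : c.length ≤ N) :
    extMoment c (A, Real.exp (-totalWeight A)) = moment (rankProb A N) c := by
  have h₀ : ∀ i ∉ Finset.range N, weight A i = 0 := fun i hi => by
    simp [weight, h i (by simpa using hi)]
  have hA : Summable (weight A) := summable_of_ne_finset_zero (s := Finset.range N) h₀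
  have h₁ := tendsto_moment hA 1 hc
  rw [one_mul] at h₁
  refine tendsto_nhds_unique h₁ (tendsto_const_nhds.congr' ?_)
  filter_upwards [eventually_ge_atTop (N - c.length)] with k hk
  obtain ⟨e, rfl⟩ := Nat.exists_eq_add_of_le hk
  rw [one_pow, one_mul]
  obtain ⟨d, rfl⟩ := Nat.exists_eq_add_of_le hN
  rw [moment_rankProb A hc, moment_rankProb A hc, show c.length + d - c.length + e = d + e by omega,
    Finset.prod_range_add]
  rw [Finset.prod_eq_one (s := Finset.range e), mul_one]
  intro j _
  rw [h₀ _ (by simp), mul_zero, sub_zero]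

/-- The points with `q = 0` correspond to the exchangeable order, whatever the set `A` is. -/
theorem extMoment_zero {c : List ℕ} (hc : IsCode c) (A : ℕ → Bool) :
    extMoment c (A, 0) = moment (codeProb exchangeable) c := by
  have h := moment_thinning (φ := rankProb A c.length) (φ' := codeProb exchangeable) (c := c) 0 ?_
  · rw [h]
    cases c with
    | nil => simp [extMoment, infProd, partialProd, normFactor]
    | cons s c => simp [extMoment]
  · intro j hj
    rw [codeProb_exchangeable (hc.drop j), Finset.sum_eq_single 0]
    · simp [rankProb_nil, List.length_drop]
    · intro k _ hk
      simp [hk]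
    · simp

/-! ### The parameters -/

open Classical in
/-- The indicator function of the set of finite values of `α`, i.e. of the non-record positions. -/
def nonRecords (α : AlphaSeq) (i : ℕ) : Bool := decide (∃ k, α.1 k = (i : ℕ∞))

theorem nonRecords_eq_true {α : AlphaSeq} {i : ℕ} :
    nonRecords α i = true ↔ ∃ k, α.1 k = (i : ℕ∞) := by
  simp [nonRecords]

theorem nonRecords_zero (α : AlphaSeq) : nonRecords α 0 = false := by
  by_contra h
  rw [Bool.not_eq_false, nonRecords_eq_true] at h
  obtain ⟨k, hk⟩ := h
  have := α.2.1 k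
  rw [hk] at this
  simp at this

theorem rankLaw_eq (α : AlphaSeq) : rankLaw α = rankDist (nonRecords α) := by
  funext i
  have h : (∃ k, α.1 k = (i : ℕ∞)) ↔ (i ≠ 0 ∧ nonRecords α i = true) := by
    rw [nonRecords_eq_true]
    refine ⟨fun h => ⟨?_, h⟩, fun h => h.2⟩
    rintro rfl
    have := nonRecords_zero α
    rw [← Bool.not_eq_true, nonRecords_eq_true] at this
    exact this h
  simp only [rankLaw, rankDist, h]

theorem alphaOne_eq (α : AlphaSeq) :
    alphaOne α = (rankMeasure (nonRecords α)).map orderOfRanks := by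
  simp only [alphaOne, rankMeasure, rankLaw_eq]

theorem summable_weight (α : AlphaSeq) : Summable (weight (nonRecords α)) := by
  have h : ∑' a, ENNReal.ofReal (weight (nonRecords α) a) ≠ ∞ := by
    refine ne_top_of_le_ne_top α.2.2.2.ne ?_
    set S : Set ℕ := {a | a ≠ 0 ∧ nonRecords α a = true} with hS
    have h₁ : ∑' a, ENNReal.ofReal (weight (nonRecords α) a) =
        ∑' a : S, ((a : ℕ) : ℝ≥0∞)⁻¹ := by
      rw [tsum_subtype S fun a : ℕ => (a : ℝ≥0∞)⁻¹]
      refine tsum_congr fun a => ?_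
      by_cases ha : a ∈ S
      · rw [indicator_of_mem ha, ofReal_weight ha, one_div]
      · have ha' : ¬ (a ≠ 0 ∧ nonRecords α a = true) := ha
        rw [indicator_of_notMem ha, weight, if_neg ha', ENNReal.ofReal_zero]
    have h₂ : ∀ a : S, ∃ k, α.1 k = ((a : ℕ) : ℕ∞) := fun a => nonRecords_eq_true.1 a.2.2
    choose f hf using h₂
    have hinj : Function.Injective f := fun a b hab => by
      have := (hf a).symm.trans ((congrArg α.1 hab).trans (hf b))
      exact Subtype.ext (by exact_mod_cast this)
    rw [h₁]
    refine le_trans (le_of_eq (tsum_congr fun a => ?_))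
      (ENNReal.tsum_comp_le_tsum_of_injective hinj fun k => ((α.1 k : ℝ≥0∞))⁻¹)
    simp [hf]
  have h' := ENNReal.summable_toReal h
  refine h'.congr fun a => ?_
  rw [ENNReal.toReal_ofReal (weight_nonneg _ _)]

instance (α : AlphaSeq) : IsProbabilityMeasure (alphaOne α) := by
  rw [alphaOne_eq]
  exact Measure.isProbabilityMeasure_map measurable_orderOfRanks.aemeasurable

instance (α : AlphaSeq) (p : unitInterval) : IsProbabilityMeasure (alphaP α p) :=
  Measure.isProbabilityMeasure_map measurable_merge.aemeasurable

instance (ω : Param) : IsProbabilityMeasure (paramMeasure ω) := by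
  cases ω <;> simp only [paramMeasure] <;> infer_instance

theorem moment_codeProb_alphaP (α : AlphaSeq) (p : unitInterval) {c : List ℕ} (hc : IsCode c) :
    moment (codeProb (alphaP α p)) c =
      extMoment c (nonRecords α, p * Real.exp (-totalWeight (nonRecords α))) := by
  have h₁ : moment (codeProb (alphaP α p)) c =
      (p : ℝ) ^ c.length * moment (codeProb (alphaOne α)) c := by
    refine moment_thinning _ fun j hj => ?_
    rw [alphaP, codeProb_merge p _ (hc.drop j), List.length_drop]
    refine Finset.sum_congr rfl fun k hk => ?_
    have hk' : k ≤ c.length - j := Nat.lt_succ_iff.1 (Finset.mem_range.1 hk)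
    rw [List.drop_drop, show j + (c.length - j - k) = c.length - k by omega]
  rw [h₁]
  refine tendsto_nhds_unique (Tendsto.const_mul _ ?_) (tendsto_moment (summable_weight α) p hc)
  unfold moment
  refine tendsto_finsetSum _ fun k _ => Tendsto.const_mul _ (Tendsto.const_mul _ ?_)
  rw [alphaOne_eq]
  have h := (tendsto_rankProb (summable_weight α) (c.drop (c.length - k))).comp
    (tendsto_add_atTop_nat c.length)
  refine h.congr fun N => ?_
  simp only [Function.comp_apply, add_comm]

/-- The point of the compact parameter space that corresponds to `ω`. -/
def extParam : Param → (ℕ → Bool) × ℝ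
  | Param.star => (fun _ => false, 0)
  | Param.pair α p => (nonRecords α, p * Real.exp (-totalWeight (nonRecords α)))

theorem moment_paramMeasure (ω : Param) {c : List ℕ} (hc : IsCode c) :
    moment (codeProb (paramMeasure ω)) c = extMoment c (extParam ω) := by
  cases ω with
  | star => exact (extMoment_zero hc _).symm
  | pair α p => exact moment_codeProb_alphaP α p hc

theorem isRD_alphaOne (α : AlphaSeq) : IsRD (alphaOne α) := by
  rw [isRD_iff]
  refine ⟨inferInstance, fun c c' hc hc' h => ?_⟩
  refine (measureReal_eq_measureReal_iff).1 ?_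
  change codeProb _ _ = codeProb _ _
  rw [alphaOne_eq]
  refine tendsto_nhds_unique (tendsto_rankProb (summable_weight α) c)
    ((tendsto_rankProb (summable_weight α) c').congr' ?_)
  filter_upwards [eventually_ge_atTop c.length] with N hN
  exact (rankProb_congr _ hc hc' h hN).symm

theorem isRD_exchangeable : IsRD exchangeable := by
  rw [isRD_iff]
  refine ⟨inferInstance, fun c c' hc hc' h => ?_⟩
  refine (measureReal_eq_measureReal_iff).1 ?_
  change codeProb _ _ = codeProb _ _
  rw [codeProb_exchangeable hc, codeProb_exchangeable hc', ← length_recWord c, h, length_recWord]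

theorem isRD_paramMeasure (ω : Param) : IsRD (paramMeasure ω) := by
  cases ω with
  | star => exact isRD_exchangeable
  | pair α p =>
    rw [isRD_iff]
    refine ⟨inferInstance, fun c c' hc hc' h => ?_⟩
    refine (measureReal_eq_measureReal_iff).1 ?_
    have hlen : c.length = c'.length := by rw [← length_recWord c, h, length_recWord]
    have h₁ := ((isRD_iff _).1 (isRD_alphaOne α)).2
    change codeProb (alphaP α p) _ = codeProb (alphaP α p) _
    rw [alphaP, codeProb_merge _ _ hc, codeProb_merge _ _ hc', hlen]
    refine Finset.sum_congr rfl fun k _ => ?_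
    congr 2
    simp only [codeProb, measureReal_def]
    rw [h₁ _ _ (hc.drop _) (hc'.drop _) (by rw [recWord_drop, recWord_drop, h])]

/-! ### The Borel structure of the parameter space -/

/-- The σ-algebra of `ℕ∞` in Mathlib is the discrete one; as the space is countable with closed
points, it is the Borel σ-algebra. -/
instance : BorelSpace ℕ∞ where
  measurable_eq := by
    refine le_antisymm (fun s _ => ?_) le_top
    have h : ∀ x : ℕ∞, MeasurableSet[borel ℕ∞] {x} := fun x =>
      MeasurableSpace.measurableSet_generateFrom (isOpen_compl_singleton (x := x)) |>.of_compl
    rw [← biUnion_of_singleton s]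
    exact MeasurableSet.biUnion s.to_countable fun x _ => h x

instance : MeasurableSpace AlphaSeq := Subtype.instMeasurableSpace

instance : BorelSpace AlphaSeq := Subtype.borelSpace _

theorem measurable_alphaSeq_coe : Measurable fun α : AlphaSeq => α.1 := comap_measurable _

theorem measurableSet_alpha_eq (k : ℕ) (x : ℕ∞) : MeasurableSet {α : AlphaSeq | α.1 k = x} :=
  measurableSet_eq_fun ((measurable_pi_apply k).comp measurable_alphaSeq_coe) measurable_const

theorem measurable_nonRecords : Measurable nonRecords := by
  refine measurable_pi_lambda _ fun i => measurable_to_bool ?_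
  have : (fun α => nonRecords α i) ⁻¹' {true} = ⋃ k, {α : AlphaSeq | α.1 k = (i : ℕ∞)} := by
    ext α
    simp [nonRecords_eq_true]
  rw [this]
  exact MeasurableSet.iUnion fun k => measurableSet_alpha_eq k _

theorem alpha_lt {α : AlphaSeq} {j k m : ℕ} (hm : α.1 k = (m : ℕ∞)) (hjk : j < k) :
    α.1 j < α.1 k := by
  induction k generalizing m with
  | zero => omega
  | succ k ih =>
    have hlt : α.1 k < α.1 (k + 1) := by
      refine (α.2.2.1 k).resolve_right ?_
      rw [hm]
      exact ENat.natCast_ne_top m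
    rcases Nat.lt_succ_iff_lt_or_eq.1 hjk with h | rfl
    · obtain ⟨m', hm'⟩ := ENat.ne_top_iff_exists.1 hlt.ne_top
      exact (ih hm'.symm h).trans hlt
    · exact hlt

theorem alpha_injOn {α : AlphaSeq} {j k m : ℕ} (hj : α.1 j = (m : ℕ∞)) (hk : α.1 k = (m : ℕ∞)) :
    j = k := by
  rcases lt_trichotomy j k with h | h | h
  · exact absurd (hj.trans hk.symm) (alpha_lt hk h).ne
  · exact h
  · exact absurd (hk.trans hj.symm) (alpha_lt hj h).ne

/-- The number of entries of `α` below the finite entry `α k` is `k`. -/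
theorem count_nonRecords {α : AlphaSeq} {k m : ℕ} (hk : α.1 k = (m : ℕ∞)) :
    Nat.count (fun i => nonRecords α i = true) m = k := by
  have hfin : ∀ j < k, α.1 j = ((α.1 j).toNat : ℕ∞) := fun j hj =>
    (ENat.natCast_toNat (alpha_lt hk hj).ne_top).symm
  have : (Finset.range m).filter (fun i => nonRecords α i = true) =
      (Finset.range k).image fun j => (α.1 j).toNat := by
    ext i
    simp only [Finset.mem_filter, Finset.mem_range, Finset.mem_image, nonRecords_eq_true]
    constructor
    · rintro ⟨hi, j, hj⟩
      refine ⟨j, ?_, by rw [hj, ENat.toNat_natCast]⟩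
      by_contra hkj
      rcases (not_lt.1 hkj).lt_or_eq with h | rfl
      · have := alpha_lt hj h
        rw [hj, hk] at this
        have : m < i := by exact_mod_cast this
        omega
      · rw [hk] at hj
        have : m = i := by exact_mod_cast hj
        omega
    · rintro ⟨j, hj, rfl⟩
      refine ⟨?_, j, hfin j hj⟩
      have := alpha_lt hk hj
      rw [hk, hfin j hj] at this
      exact_mod_cast this
  rw [Nat.count_eq_card_filter_range, this, Finset.card_image_of_injOn, Finset.card_range]
  intro i hi j hj hij
  simp only [Finset.coe_range, mem_Iio] at hi hj
  simp only at hij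
  refine alpha_injOn (hfin i hi) ?_
  rw [hij]
  exact hfin j hj

theorem alpha_eq_iff {α : AlphaSeq} {k m : ℕ} : α.1 k = (m : ℕ∞) ↔
    nonRecords α m = true ∧ Nat.count (fun i => nonRecords α i = true) m = k := by
  refine ⟨fun h => ⟨nonRecords_eq_true.2 ⟨k, h⟩, count_nonRecords h⟩, fun ⟨h₁, h₂⟩ => ?_⟩
  obtain ⟨j, hj⟩ := nonRecords_eq_true.1 h₁
  rw [← h₂, count_nonRecords hj, hj]

theorem measurable_count (m : ℕ) :
    Measurable fun A : ℕ → Bool => Nat.count (fun i => A i = true) m := by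
  simp only [Nat.count_eq_card_filter_range, Finset.card_filter]
  refine Finset.measurable_sum _ fun k _ => ?_
  exact Measurable.ite (measurableSet_eq_fun (measurable_pi_apply k) measurable_const)
    measurable_const measurable_const

/-- The Borel σ-algebra of the space of sequences is generated by the sets of non-records. -/
theorem alphaSeq_measurableSpace :
    (inferInstance : MeasurableSpace AlphaSeq) = MeasurableSpace.comap nonRecords inferInstance := by
  refine le_antisymm ?_ measurable_nonRecords.comap_le
  have h : ∀ k, @Measurable AlphaSeq ℕ∞ (MeasurableSpace.comap nonRecords inferInstance) _
      fun α => α.1 k := by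
    intro k
    have hfin : ∀ m : ℕ, MeasurableSet[MeasurableSpace.comap nonRecords inferInstance]
        {α : AlphaSeq | α.1 k = (m : ℕ∞)} := by
      intro m
      refine ⟨{A | A m = true ∧ Nat.count (fun i => A i = true) m = k}, ?_, ?_⟩
      · exact (measurableSet_eq_fun (measurable_pi_apply m) measurable_const).inter
          (measurable_count m (measurableSet_singleton k))
      · ext α
        exact alpha_eq_iff.symm
    refine @measurable_to_countable' _ _ _ _ (MeasurableSpace.comap nonRecords inferInstance) _
      fun x => ?_
    rcases eq_or_ne x ⊤ with rfl | hx
    · have : (fun α : AlphaSeq => α.1 k) ⁻¹' {⊤} = (⋃ m : ℕ, {α : AlphaSeq | α.1 k = (m : ℕ∞)})ᶜ := by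
        ext α
        simp only [mem_preimage, mem_singleton_iff, mem_compl_iff, mem_iUnion, mem_ofPred_eq]
        rw [← not_iff_not, not_not]
        change α.1 k ≠ ⊤ ↔ _
        rw [ENat.ne_top_iff_exists]
        simp [eq_comm]
      rw [this]
      exact (MeasurableSet.iUnion hfin).compl
    · obtain ⟨m, rfl⟩ := ENat.ne_top_iff_exists.1 hx
      exact hfin m
  have h' : @Measurable AlphaSeq (ℕ → ℕ∞) (MeasurableSpace.comap nonRecords inferInstance) _
      Subtype.val := @measurable_pi_lambda _ _ _ (MeasurableSpace.comap nonRecords inferInstance) _ _ h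
  exact h'.comap_le

/-- The parameters different from `*`. -/
def pairMap (x : AlphaSeq × {p : unitInterval // 0 < p}) : Param := Param.pair x.1 x.2

theorem pairMap_injective : Function.Injective pairMap := by
  rintro ⟨α, p⟩ ⟨β, q⟩ h
  simpa [pairMap] using h

theorem isOpenEmbedding_pairMap : Topology.IsOpenEmbedding pairMap := by
  refine Topology.IsOpenEmbedding.of_continuous_injective_isOpenMap ?_ pairMap_injective ?_
  · exact ⟨fun U hU => hU.1⟩
  · intro V hV
    refine ⟨?_, ?_⟩
    · change IsOpen (pairMap ⁻¹' (pairMap '' V))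
      rwa [preimage_image_eq _ pairMap_injective]
    · rintro ⟨x, _, hx⟩
      simp [pairMap] at hx

theorem measurableEmbedding_pairMap : MeasurableEmbedding pairMap :=
  isOpenEmbedding_pairMap.measurableEmbedding

theorem range_pairMap : range pairMap = {Param.star}ᶜ := by
  ext ω
  cases ω with
  | star => simp [pairMap]
  | pair α p => simp only [mem_compl_iff, mem_singleton_iff, reduceCtorEq, not_false_eq_true,
      iff_true]; exact ⟨(α, p), rfl⟩

theorem measurable_param {X : Type*} [MeasurableSpace X] {f : Param → X}
    (hf : Measurable fun x => f (pairMap x)) : Measurable f := by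
  intro s hs
  have hstar : MeasurableSet ({Param.star} : Set Param) := by
    rw [← MeasurableSet.compl_iff, ← range_pairMap]
    exact measurableEmbedding_pairMap.measurableSet_range
  have : f ⁻¹' s = pairMap '' ((fun x => f (pairMap x)) ⁻¹' s) ∪
      ({Param.star} ∩ {_ω | f Param.star ∈ s}) := by
    ext ω
    cases ω with
    | star => simp [pairMap]
    | pair α p =>
      simp only [mem_preimage, mem_union, mem_image, mem_inter_iff, mem_singleton_iff, reduceCtorEq,
        false_and, or_false]
      refine ⟨fun h => ⟨(α, p), h, rfl⟩, ?_⟩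
      rintro ⟨x, hx, h⟩
      rwa [h] at hx
  rw [this]
  exact (measurableEmbedding_pairMap.measurableSet_image.2 (hf hs)).union
    (hstar.inter (MeasurableSet.const _))

/-- The coordinates of a parameter: the set of non-records and the number `p`. -/
def coords : Param → (ℕ → Bool) × ℝ
  | Param.star => (fun _ => false, 0)
  | Param.pair α p => (nonRecords α, p)

theorem measurable_coords : Measurable coords := by
  refine measurable_param ?_
  exact (measurable_nonRecords.comp measurable_fst).prodMk
    ((measurable_subtype_coe.comp measurable_subtype_coe).comp measurable_snd)

/-- The Borel σ-algebra of the parameter space is generated by the coordinates. -/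
theorem param_measurableSpace :
    (inferInstance : MeasurableSpace Param) = MeasurableSpace.comap coords inferInstance := by
  refine le_antisymm (fun U hU => ?_) measurable_coords.comap_le
  have h : (inferInstance : MeasurableSpace (AlphaSeq × {p : unitInterval // 0 < p})) =
      MeasurableSpace.comap (fun x => (nonRecords x.1, (x.2 : ℝ))) inferInstance := by
    have h₁ := MeasurableSpace.comap_prodMk (mβ := inferInstance) (mγ := inferInstance)
      (fun x : AlphaSeq × {p : unitInterval // 0 < p} => nonRecords x.1)
      fun x => ((x.2 : unitInterval) : ℝ)
    refine Eq.trans ?_ h₁.symm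
    have h₂ : (inferInstance : MeasurableSpace (AlphaSeq × {p : unitInterval // 0 < p})) =
      MeasurableSpace.comap Prod.fst inferInstance ⊔
        MeasurableSpace.comap Prod.snd inferInstance := rfl
    rw [h₂, alphaSeq_measurableSpace, MeasurableSpace.comap_comp]
    congr 1
    change MeasurableSpace.comap Prod.snd (MeasurableSpace.comap Subtype.val
      (MeasurableSpace.comap Subtype.val inferInstance)) = _
    rw [MeasurableSpace.comap_comp, MeasurableSpace.comap_comp]
    rfl
  have hU' := measurableEmbedding_pairMap.measurable hU
  have hU'' : MeasurableSet[MeasurableSpace.comap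
      (fun x : AlphaSeq × {p : unitInterval // 0 < p} => (nonRecords x.1, (x.2 : ℝ))) inferInstance]
      (pairMap ⁻¹' U) := h ▸ hU'
  obtain ⟨V, hV, hVU⟩ := hU''
  refine ⟨(V ∩ {x | 0 < x.2}) ∪ ({x | x.2 ≤ 0} ∩ {_x | Param.star ∈ U}), ?_, ?_⟩
  · exact (hV.inter (measurableSet_lt measurable_const measurable_snd)).union
      ((measurableSet_le measurable_snd measurable_const).inter (MeasurableSet.const _))
  · ext ω
    cases ω with
    | star => simp [coords]
    | pair α p =>
      have h₁ : (α, p) ∈ pairMap ⁻¹' U ↔ (nonRecords α, ((p : unitInterval) : ℝ)) ∈ V := by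
        rw [← hVU]; rfl
      have hp : (0 : ℝ) < ((p : unitInterval) : ℝ) := p.2
      simp only [coords, mem_preimage, mem_union, mem_inter_iff, mem_ofPred_eq, hp, hp.not_ge,
        and_true, false_and, or_false]
      exact h₁.symm

theorem measurable_totalWeight : Measurable totalWeight :=
  Measurable.tsum fun a => (continuous_weight a).measurable

theorem measurable_extParam : Measurable extParam := by
  have : extParam = fun ω =>
      ((coords ω).1, (coords ω).2 * Real.exp (-totalWeight (coords ω).1)) := by
    funext ω
    cases ω <;> simp [extParam, coords]
  rw [this]
  have h := measurable_coords
  have h' := measurable_totalWeight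
  exact h.fst.prodMk (h.snd.mul (Real.measurable_exp.comp (h'.comp h.fst).neg))

/-- If the moments depend measurably on a parameter, then so do the probabilities of the codes. -/
theorem measurable_of_measurable_moment {X : Type*} [MeasurableSpace X] {φ : X → List ℕ → ℝ}
    (h : ∀ c, IsCode c → Measurable fun x => moment (φ x) c) {c : List ℕ} (hc : IsCode c) :
    Measurable fun x => φ x c := by
  induction hn : c.length using Nat.strong_induction_on generalizing c with
  | _ n ih =>
    have h₁ : (fun x => φ x c) = fun x => (moment (φ x) c -
        ∑ k ∈ Finset.range c.length, (-1) ^ (c.length - k) * (c.length.choose k) *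
          (k.factorial * φ x (c.drop (c.length - k)))) / c.length.factorial := by
      funext x
      rw [moment, Finset.sum_range_succ, add_sub_cancel_left]
      have := Nat.factorial_ne_zero c.length
      simp
      field_simp
    rw [h₁]
    refine ((h c hc).sub (Finset.measurable_sum _ fun k hk => ?_)).div_const _
    simp only [Finset.mem_range] at hk
    exact ((ih k (by omega) (hc.drop _) (by simp; omega)).const_mul _).const_mul _

theorem measurable_paramMeasure : Measurable paramMeasure := by
  refine Measurable.measure_of_isPiSystem_of_isProbabilityMeasure generateFrom_codeEvents
    isPiSystem_codeEvents ?_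
  rintro _ ⟨n, S, rfl⟩
  simp only [measure_codeEvent]
  refine Measurable.tsum fun c => ?_
  by_cases hc : IsCode (c : List ℕ) ∧ (c : List ℕ).length = n
  · obtain ⟨h₁, rfl⟩ := hc
    have h₂ : Measurable fun ω => codeProb (paramMeasure ω) (c : List ℕ) := by
      refine measurable_of_measurable_moment (φ := fun ω => codeProb (paramMeasure ω))
        (fun c hc => ?_) h₁
      simp only [moment_paramMeasure _ hc]
      exact (continuous_extMoment c).measurable.comp measurable_extParam
    convert h₂.ennreal_ofReal using 2 with ω
    rw [codeProb, ofReal_measureReal]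
  · simp only [measure_code_eq_zero _ hc]
    exact measurable_const

/-! ### Record-dependent measures as mixtures at a finite level -/

/-- The indicator function of the non-record positions, from a list of record indicators. -/
def zerosOf : List Bool → ℕ → Bool
  | [], _ => false
  | b :: w, i => if i = w.length then !b else zerosOf w i

theorem zerosOf_revList (b : ℕ → Bool) (N i : ℕ) :
    zerosOf (revList b N) i = if i < N then !b i else false := by
  induction N with
  | zero => simp [revList, zerosOf]
  | succ N ih =>
    rw [revList, zerosOf, ih, length_revList]
    by_cases h : i = N
    · simp [h]
    · have : i < N + 1 ↔ i < N := by omega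
      simp [h, this]

theorem recWord_revList (r : ℕ → ℕ) (N : ℕ) :
    recWord (revList r N) = revList (fun i => decide (r i = i)) N := by
  induction N with
  | zero => rfl
  | succ N ih => simp [revList, recWord, ih]

theorem zerosOf_recWord_of_le {c : List ℕ} {i : ℕ} (h : c.length ≤ i) :
    zerosOf (recWord c) i = false := by
  obtain ⟨f, hf⟩ := exists_revList c
  rw [← hf, recWord_revList, zerosOf_revList, if_neg (by omega)]

theorem zerosOf_recWord_zero {c : List ℕ} (hc : IsCode c) : zerosOf (recWord c) 0 = false := by
  induction c with
  | nil => rfl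
  | cons s c ih =>
    rw [recWord, zerosOf, ih hc.2]
    have := hc.1
    split_ifs with h
    · simp only [length_recWord] at h
      simp only [Bool.not_eq_false', decide_eq_true_eq]
      omega
    · rfl

/-- The rank codes with given record indicators. -/
def codesWith (w : List Bool) : Set (List ℕ) := {c | IsCode c ∧ recWord c = w}

/-- Independent ranks with prescribed non-records have the prescribed record indicators. -/
theorem ae_revList_mem {c : List ℕ} (hc : IsCode c) :
    ∀ᵐ r ∂(rankMeasure (zerosOf (recWord c))), revList r c.length ∈ codesWith (recWord c) := by
  filter_upwards [rankMeasure_ae (zerosOf (recWord c))] with r hr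
  refine ⟨isCode_revList (fun i => (hr i).1) _, ?_⟩
  obtain ⟨f, hf⟩ := exists_revList c
  have h₀ := zerosOf_recWord_zero hc
  have key : ∀ i < c.length, zerosOf (recWord c) i = !decide (f i = i) := by
    intro i hi
    conv_lhs => rw [← hf]
    rw [recWord_revList, zerosOf_revList, if_pos hi]
  conv_rhs => rw [← hf]
  rw [recWord_revList, recWord_revList]
  refine revList_congr fun i hi => ?_
  have h₁ := hr i
  have h₂ := key i hi
  rw [decide_eq_decide]
  by_cases hfi : f i = i
  · simp only [hfi, decide_true, Bool.not_true] at h₂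
    have h₃ : ¬ r i < i := fun h => by simpa [h₂] using h₁.2.1 h
    simp only [hfi, iff_true]
    omega
  · simp only [hfi, decide_false, Bool.not_false] at h₂
    have hi₀ : i ≠ 0 := by
      rintro rfl
      rw [h₀] at h₂
      exact Bool.false_ne_true h₂
    have := h₁.2.2 ⟨hi₀, h₂⟩
    simp only [hfi, iff_false]
    omega

/-- The law of the first `N` independent ranks. -/
def codeLaw (A : ℕ → Bool) (N : ℕ) : Measure (List ℕ) :=
  (rankMeasure A).map fun r => revList r N

theorem codeLaw_singleton {A : ℕ → Bool} {c : List ℕ} :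
    codeLaw A c.length {c} = ENNReal.ofReal (rankProb A c.length c) := by
  rw [rankProb, ofReal_measureReal, codeLaw, Measure.map_apply (by fun_prop)
    MeasurableSet.of_discrete]
  refine measure_congr ?_
  filter_upwards [rankMeasure_ae A] with r hr
  apply propext
  change revList r c.length = c ↔ restr c.length (revList r c.length) = c
  rw [restr_of_length_le (isCode_revList (fun i => (hr i).1) _) (by simp)]

theorem codeLaw_codesWith {c : List ℕ} (hc : IsCode c) :
    codeLaw (zerosOf (recWord c)) c.length (codesWith (recWord c)) = 1 := by
  rw [codeLaw, Measure.map_apply (by fun_prop) MeasurableSet.of_discrete]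
  exact (prob_compl_eq_zero_iff (measurable_revList _ MeasurableSet.of_discrete)).1 (ae_revList_mem hc)

theorem codeLaw_singleton_eq_zero {c c' : List ℕ} (hc' : IsCode c')
    (h : ¬ (IsCode c ∧ recWord c = recWord c')) :
    codeLaw (zerosOf (recWord c')) c'.length {c} = 0 := by
  have h₁ := codeLaw_codesWith hc'
  have : IsProbabilityMeasure (codeLaw (zerosOf (recWord c')) c'.length) :=
    Measure.isProbabilityMeasure_map (measurable_revList _).aemeasurable
  rw [← prob_compl_eq_zero_iff MeasurableSet.of_discrete] at h₁
  exact measure_mono_null (singleton_subset_iff.2 h) h₁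

theorem measure_eq_tsum_singleton (μ : Measure (List ℕ)) (S : Set (List ℕ)) :
    μ S = ∑' c : S, μ {(c : List ℕ)} := by
  conv_lhs => rw [← biUnion_of_singleton S]
  rw [measure_biUnion S.to_countable (fun a _ b _ hab => Set.disjoint_singleton.2 hab)
    fun c _ => measurableSet_singleton c]

/-- Given its set of records, the rank code of a record-dependent random order is uniform, i.e. it
consists of independent ranks. -/
theorem IsRD.code_eq_mul {P : Measure Orders} (hP : IsRD P) {c : List ℕ} (hc : IsCode c) :
    P {O | code O c.length = c} =
      P {O | recWord (code O c.length) = recWord c} *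
        codeLaw (zerosOf (recWord c)) c.length {c} := by
  set S := codesWith (recWord c) with hS
  have hlen : ∀ c' ∈ S, c'.length = c.length := fun c' h => by
    rw [← length_recWord c', h.2, length_recWord]
  have h₁ : {O | recWord (code O c.length) = recWord c} = {O | code O c.length ∈ S} := by
    ext O
    simp [hS, codesWith, isCode_code]
  have h₂ : P {O | code O c.length ∈ S} =
      ∑' _ : S, P {O | code O c.length = c} := by
    rw [measure_codeEvent]
    refine tsum_congr fun c' => ?_
    have := ((isRD_iff P).1 hP).2 c' c c'.2.1 hc c'.2.2
    rwa [hlen c' c'.2] at this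
  have h₃ : ∑' _ : S, codeLaw (zerosOf (recWord c)) c.length {c} = 1 := by
    refine Eq.trans (tsum_congr fun c' => ?_)
      ((measure_eq_tsum_singleton _ S).symm.trans (codeLaw_codesWith hc))
    rw [← hlen c' c'.2, codeLaw_singleton, hlen c' c'.2, codeLaw_singleton,
      rankProb_congr _ c'.2.1 hc c'.2.2 (hlen c' c'.2).le]
  calc P {O | code O c.length = c}
      = ∑' _ : S, P {O | code O c.length = c} * codeLaw (zerosOf (recWord c)) c.length {c} := by
        rw [ENNReal.tsum_mul_left, h₃, mul_one]
    _ = P {O | recWord (code O c.length) = recWord c} *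
          codeLaw (zerosOf (recWord c)) c.length {c} := by
        rw [ENNReal.tsum_mul_right, ← h₂, ← h₁]

/-- The marginals of a record-dependent measure are mixtures of laws of independent ranks. -/
theorem IsRD.lintegral_codeLaw {P : Measure Orders} (hP : IsRD P) (N : ℕ) (S : Set (List ℕ)) :
    P {O | code O N ∈ S} = ∫⁻ O, codeLaw (zerosOf (recWord (code O N))) N S ∂P := by
  have hmeas : ∀ f : List ℕ → ℝ≥0∞, Measurable fun O : Orders => f (code O N) := fun f =>
    (measurable_of_countable f).comp (measurable_code N)
  have h₁ : ∀ O, codeLaw (zerosOf (recWord (code O N))) N S =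
      ∑' c : S, codeLaw (zerosOf (recWord (code O N))) N {(c : List ℕ)} := fun O =>
    measure_eq_tsum_singleton _ S
  simp_rw [h₁]
  rw [measure_codeEvent, lintegral_tsum fun c : S =>
    (hmeas fun C => codeLaw (zerosOf (recWord C)) N {(c : List ℕ)}).aemeasurable]
  refine tsum_congr fun c => ?_
  obtain ⟨c, hcS⟩ := c
  simp only
  by_cases hc : IsCode c ∧ c.length = N
  · obtain ⟨hc, rfl⟩ := hc
    have h₂ : ∀ O, codeLaw (zerosOf (recWord (code O c.length))) c.length {c} =
        {O | recWord (code O c.length) = recWord c}.indicator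
          (fun _ => codeLaw (zerosOf (recWord c)) c.length {c}) O := by
      intro O
      by_cases h : recWord (code O c.length) = recWord c
      · rw [indicator_of_mem (by exact h), h]
      · rw [indicator_of_notMem (by exact h)]
        have h₃ := codeLaw_singleton_eq_zero (c := c) (isCode_code O c.length)
          (fun h' => h h'.2.symm)
        rwa [length_code] at h₃
    simp_rw [h₂]
    rw [lintegral_indicator_const, hP.code_eq_mul hc, mul_comm]
    exact measurable_code _ (MeasurableSet.of_discrete (s := {C | recWord C = recWord c}))
  · rw [measure_code_eq_zero P hc]
    symm
    rw [lintegral_eq_zero_iff (hmeas fun C => codeLaw (zerosOf (recWord C)) N {c})]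
    refine ae_of_all _ fun O => ?_
    have h₃ := codeLaw_singleton_eq_zero (c := c) (isCode_code O N) (fun h' => hc ⟨h'.1, by
      rw [← length_recWord, h'.2, length_recWord, length_code]⟩)
    rwa [length_code] at h₃

theorem IsRD.integral_rankProb {P : Measure Orders} (hP : IsRD P) {N : ℕ} {c : List ℕ}
    (hN : c.length ≤ N) :
    ∫ O, rankProb (zerosOf (recWord (code O N))) N c ∂P = codeProb P c := by
  have h₁ : {O | code O c.length = c} = {O | code O N ∈ {C | restr c.length C = c}} := by
    ext O
    rw [mem_ofPred_eq, code_eq_restr O hN]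
    rfl
  have h₂ : ∀ A, rankProb A N c = (codeLaw A N {C | restr c.length C = c}).toReal := fun A => by
    rw [codeLaw, Measure.map_apply (by fun_prop) MeasurableSet.of_discrete]
    rfl
  have hmeas : ∀ f : List ℕ → ℝ≥0∞, Measurable fun O : Orders => f (code O N) := fun f =>
    (measurable_of_countable f).comp (measurable_code N)
  rw [codeProb, measureReal_def, h₁, hP.lintegral_codeLaw]
  simp_rw [h₂]
  have : ∀ A, IsProbabilityMeasure (codeLaw A N) := fun A =>
    Measure.isProbabilityMeasure_map (measurable_revList _).aemeasurable
  refine integral_toReal (hmeas fun C => codeLaw (zerosOf (recWord C)) N _).aemeasurable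
    (ae_of_all _ fun O => measure_lt_top _ _)

theorem moment_integral {X : Type*} [MeasurableSpace X] {μ : Measure X} {φ : X → List ℕ → ℝ}
    {c : List ℕ} (h : ∀ k, Integrable (fun x => φ x (c.drop k)) μ) :
    moment (fun c => ∫ x, φ x c ∂μ) c = ∫ x, moment (φ x) c ∂μ := by
  unfold moment
  rw [integral_finsetSum _ fun k _ => ((h _).const_mul _).const_mul _]
  refine Finset.sum_congr rfl fun k _ => ?_
  rw [integral_const_mul, integral_const_mul]

/-- The approximate parameter of an order, computed from its first `N` letters: the set `A` of
non-records and the number `q = p * exp (-∑ 1 / a)` for `p = 1`. -/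
def approxParam (N : ℕ) (O : Orders) : (ℕ → Bool) × unitInterval :=
  (zerosOf (recWord (code O N)),
    ⟨Real.exp (-totalWeight (zerosOf (recWord (code O N)))), (Real.exp_pos _).le,
      Real.exp_le_one_iff.2 (neg_nonpos.2 (tsum_nonneg fun a => weight_nonneg _ a))⟩)

theorem measurable_approxParam (N : ℕ) : Measurable (approxParam N) :=
  (measurable_of_countable fun C : List ℕ => ((zerosOf (recWord C),
    ⟨Real.exp (-totalWeight (zerosOf (recWord C))), (Real.exp_pos _).le,
      Real.exp_le_one_iff.2 (neg_nonpos.2 (tsum_nonneg fun a => weight_nonneg _ a))⟩) :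
      (ℕ → Bool) × unitInterval)).comp (measurable_code N)

/-- The moments of a record-dependent measure are averages of the extended moments over the
approximate parameters. -/
theorem IsRD.integral_extMoment {P : Measure Orders} (hP : IsRD P) {N : ℕ} {c : List ℕ}
    (hc : IsCode c) (hN : c.length ≤ N) :
    ∫ O, extMoment c ((approxParam N O).1, ((approxParam N O).2 : ℝ)) ∂P =
      moment (codeProb P) c := by
  have := hP.isProbabilityMeasure
  have h₁ : ∀ O, extMoment c ((approxParam N O).1, ((approxParam N O).2 : ℝ)) =
      moment (rankProb (zerosOf (recWord (code O N))) N) c := fun O =>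
    extMoment_finite (fun i hi => zerosOf_recWord_of_le (by simpa using hi)) hc hN
  simp_rw [h₁]
  rw [← moment_integral]
  · refine moment_congr fun k _ => hP.integral_rankProb ?_
    simp; omega
  · intro k
    refine Integrable.of_bound (C := 1) ?_ (ae_of_all _ fun O => ?_)
    · exact ((measurable_of_countable fun C : List ℕ =>
        rankProb (zerosOf (recWord C)) N (c.drop k)).comp (measurable_code N)).aestronglyMeasurable
    · refine (Real.norm_of_nonneg measureReal_nonneg).le.trans ?_
      exact measureReal_le_one

/-! ### From the compact parameter space to the parameters -/

/-- The increasing enumeration of a set of non-records, followed by `⊤` if the set is finite. The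
quantifier over proofs of finiteness is void for infinite sets, as in the lemmas on `Nat.nth`. -/
def enum (A : ℕ → Bool) (k : ℕ) : ℕ∞ :=
  open Classical in
  if ∀ hf : (Set.ofPred fun i => A i = true).Finite, k < hf.toFinset.card
  then (Nat.nth (fun i => A i = true) k : ℕ∞) else ⊤

theorem enum_eq_iff {A : ℕ → Bool} {m : ℕ} : (∃ k, enum A k = (m : ℕ∞)) ↔ A m = true := by
  constructor
  · rintro ⟨k, hk⟩
    unfold enum at hk
    split_ifs at hk with h
    · have := Nat.nth_mem k h
      rwa [show Nat.nth (fun i => A i = true) k = m by exact_mod_cast hk] at this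
    · exact absurd hk.symm (ENat.natCast_ne_top m)
  · intro h
    obtain ⟨k, hk, hkm⟩ := Nat.exists_lt_card_nth_eq (p := fun i => A i = true) h
    exact ⟨k, by rw [enum, if_pos hk, hkm]⟩

/-- The sequence `α` with a given set of non-records. -/
def alphaOf (A : ℕ → Bool) (h₀ : A 0 = false) (hA : Summable (weight A)) : AlphaSeq :=
  ⟨enum A, by
    intro k
    unfold enum
    split_ifs with h
    · have h₁ := Nat.nth_mem k h
      have : Nat.nth (fun i => A i = true) k ≠ 0 := fun h₂ => by
        rw [h₂, h₀] at h₁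
        exact Bool.false_ne_true h₁
      exact_mod_cast Nat.one_le_iff_ne_zero.2 this
    · exact le_top, by
    intro k
    by_cases h : ∀ hf : (Set.ofPred fun i => A i = true).Finite, k + 1 < hf.toFinset.card
    · left
      have h' : ∀ hf : (Set.ofPred fun i => A i = true).Finite, k < hf.toFinset.card :=
        fun hf => (Nat.lt_succ_self k).trans (h hf)
      rw [enum, if_pos h', enum, if_pos h]
      exact_mod_cast Nat.nth_lt_nth' (Nat.lt_succ_self k) h
    · right
      rw [enum, if_neg h], by
    set D : Set ℕ := {k | ∀ hf : (Set.ofPred fun i => A i = true).Finite, k < hf.toFinset.card}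
      with hD
    have hinj : Function.Injective fun k : D => Nat.nth (fun i => A i = true) k := by
      intro k l hkl
      rcases lt_trichotomy (k : ℕ) l with h | h | h
      · exact absurd hkl (Nat.nth_lt_nth' h l.2).ne
      · exact Subtype.ext h
      · exact absurd hkl (Nat.nth_lt_nth' h k.2).ne'
    have h₁ : ∑' k, ((enum A k : ℝ≥0∞))⁻¹ =
        ∑' k : D, ENNReal.ofReal (weight A (Nat.nth (fun i => A i = true) k)) := by
      rw [tsum_subtype D fun k => ENNReal.ofReal (weight A (Nat.nth (fun i => A i = true) k))]
      refine tsum_congr fun k => ?_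
      by_cases hk : k ∈ D
      · have hk' : ∀ hf : (Set.ofPred fun i => A i = true).Finite, k < hf.toFinset.card := hk
        have h₁ := Nat.nth_mem k hk'
        rw [indicator_of_mem hk, enum, if_pos hk', ofReal_weight ⟨fun h₂ => ?_, h₁⟩]
        · simp
        · rw [h₂, h₀] at h₁
          exact Bool.false_ne_true h₁
      · have hk' : ¬ ∀ hf : (Set.ofPred fun i => A i = true).Finite, k < hf.toFinset.card := hk
        rw [indicator_of_notMem hk, enum, if_neg hk']
        simp
    rw [h₁]
    exact (ENNReal.tsum_comp_le_tsum_of_injective hinj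
      fun a => ENNReal.ofReal (weight A a)).trans_lt hA.tsum_ofReal_lt_top⟩

theorem nonRecords_alphaOf {A : ℕ → Bool} (h₀ : A 0 = false) (hA : Summable (weight A)) :
    nonRecords (alphaOf A h₀ hA) = A := by
  funext m
  rw [Bool.eq_iff_iff, nonRecords_eq_true]
  exact enum_eq_iff

/-- The pairs `(A, q)` that come from a pair `(α, p)`. -/
def IsProper (x : (ℕ → Bool) × unitInterval) : Prop :=
  x.1 0 = false ∧ Summable (weight x.1) ∧ 0 < (x.2 : ℝ) ∧
    (x.2 : ℝ) * Real.exp (totalWeight x.1) ≤ 1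

open Classical in
/-- The parameter that corresponds to a point of the compact space; this is meaningful on the set
`support`, where the points that are not proper have `q = 0`. -/
def toParam (x : (ℕ → Bool) × unitInterval) : Param :=
  if h : IsProper x then
    Param.pair (alphaOf x.1 h.1 h.2.1) ⟨⟨x.2 * Real.exp (totalWeight x.1),
      mul_nonneg x.2.2.1 (Real.exp_pos _).le, h.2.2.2⟩, mul_pos h.2.2.1 (Real.exp_pos _)⟩
  else Param.star

theorem measurableSet_isProper : MeasurableSet {x | IsProper x} := by
  have h₁ : MeasurableSet {A : ℕ → Bool | Summable (weight A)} := by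
    have : {A : ℕ → Bool | Summable (weight A)} =
        {A | ∑' a, ENNReal.ofReal (weight A a) < ∞} := by
      ext A
      refine ⟨fun h => h.tsum_ofReal_lt_top, fun h => ?_⟩
      have h' := ENNReal.summable_toReal (ne_of_lt h)
      refine h'.congr fun a => ?_
      rw [ENNReal.toReal_ofReal (weight_nonneg _ _)]
    rw [this]
    exact measurableSet_lt (Measurable.tsum fun a =>
      (continuous_weight a).measurable.ennreal_ofReal) measurable_const
  have hq : Measurable fun x : (ℕ → Bool) × unitInterval => (x.2 : ℝ) :=
    measurable_subtype_coe.comp measurable_snd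
  have hw := measurable_totalWeight
  refine (measurableSet_eq_fun ((measurable_pi_apply 0).comp measurable_fst)
    measurable_const).inter ((measurable_fst h₁).inter ((measurableSet_lt measurable_const hq).inter
    (measurableSet_le (hq.mul (Real.measurable_exp.comp (hw.comp measurable_fst)))
      measurable_const)))

theorem measurable_toParam : Measurable toParam := by
  have h₁ : Measurable fun x => coords (toParam x) := by
    classical
    have : (fun x => coords (toParam x)) = fun x => if IsProper x then
        (x.1, (x.2 : ℝ) * Real.exp (totalWeight x.1)) else (fun _ => false, 0) := by
      funext x
      by_cases h : IsProper x
      · rw [if_pos h, toParam, dif_pos h, coords, nonRecords_alphaOf]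
      · rw [if_neg h, toParam, dif_neg h, coords]
    rw [this]
    have hw := measurable_totalWeight
    exact Measurable.ite measurableSet_isProper (measurable_fst.prodMk
      ((measurable_subtype_coe.comp measurable_snd).mul
        (Real.measurable_exp.comp (hw.comp measurable_fst)))) measurable_const
  intro U hU
  have hU' : MeasurableSet[MeasurableSpace.comap coords inferInstance] U :=
    param_measurableSpace ▸ hU
  obtain ⟨V, hV, rfl⟩ := hU'
  exact h₁ hV

/-- The closed subset `q * exp (∑ 1 / a) ≤ 1` of the compact space, stated through partial sums. It
contains the approximate parameters. -/
def support : Set ((ℕ → Bool) × unitInterval) :=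
  {x | x.1 0 = false ∧ ∀ m, (x.2 : ℝ) * Real.exp (∑ a ∈ Finset.range m, weight x.1 a) ≤ 1}

theorem isClosed_support : IsClosed support := by
  have h₁ : IsClosed {x : (ℕ → Bool) × unitInterval | x.1 0 = false} :=
    isClosed_eq ((continuous_apply 0).comp continuous_fst) continuous_const
  have h₂ : ∀ m, IsClosed {x : (ℕ → Bool) × unitInterval |
      (x.2 : ℝ) * Real.exp (∑ a ∈ Finset.range m, weight x.1 a) ≤ 1} := fun m =>
    isClosed_le ((continuous_subtype_val.comp continuous_snd).mul (Real.continuous_exp.comp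
      (continuous_finsetSum _ fun a _ => (continuous_weight a).comp continuous_fst)))
      continuous_const
  have : support = {x | x.1 0 = false} ∩ ⋂ m, {x |
      (x.2 : ℝ) * Real.exp (∑ a ∈ Finset.range m, weight x.1 a) ≤ 1} := by
    ext x; simp [support]
  rw [this]
  exact h₁.inter (isClosed_iInter h₂)

theorem approxParam_mem_support (N : ℕ) (O : Orders) : approxParam N O ∈ support := by
  refine ⟨zerosOf_recWord_zero (isCode_code O N), fun m => ?_⟩
  simp only [approxParam]
  rw [← Real.exp_add, Real.exp_le_one_iff]
  have hA : Summable (weight (zerosOf (recWord (code O N)))) :=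
    summable_of_ne_finset_zero (s := Finset.range N) fun i hi => by
      simp [weight, zerosOf_recWord_of_le (c := code O N) (i := i) (by simpa using hi)]
  have := hA.sum_le_tsum (Finset.range m) fun a _ => weight_nonneg _ a
  unfold totalWeight
  linarith

theorem extMoment_eq_of_mem_support {x : (ℕ → Bool) × unitInterval} (hx : x ∈ support)
    {c : List ℕ} (hc : IsCode c) :
    extMoment c (x.1, (x.2 : ℝ)) = moment (codeProb (paramMeasure (toParam x))) c := by
  rw [moment_paramMeasure _ hc]
  rcases x.2.2.1.eq_or_lt with hq | hq
  · have h₁ : ¬ IsProper x := fun h => h.2.2.1.ne hq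
    rw [toParam, dif_neg h₁, extParam, ← hq, extMoment_zero hc, extMoment_zero hc]
  · have hle : ∀ m, ∑ a ∈ Finset.range m, weight x.1 a ≤ Real.log (x.2 : ℝ)⁻¹ := by
      intro m
      rw [Real.le_log_iff_exp_le (inv_pos.2 hq), inv_eq_one_div, le_div_iff₀ hq, mul_comm]
      exact hx.2 m
    have hA : Summable (weight x.1) :=
      summable_of_sum_range_le (fun a => weight_nonneg _ a) hle
    have hW : totalWeight x.1 ≤ Real.log (x.2 : ℝ)⁻¹ :=
      hA.tsum_le_of_sum_range_le hle
    have h₁ : IsProper x := by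
      refine ⟨hx.1, hA, hq, ?_⟩
      rw [Real.le_log_iff_exp_le (inv_pos.2 hq), inv_eq_one_div, le_div_iff₀ hq, mul_comm] at hW
      exact hW
    rw [toParam, dif_pos h₁, extParam, nonRecords_alphaOf]
    simp only
    rw [mul_assoc, ← Real.exp_add, add_neg_cancel, Real.exp_zero, mul_one]

/-! ### Existence of the mixing measure -/

theorem codeProb_bind {X : Type*} [MeasurableSpace X] {μ : Measure X} {κ : X → Measure Orders}
    (hκ : Measurable κ) [∀ x, IsProbabilityMeasure (κ x)] (c : List ℕ) :
    codeProb (μ.bind κ) c = ∫ x, codeProb (κ x) c ∂μ := by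
  rw [codeProb, measureReal_def, Measure.bind_apply (measurableSet_code_eq _ _) hκ.aemeasurable]
  exact (integral_toReal ((Measure.measurable_coe (measurableSet_code_eq _ _)).comp hκ).aemeasurable
    (ae_of_all _ fun x => measure_lt_top _ _)).symm

/-- The mixing measure is a limit point of the laws of the approximate parameters. -/
theorem IsRD.exists_mixture {P : Measure Orders} (hP : IsRD P) :
    ∃ μ : ProbabilityMeasure Param, P = (μ : Measure Param).bind paramMeasure := by
  have := hP.isProbabilityMeasure
  -- a limit point of the laws of the approximate parameters
  let μs : ℕ → ProbabilityMeasure ((ℕ → Bool) × unitInterval) := fun N =>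
    ⟨P.map (approxParam N), Measure.isProbabilityMeasure_map (measurable_approxParam N).aemeasurable⟩
  obtain ⟨ν, -, hν⟩ := isCompact_univ.ultrafilter_le_nhds ((hyperfilter ℕ).map μs) (by simp)
  have hν : Tendsto μs (hyperfilter ℕ) (𝓝 ν) := hν
  have hatTop : (hyperfilter ℕ : Filter ℕ) ≤ atTop := by
    rw [← Nat.cofinite_eq_atTop]
    exact hyperfilter_le_cofinite
  have hsupp : ∀ᵐ x ∂(ν : Measure ((ℕ → Bool) × unitInterval)), x ∈ support := by
    refine (prob_compl_eq_zero_iff isClosed_support.measurableSet).2 ?_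
    refine le_antisymm prob_le_one (le_trans ?_
      (ProbabilityMeasure.limsup_measure_closed_le_of_tendsto hν isClosed_support))
    have h₁ : ∀ N, (μs N : Measure ((ℕ → Bool) × unitInterval)) support = 1 := fun N => by
      change P.map (approxParam N) support = 1
      rw [Measure.map_apply (measurable_approxParam N) isClosed_support.measurableSet,
        show approxParam N ⁻¹' support = univ from
          eq_univ_of_forall (approxParam_mem_support N), measure_univ]
    simp_rw [h₁]
    exact (limsup_const _).ge
  have hmom : ∀ c, IsCode c →
      ∫ x, extMoment c (x.1, (x.2 : ℝ)) ∂(ν : Measure ((ℕ → Bool) × unitInterval)) =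
        moment (codeProb P) c := by
    intro c hc
    have hcont : Continuous fun x : (ℕ → Bool) × unitInterval => extMoment c (x.1, (x.2 : ℝ)) :=
      (continuous_extMoment c).comp (continuous_fst.prodMk
        (continuous_subtype_val.comp continuous_snd))
    have h₁ := (ProbabilityMeasure.tendsto_iff_forall_integral_tendsto.1 hν)
      (BoundedContinuousFunction.mkOfCompact ⟨_, hcont⟩)
    refine tendsto_nhds_unique h₁ (tendsto_const_nhds.congr' ?_)
    filter_upwards [hatTop (eventually_ge_atTop c.length)] with N hN
    rw [← hP.integral_extMoment hc hN]
    exact (integral_map (measurable_approxParam N).aemeasurable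
      hcont.measurable.aestronglyMeasurable).symm
  refine ⟨⟨(ν : Measure ((ℕ → Bool) × unitInterval)).map toParam,
    Measure.isProbabilityMeasure_map measurable_toParam.aemeasurable⟩, ?_⟩
  rw [ProbabilityMeasure.coe_mk]
  have hprob : IsProbabilityMeasure
      (((ν : Measure ((ℕ → Bool) × unitInterval)).map toParam).bind paramMeasure) := by
    have : IsProbabilityMeasure ((ν : Measure ((ℕ → Bool) × unitInterval)).map toParam) :=
      Measure.isProbabilityMeasure_map measurable_toParam.aemeasurable
    constructor
    rw [Measure.bind_apply MeasurableSet.univ measurable_paramMeasure.aemeasurable]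
    simp
  refine eq_of_codeProb_eq fun c hc => eq_of_moment_eq (fun c hc => ?_) hc
  have hint : ∀ k, Integrable (fun ω => codeProb (paramMeasure ω) (c.drop k))
      ((ν : Measure ((ℕ → Bool) × unitInterval)).map toParam) := by
    intro k
    have : IsProbabilityMeasure ((ν : Measure ((ℕ → Bool) × unitInterval)).map toParam) :=
      Measure.isProbabilityMeasure_map measurable_toParam.aemeasurable
    refine Integrable.of_bound (C := 1) ?_ (ae_of_all _ fun ω => ?_)
    · exact ((Measure.measurable_coe (measurableSet_code_eq _ _)).comp
        measurable_paramMeasure).ennreal_toReal.aestronglyMeasurable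
    · refine (Real.norm_of_nonneg measureReal_nonneg).le.trans ?_
      exact measureReal_le_one
  simp only [funext (codeProb_bind measurable_paramMeasure)]
  rw [moment_integral hint, integral_map measurable_toParam.aemeasurable, ← hmom c hc]
  · refine integral_congr_ae ?_
    filter_upwards [hsupp] with x hx
    exact extMoment_eq_of_mem_support hx hc
  · simp only [moment_paramMeasure _ hc]
    exact ((continuous_extMoment c).measurable.comp measurable_extParam).aestronglyMeasurable

/-! ### Recovering the parameter from a sample -/

/-- The number of predecessors of a letter, possibly infinite. -/
def predCount (O : Orders) (x : ℕ) : ℕ∞ := {k | O.Prec k x}.encard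

/-- The letter in position `j` exists and is smaller than one of its predecessors, i.e. `j` is not a
record position. -/
def IsNonRecordPos (O : Orders) (j : ℕ) : Prop :=
  ∃ x y, predCount O x = (j : ℕ∞) ∧ O.Prec y x ∧ x < y

open Classical in
/-- The statistic that recovers the parameter of a sample: the set of its non-record positions and
the upper density of the set of letters with finitely many predecessors (the density need not exist
for every order). -/
def statistic (O : Orders) : (ℕ → Bool) × ℝ :=
  (fun j => decide (IsNonRecordPos O j),
    limsup (fun n : ℕ => (∑ i ∈ Finset.range n, if predCount O i ≠ ⊤ then (1 : ℝ) else 0) / n) atTop)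

theorem measurableSet_predCount_eq (x j : ℕ) :
    MeasurableSet {O : Orders | predCount O x = (j : ℕ∞)} := by
  have : {O : Orders | predCount O x = (j : ℕ∞)} =
      ⋃ S : Finset ℕ, {O | S.card = j ∧ ∀ k, O.Prec k x ↔ k ∈ S} := by
    ext O
    simp only [mem_ofPred_eq, mem_iUnion, predCount]
    constructor
    · intro h
      have hf : {k | O.Prec k x}.Finite := finite_of_encard_eq_coe h
      refine ⟨hf.toFinset, ?_, fun k => by simp⟩
      rw [hf.encard_eq_coe_toFinset_card] at h
      exact_mod_cast h
    · rintro ⟨S, hS, h⟩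
      have : {k | O.Prec k x} = S := by ext k; simpa using h k
      rw [this, encard_coe_eq_coe_finsetCard, hS]
  rw [this]
  refine MeasurableSet.iUnion fun S => (MeasurableSet.const _).inter
    (s₂ := {O : Orders | ∀ k, O.Prec k x ↔ k ∈ S}) ?_
  simp only [ofPred_forall]
  refine MeasurableSet.iInter fun k => ?_
  by_cases hk : k ∈ S
  · simpa [hk] using measurableSet_prec k x
  · simpa [hk, compl_def] using (measurableSet_prec k x).compl

theorem measurableSet_predCount_ne_top (x : ℕ) :
    MeasurableSet {O : Orders | predCount O x ≠ ⊤} := by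
  have : {O : Orders | predCount O x ≠ ⊤} = ⋃ j : ℕ, {O | predCount O x = (j : ℕ∞)} := by
    ext O
    simp only [mem_ofPred_eq, mem_iUnion, ENat.ne_top_iff_exists, eq_comm]
  rw [this]
  exact MeasurableSet.iUnion fun j => measurableSet_predCount_eq x j

theorem measurableSet_isNonRecordPos (j : ℕ) : MeasurableSet {O | IsNonRecordPos O j} := by
  simp only [IsNonRecordPos, ofPred_exists]
  exact MeasurableSet.iUnion fun x => MeasurableSet.iUnion fun y =>
    (measurableSet_predCount_eq x j).inter ((measurableSet_prec y x).inter (MeasurableSet.const _))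

theorem measurable_statistic : Measurable statistic := by
  classical
  refine Measurable.prodMk (measurable_pi_lambda _ fun j => ?_) (Measurable.limsup fun n => ?_)
  · exact measurable_to_bool (by
      simpa [preimage] using measurableSet_isNonRecordPos j)
  · exact (Finset.measurable_sum _ fun i _ => Measurable.ite (measurableSet_predCount_ne_top i)
      measurable_const measurable_const).div_const _

/-- The strong law of large numbers for relative frequencies. -/
theorem ae_tendsto_frequency {X : Type*} [MeasurableSpace X] (μ : Measure X)
    [IsProbabilityMeasure μ] {B : Set X} (hB : MeasurableSet B) :
    ∀ᵐ ξ ∂(Measure.infinitePi fun _ : ℕ => μ),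
      Tendsto (fun n : ℕ => (∑ i ∈ Finset.range n, B.indicator (fun _ => (1 : ℝ)) (ξ i)) / n) atTop
        (𝓝 (μ.real B)) := by
  have hm : Measurable (B.indicator fun _ => (1 : ℝ)) := measurable_const.indicator hB
  have hmp := measurePreserving_eval_infinitePi (fun _ : ℕ => μ)
  have h := ProbabilityTheory.strong_law_ae_real (μ := Measure.infinitePi fun _ : ℕ => μ)
    (fun i ξ => B.indicator (fun _ => (1 : ℝ)) (ξ i)) ?_ ?_ ?_
  · have hmean : ∫ ξ, B.indicator (fun _ => (1 : ℝ)) (ξ 0) ∂(Measure.infinitePi fun _ : ℕ => μ) =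
        μ.real B := by
      have h := integral_map (μ := Measure.infinitePi fun _ => μ) (hmp 0).measurable.aemeasurable
        (f := B.indicator fun _ => (1 : ℝ)) hm.aestronglyMeasurable
      rw [(hmp 0).map_eq] at h
      exact h.symm.trans (integral_indicator_one hB)
    rw [hmean] at h
    exact h
  · exact Integrable.of_bound (C := 1) (hm.comp (measurable_pi_apply 0)).aestronglyMeasurable
      (ae_of_all _ fun ξ => by
        by_cases h : ξ 0 ∈ B <;> simp [h])
  · intro i j hij
    exact (ProbabilityTheory.iIndepFun_infinitePi (P := fun _ : ℕ => μ)
      (X := fun _ => B.indicator fun _ => (1 : ℝ)) fun _ => hm).indepFun hij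
  · intro i
    have h₀ := fun i => (hmp i).map_eq
    refine ⟨(hm.comp (measurable_pi_apply i)).aemeasurable,
      (hm.comp (measurable_pi_apply 0)).aemeasurable, ?_⟩
    have h₁ : ∀ i, Measure.map (fun ξ : ℕ → X => B.indicator (fun _ => (1 : ℝ)) (ξ i))
        (Measure.infinitePi fun _ => μ) = μ.map (B.indicator fun _ => 1) := fun i => by
      conv_rhs => rw [← h₀ i, Measure.map_map hm (hmp i).measurable]
      rfl
    rw [h₁, h₁]

theorem infinite_of_tendsto_frequency {X : Type*} {B : Set X} {ξ : ℕ → X} {q : ℝ} (hq : 0 < q)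
    (h : Tendsto (fun n : ℕ => (∑ i ∈ Finset.range n, B.indicator (fun _ => (1 : ℝ)) (ξ i)) / n)
      atTop (𝓝 q)) : {i | ξ i ∈ B}.Infinite := by
  intro hf
  refine hq.ne' (tendsto_nhds_unique h ?_)
  refine squeeze_zero (g := fun n : ℕ => (hf.toFinset.card : ℝ) / n) (fun n => ?_) (fun n => ?_)
    (tendsto_const_div_atTop_nhds_zero_nat _)
  · exact div_nonneg (Finset.sum_nonneg fun i _ => indicator_nonneg (fun _ _ => zero_le_one) _)
      n.cast_nonneg
  · gcongr
    calc ∑ i ∈ Finset.range n, B.indicator (fun _ => (1 : ℝ)) (ξ i)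
        = ∑ i ∈ Finset.range n, if i ∈ hf.toFinset then (1 : ℝ) else 0 := by
          refine Finset.sum_congr rfl fun i _ => ?_
          by_cases hi : ξ i ∈ B <;> simp [hi]
      _ ≤ hf.toFinset.card := by
          rw [Finset.sum_boole]
          exact_mod_cast Finset.card_le_card fun i hi => (Finset.mem_filter.1 hi).2

/-- Almost surely no variable is `0`, and infinitely many variables are smaller than any given
positive number. -/
theorem ae_predCount_exchangeable : ∀ᵐ O ∂exchangeable, ∀ x, predCount O x = ⊤ := by
  have hm : MeasurableSet {O : Orders | ∀ x, predCount O x = ⊤} := by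
    simp only [ofPred_forall]
    refine MeasurableSet.iInter fun x => ?_
    convert (measurableSet_predCount_ne_top x).compl using 1
    ext O; simp
  rw [exchangeable, ae_map_iff measurable_orderOfReals.aemeasurable hm]
  have h₁ : ∀ᵐ ξ ∂(Measure.infinitePi fun _ : ℕ => (volume : Measure unitInterval)),
      ∀ x, ξ x ≠ 0 := by
    rw [ae_all_iff]
    intro x
    refine (measurePreserving_eval_infinitePi (fun _ : ℕ => (volume : Measure unitInterval))
      x).quasiMeasurePreserving.ae (p := fun t => t ≠ 0) ?_
    rw [ae_iff]
    simp
  have h₂ : ∀ᵐ ξ ∂(Measure.infinitePi fun _ : ℕ => (volume : Measure unitInterval)),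
      ∀ m : ℕ, {i | (ξ i : ℝ) < 1 / (m + 1)}.Infinite := by
    rw [ae_all_iff]
    intro m
    have hm : (0 : ℝ) < 1 / (m + 1) := Nat.one_div_pos_of_nat
    let t : unitInterval := ⟨1 / (m + 1), hm.le, by
      rw [div_le_one (by positivity)]
      exact le_add_of_nonneg_left m.cast_nonneg⟩
    filter_upwards [ae_tendsto_frequency (volume : Measure unitInterval)
      (measurableSet_Iio (a := t))] with ξ hξ
    refine infinite_of_tendsto_frequency ?_ hξ
    rw [measureReal_def, unitInterval.volume_Iio, ENNReal.toReal_ofReal t.2.1]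
    exact hm
  filter_upwards [h₁, h₂] with ξ h₁ h₂ x
  have hx : 0 < (ξ x : ℝ) := lt_of_le_of_ne (ξ x).2.1 fun h => h₁ x (Subtype.ext h.symm)
  obtain ⟨m, hm⟩ := exists_nat_one_div_lt hx
  rw [predCount, encard_eq_top_iff]
  refine (h₂ m).mono fun i hi => ?_
  rw [mem_ofPred_eq, prec_orderOfReals]
  exact Or.inl (Subtype.coe_lt_coe.1 (lt_trans hi hm))

theorem predCount_orderOfPerm (σ : Equiv.Perm ℕ) (x : ℕ) :
    predCount (orderOfPerm σ) x = (σ.symm x : ℕ∞) := by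
  have : {k | (orderOfPerm σ).Prec k x} = σ '' (Finset.range (σ.symm x) : Set ℕ) := by
    ext k
    simp only [mem_ofPred_eq, prec_orderOfPerm, mem_image, Finset.coe_range, mem_Iio]
    constructor
    · intro h
      exact ⟨_, h, by simp⟩
    · rintro ⟨i, hi, rfl⟩
      simpa using hi
  rw [predCount, this, σ.injective.encard_image, encard_coe_eq_coe_finsetCard, Finset.card_range]

theorem isNonRecordPos_orderOfPerm (σ : Equiv.Perm ℕ) (j : ℕ) :
    IsNonRecordPos (orderOfPerm σ) j ↔ ∃ i < j, σ j < σ i := by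
  simp only [IsNonRecordPos, predCount_orderOfPerm, prec_orderOfPerm, Nat.cast_inj]
  constructor
  · rintro ⟨x, y, rfl, h₁, h₂⟩
    exact ⟨σ.symm y, h₁, by simpa using h₂⟩
  · rintro ⟨i, hi, h⟩
    exact ⟨σ j, σ i, by simp, by simpa using hi, h⟩

/-- Under `P^(α, 1)` the order has type `ω` and the non-record positions are the entries of `α`. -/
theorem ae_alphaOne (α : AlphaSeq) : ∀ᵐ O ∂(alphaOne α), (∀ x, predCount O x ≠ ⊤) ∧
    ∀ j, IsNonRecordPos O j ↔ nonRecords α j = true := by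
  have hm : MeasurableSet {O : Orders | (∀ x, predCount O x ≠ ⊤) ∧
      ∀ j, IsNonRecordPos O j ↔ nonRecords α j = true} := by
    refine MeasurableSet.inter (s₁ := {O : Orders | ∀ x, predCount O x ≠ ⊤})
      (s₂ := {O : Orders | ∀ j, IsNonRecordPos O j ↔ nonRecords α j = true}) ?_ ?_
    · simp only [ofPred_forall]
      exact MeasurableSet.iInter fun x => measurableSet_predCount_ne_top x
    · simp only [ofPred_forall]
      refine MeasurableSet.iInter fun j => ?_
      by_cases h : nonRecords α j = true
      · simpa [h] using measurableSet_isNonRecordPos j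
      · simpa [h, compl_def] using (measurableSet_isNonRecordPos j).compl
  rw [alphaOne_eq, ae_map_iff measurable_orderOfRanks.aemeasurable hm]
  filter_upwards [rankMeasure_ae (nonRecords α), ae_exists_isLimitPerm (summable_weight α)]
    with r h₁ ⟨σ, hσ⟩
  rw [orderOfRanks_eq hσ]
  refine ⟨fun x => by simp [predCount_orderOfPerm], fun j => ?_⟩
  rw [isNonRecordPos_orderOfPerm, ← hσ.lt_iff fun i => (h₁ i).1, (h₁ j).2]
  refine ⟨fun h => h.2, fun h => ⟨?_, h⟩⟩
  rintro rfl
  rw [nonRecords_zero] at h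
  exact Bool.false_ne_true h

theorem exists_classIndex_eq {ε : ℕ → Bool} {b : Bool} (hε : {i | ε i = b}.Infinite) (m : ℕ) :
    ∃ x, ε x = b ∧ classIndex ε x = m := by
  have hx := Nat.nth_mem_of_infinite hε m
  refine ⟨Nat.nth (fun i => ε i = b) m, hx, ?_⟩
  rw [classIndex, hx, Nat.count_nth_of_infinite hε]

/-- Letters in `N₁` have the same number of predecessors in the merged order as in the order on
`N₁`, since `N₁` precedes `N₂`. -/
theorem predCount_merge_of_true {x : (ℕ → Bool) × Orders × Orders}
    (hε : {i | x.1 i = true}.Infinite) {i : ℕ} (hi : x.1 i = true) : predCount (merge x) i = predCount x.2.1 (classIndex x.1 i) := by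
  have hinj : InjOn (classIndex x.1) {k | (merge x).Prec k i} := by
    intro j hj k hk hjk
    refine classIndex_inj ?_ hjk
    rw [mem_ofPred_eq, prec_merge, MergeRel] at hj hk
    simp only [hi, Bool.true_eq_false, and_false, false_and, true_and, false_or, or_false] at hj hk
    rw [hj.1, hk.1]
  rw [predCount, ← hinj.encard_image, predCount]
  congr 1
  ext m
  simp only [mem_image, mem_ofPred_eq, prec_merge, MergeRel, hi, Bool.true_eq_false, and_false,
    false_and, true_and, false_or, or_false]
  constructor
  · rintro ⟨k, hk, rfl⟩
    exact hk.2
  · intro hm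
    obtain ⟨k, hk, rfl⟩ := exists_classIndex_eq hε m
    exact ⟨k, ⟨hk, hm⟩, rfl⟩

theorem predCount_merge_of_false {x : (ℕ → Bool) × Orders × Orders}
    (hε : {i | x.1 i = true}.Infinite) {i : ℕ} (hi : x.1 i = false) :
    predCount (merge x) i = ⊤ := by
  rw [predCount, encard_eq_top_iff]
  refine hε.mono fun k hk => ?_
  rw [mem_ofPred_eq, prec_merge]
  exact Or.inl ⟨hk, hi⟩

theorem isNonRecordPos_merge {x : (ℕ → Bool) × Orders × Orders}
    (hε : {i | x.1 i = true}.Infinite) (j : ℕ) :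
    IsNonRecordPos (merge x) j ↔ IsNonRecordPos x.2.1 j := by
  constructor
  · rintro ⟨i, k, hi, hk, hik⟩
    cases hi₁ : x.1 i with
    | false =>
      rw [predCount_merge_of_false hε hi₁] at hi
      exact absurd hi.symm (ENat.natCast_ne_top j)
    | true =>
      rw [predCount_merge_of_true hε hi₁] at hi
      simp only [prec_merge, MergeRel, hi₁, Bool.true_eq_false, and_false,
        false_and, true_and, false_or, or_false] at hk
      exact ⟨_, _, hi, hk.2, classIndex_lt (hi₁.trans hk.1.symm) hik⟩
  · rintro ⟨i, k, hi, hk, hik⟩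
    obtain ⟨i, hi₁, rfl⟩ := exists_classIndex_eq hε i
    obtain ⟨k, hk₁, rfl⟩ := exists_classIndex_eq hε k
    refine ⟨i, k, (predCount_merge_of_true hε hi₁).trans hi, ?_,
      (classIndex_lt_iff (hi₁.trans hk₁.symm)).1 hik⟩
    rw [prec_merge]
    exact Or.inr (Or.inl ⟨hk₁, hi₁, hk⟩)

/-- Under `P^ω` the statistic is almost surely constant, with value the coordinates of `ω`. -/
theorem ae_statistic (ω : Param) : ∀ᵐ O ∂(paramMeasure ω), statistic O = coords ω := by
  classical
  cases ω with
  | star =>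
    filter_upwards [show ∀ᵐ O ∂(paramMeasure Param.star), ∀ x, predCount O x = ⊤ from
      ae_predCount_exchangeable] with O hO
    simp [statistic, coords, hO, IsNonRecordPos]
  | pair α p =>
    have hp : (0 : ℝ) < ((p : unitInterval) : ℝ) := p.2
    have hm : MeasurableSet {O | statistic O = coords (Param.pair α p)} :=
      measurable_statistic (measurableSet_singleton _)
    rw [paramMeasure, alphaP, ae_map_iff measurable_merge.aemeasurable hm]
    have h₁ : ∀ᵐ x ∂((Measure.infinitePi fun _ : ℕ =>
        ProbabilityTheory.bernoulliMeasure true false (p : unitInterval)).prod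
        ((alphaOne α).prod exchangeable)),
        Tendsto (fun n : ℕ =>
          (∑ i ∈ Finset.range n, ({true} : Set Bool).indicator (fun _ => (1 : ℝ)) (x.1 i)) / n)
          atTop (𝓝 ((p : unitInterval) : ℝ)) := by
      have h := ae_tendsto_frequency
        (ProbabilityTheory.bernoulliMeasure true false (p : unitInterval))
        (measurableSet_singleton true)
      rw [ProbabilityTheory.bernoulliMeasure_real_apply_of_mem_of_notMem _
        (measurableSet_singleton true) (by simp) (by simp)] at h
      exact Measure.quasiMeasurePreserving_fst.ae h
    have h₂ : ∀ᵐ x ∂((Measure.infinitePi fun _ : ℕ =>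
        ProbabilityTheory.bernoulliMeasure true false (p : unitInterval)).prod
        ((alphaOne α).prod exchangeable)), (∀ k, predCount x.2.1 k ≠ ⊤) ∧
          ∀ j, IsNonRecordPos x.2.1 j ↔ nonRecords α j = true :=
      Measure.quasiMeasurePreserving_snd.ae (Measure.quasiMeasurePreserving_fst.ae (ae_alphaOne α))
    filter_upwards [h₁, h₂] with x h₁ h₂
    have hε : {i | x.1 i = true}.Infinite := infinite_of_tendsto_frequency hp h₁
    refine Prod.ext (funext fun j => ?_) ?_
    · simp only [statistic, coords, isNonRecordPos_merge hε, h₂.2]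
      simp
    · have h₃ : ∀ i, (if predCount (merge x) i ≠ ⊤ then (1 : ℝ) else 0) =
          ({true} : Set Bool).indicator (fun _ => (1 : ℝ)) (x.1 i) := by
        intro i
        cases hi : x.1 i with
        | false => simp [predCount_merge_of_false hε hi]
        | true => rw [predCount_merge_of_true hε hi, if_pos (h₂.1 _)]; simp
      simp only [statistic, coords, h₃]
      exact h₁.limsup_eq

/-! ### Uniqueness of the mixing measure -/

/-- The law of the statistic under a mixture is the image of the mixing measure under `coords`. -/
theorem mixture_preimage_statistic (μ : Measure Param) {V : Set ((ℕ → Bool) × ℝ)}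
    (hV : MeasurableSet V) : μ.bind paramMeasure (statistic ⁻¹' V) = μ (coords ⁻¹' V) := by
  have h : ∀ ω, paramMeasure ω (statistic ⁻¹' V) = (coords ⁻¹' V).indicator 1 ω := by
    intro ω
    have : paramMeasure ω (statistic ⁻¹' V) = paramMeasure ω {_O | coords ω ∈ V} := by
      refine measure_congr ?_
      filter_upwards [ae_statistic ω] with O hO
      apply propext
      change statistic O ∈ V ↔ coords ω ∈ V
      rw [hO]
    rw [this]
    by_cases hω : coords ω ∈ V
    · rw [indicator_of_mem (by exact hω)]
      simp [hω]
    · rw [indicator_of_notMem (by exact hω)]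
      simp [hω]
  rw [Measure.bind_apply (measurable_statistic hV) measurable_paramMeasure.aemeasurable]
  simp_rw [h]
  exact lintegral_indicator_one (measurable_coords hV)

/-- The mixing measure is unique, as the coordinates generate the σ-algebra. -/
theorem mixture_injective : Function.Injective fun μ : Measure Param => μ.bind paramMeasure := by
  intro μ ν h
  ext U hU
  have hU' : MeasurableSet[MeasurableSpace.comap coords inferInstance] U :=
    param_measurableSpace ▸ hU
  obtain ⟨V, hV, rfl⟩ := hU'
  rw [← mixture_preimage_statistic μ hV, ← mixture_preimage_statistic ν hV]
  exact congrArg (fun P : Measure Orders => P (statistic ⁻¹' V)) h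

/-! ### Extreme points -/

theorem bind_add_left {X Y : Type*} [MeasurableSpace X] [MeasurableSpace Y] (μ ν : Measure X)
    {κ : X → Measure Y} (hκ : Measurable κ) :
    (μ + ν).bind κ = μ.bind κ + ν.bind κ := by
  ext s hs
  rw [Measure.add_apply, Measure.bind_apply hs hκ.aemeasurable,
    Measure.bind_apply hs hκ.aemeasurable, Measure.bind_apply hs hκ.aemeasurable,
    lintegral_add_measure]

theorem isRD_mixture (μ : Measure Param) [IsProbabilityMeasure μ] :
    IsRD (μ.bind paramMeasure) := by
  rw [isRD_iff]
  refine ⟨⟨?_⟩, fun c c' hc hc' h => ?_⟩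
  · rw [Measure.bind_apply MeasurableSet.univ measurable_paramMeasure.aemeasurable]
    simp
  · rw [Measure.bind_apply (measurableSet_code_eq _ _) measurable_paramMeasure.aemeasurable,
      Measure.bind_apply (measurableSet_code_eq _ _) measurable_paramMeasure.aemeasurable]
    exact lintegral_congr fun ω => ((isRD_iff _).1 (isRD_paramMeasure ω)).2 c c' hc hc' h

/-- A probability measure on the parameter space with values in `{0, 1}` is a point mass. -/
theorem exists_eq_dirac_of_zero_one {μ : Measure Param} [IsProbabilityMeasure μ]
    (h : ∀ U, MeasurableSet U → μ U = 0 ∨ μ U = 1) : ∃ ω, μ = Measure.dirac ω := by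
  have hprob : IsProbabilityMeasure (μ.map coords) :=
    Measure.isProbabilityMeasure_map measurable_coords.aemeasurable
  have h01 : IsZeroOneMeasure (μ.map coords) := ⟨fun V hV => by
    rw [Measure.map_apply measurable_coords hV]
    exact h _ (measurable_coords hV)⟩
  obtain ⟨x, hx⟩ := IsZeroOneMeasure.exists_eq_dirac (μ := μ.map coords)
  have happly : ∀ V, MeasurableSet V → μ (coords ⁻¹' V) = Measure.dirac x V := fun V hV => by
    rw [← hx, Measure.map_apply measurable_coords hV]
  have hne : (coords ⁻¹' {x}).Nonempty := by
    refine nonempty_of_measure_ne_zero (μ := μ) ?_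
    rw [happly _ (measurableSet_singleton x)]
    simp
  obtain ⟨ω, hω⟩ := hne
  refine ⟨ω, Measure.ext fun U hU => ?_⟩
  have hU' : MeasurableSet[MeasurableSpace.comap coords inferInstance] U :=
    param_measurableSpace ▸ hU
  obtain ⟨V, hV, rfl⟩ := hU'
  have hω : coords ω = x := hω
  rw [happly V hV, Measure.dirac_apply' _ hV, Measure.dirac_apply' _ hU, ← hω]
  rfl

/-- If the mixtures by `μ₁` and `μ₂` average to `P^ω`, then `μ₁` and `μ₂` average to the point mass at
`ω`, hence they are equal to it. -/
theorem paramMeasure_mem_extremePoints (ω : Param) :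
    paramMeasure ω ∈ extremePoints ℝ≥0 {P : Measure Orders | IsRD P} := by
  refine ⟨isRD_paramMeasure ω, ?_⟩
  rintro P₁ hP₁ P₂ hP₂ ⟨a, b, ha, hb, -, h⟩
  obtain ⟨μ₁, rfl⟩ := IsRD.exists_mixture hP₁
  obtain ⟨μ₂, rfl⟩ := IsRD.exists_mixture hP₂
  have h₁ : a • (μ₁ : Measure Param) + b • (μ₂ : Measure Param) = Measure.dirac ω := by
    refine mixture_injective ?_
    simp only [bind_add_left _ _ measurable_paramMeasure, Measure.bind_smul,
      Measure.dirac_bind measurable_paramMeasure]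
    exact h
  have h₂ : ∀ U, MeasurableSet U → ω ∉ U → (μ₁ : Measure Param) U = 0 := by
    intro U hU hω
    have h₃ := congrArg (fun μ : Measure Param => μ U) h₁
    simp only [Measure.add_apply, Measure.dirac_apply' _ hU, indicator_of_notMem hω,
      add_eq_zero, Measure.smul_apply] at h₃
    have h₄ : (a : ℝ≥0∞) * (μ₁ : Measure Param) U = 0 := h₃.1
    rcases mul_eq_zero.1 h₄ with h₄ | h₄
    · exact absurd (ENNReal.coe_eq_zero.1 h₄) ha.ne'
    · exact h₄
  have h₃ : (μ₁ : Measure Param) = Measure.dirac ω := by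
    ext U hU
    rw [Measure.dirac_apply' _ hU]
    by_cases hω : ω ∈ U
    · rw [indicator_of_mem hω]
      exact (prob_compl_eq_zero_iff hU).1 (h₂ _ hU.compl fun h => h hω)
    · rw [indicator_of_notMem hω]
      exact h₂ U hU hω
  rw [h₃, Measure.dirac_bind measurable_paramMeasure]

/-- The mixing measure of an extreme point takes only the values `0` and `1`. -/
theorem exists_eq_paramMeasure_of_mem_extremePoints {P : Measure Orders}
    (hP : P ∈ extremePoints ℝ≥0 {P : Measure Orders | IsRD P}) : ∃ ω, paramMeasure ω = P := by
  obtain ⟨μ, rfl⟩ := IsRD.exists_mixture hP.1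
  have h : ∀ U, MeasurableSet U → (μ : Measure Param) U = 0 ∨ (μ : Measure Param) U = 1 := by
    intro U hU
    by_contra! hne
    have h₀ : (μ : Measure Param) Uᶜ ≠ 0 := fun h => hne.2 ((prob_compl_eq_zero_iff hU).1 h)
    -- conditioning on `U` and on its complement splits the mixture
    have p₁ := ProbabilityTheory.cond_isProbabilityMeasure hne.1
    have p₂ := ProbabilityTheory.cond_isProbabilityMeasure h₀
    have hsplit : ((μ : Measure Param) U).toNNReal • ProbabilityTheory.cond (μ : Measure Param) U +
        ((μ : Measure Param) Uᶜ).toNNReal • ProbabilityTheory.cond (μ : Measure Param) Uᶜ = μ := by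
      have hs : ∀ s : Set Param, (μ : Measure Param) s ≠ 0 → ((μ : Measure Param) s).toNNReal •
          ProbabilityTheory.cond (μ : Measure Param) s = (μ : Measure Param).restrict s := by
        intro s hs
        rw [ProbabilityTheory.cond, ENNReal.smul_def,
          ENNReal.coe_toNNReal (measure_ne_top _ _), smul_smul,
          ENNReal.mul_inv_cancel hs (measure_ne_top _ _), one_smul]
      rw [hs U hne.1, hs Uᶜ h₀, Measure.restrict_add_restrict_compl hU]
    have hmem : (μ : Measure Param).bind paramMeasure ∈ openSegment ℝ≥0
        ((ProbabilityTheory.cond (μ : Measure Param) U).bind paramMeasure)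
        ((ProbabilityTheory.cond (μ : Measure Param) Uᶜ).bind paramMeasure) := by
      refine ⟨((μ : Measure Param) U).toNNReal, ((μ : Measure Param) Uᶜ).toNNReal,
        ENNReal.toNNReal_pos hne.1 (measure_ne_top _ _),
        ENNReal.toNNReal_pos h₀ (measure_ne_top _ _), ?_, ?_⟩
      · rw [← ENNReal.toNNReal_add (measure_ne_top _ _) (measure_ne_top _ _),
          measure_add_measure_compl hU, measure_univ, ENNReal.toNNReal_one]
      · rw [← Measure.bind_smul, ← Measure.bind_smul, ← bind_add_left _ _ measurable_paramMeasure,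
          hsplit]
    have heq := mixture_injective (hP.2 (isRD_mixture _) (isRD_mixture _) hmem)
    refine hne.2 ?_
    rw [← heq]
    exact ProbabilityTheory.cond_apply_self hne.1 (measure_ne_top _ _)
  obtain ⟨ω, hω⟩ := exists_eq_dirac_of_zero_one h
  exact ⟨ω, by rw [hω, Measure.dirac_bind measurable_paramMeasure]⟩

end RecordDependent

end

theorem mainTheorem2 :
    -- the measures `P^ω` are exactly the extreme record-dependent measures,
    (Set.range RecordDependent.paramMeasure =
      Set.extremePoints ℝ≥0 {P : Measure RecordDependent.Orders | RecordDependent.IsRD P}) ∧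
    -- they depend measurably on `ω`,
    Measurable RecordDependent.paramMeasure ∧
    -- and every record-dependent measure is a mixture of them in exactly one way
    ∀ P : Measure RecordDependent.Orders, RecordDependent.IsRD P →
      ∃! μ : ProbabilityMeasure RecordDependent.Param,
        P = (μ : Measure RecordDependent.Param).bind RecordDependent.paramMeasure := by
  refine ⟨Subset.antisymm ?_ ?_, RecordDependent.measurable_paramMeasure, fun P hP => ?_⟩
  · rintro _ ⟨ω, rfl⟩
    exact RecordDependent.paramMeasure_mem_extremePoints ω
  · intro P hP
    exact RecordDependent.exists_eq_paramMeasure_of_mem_extremePoints hP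
  · obtain ⟨μ, hμ⟩ := RecordDependent.IsRD.exists_mixture hP
    exact ⟨μ, hμ, fun ν hν => Subtype.ext (RecordDependent.mixture_injective (hν.symm.trans hμ))⟩
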